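/- Let $(M,\Omega)$ be a compact symplectic manifold of real dimension $2m$ with a compatible almost complex structure $J$, let $g(u,v)=\Omega(u,Jv)$, and for $k\ge 1$ let $g_k=kg$. Let $L\to M$ be a Hermitian line bundle with a Hermitian connection of curvature $-i\Omega$, and $E\to M$ a Hermitian vector bundle of rank $n$, $1\le n\le m$, with a Hermitian connection. Let $D^k$ be the induced connection on $E\otimes L^k$, $\Theta_k$ its curvature, and $\bar\partial s=(Ds)^{0,1}$ the $(0,1)$-part with respect to $J$. Let $s_k$ be smooth sections of $E\otimes L^k$, $k\ge 1$, which are asymptotically holomorphic and uniformly transverse, that is: there is a constant $C_1$ independent of $k$ such that on $M$ $$|s_k|\le C_1,\quad |D^ks_k|\le C_1,\quad |D^kD^ks_k|\le C_1,\quad |\bar\partial s_k|\le C_1k^{-1/2},\quad |D^k\bar\partial s_k|\le C_1k^{-1/2},$$ and there are $\eta>0$ and $k_0\ge 1$ such that for all $k\ge k_0$ and all $x\in M$ with $|s_k(x)|\le\eta$ the real linear map $D^ks_k(x):T_xM\to(E\otimes L^k)_x$ is surjective with a right inverse of norm at most $\eta^{-1}$. Here all norms are taken with respect to $g_k$, and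 covariant derivatives of one-forms use the Levi-Civita connection of $g_k$. Let $\sigma_k$ be the Harvey–Lawson potential of $s_k$, the form of degree $2n-1$ on $M\setminus s_k^{-1}(0)$ given in any orthonormal local frame $f=(f_1,\dots,f_n)$ with dual frame $f^*$, $s_k=uf$, $u^*=\bar u^t$, by $$\sigma_k\,\lambda(f)=\frac1{n!}\Big(\frac i{2\pi}\Big)^n f^*\frac{u^*Du}{|u|^2}f\wedge\sum_{j=0}^{n-1}\Big(f^*\Theta_kf-f^*\frac{Du^*\wedge Du}{|u|^2}f\Big)^{j}\wedge\big(f^*\Theta_kf\big)^{n-1-j},\qquad \lambda(f)=f_1^*\wedge f_1\wedge\dots\wedge f_n^*\wedge f_n.$$ Then for every $k\ge k_0$ the form $\sigma_k$ is of class $L^1_{loc}$ on $M$, so that it defines a current $\langle\sigma_k,\psi\rangle=\int_M\sigma_k\wedge\psi$ with $\langle d\sigma_k,\phi\rangle=(-1)^{\deg\sigma_k+1}\langle\sigma_k,d\phi\rangle$; and there is a constant $C>0$, independent of $k$ and of $\phi$, such that for every $k\ge k_0$ and every smooth complex-valued differential form $\phi$ of degree $2m-2n$ on $M$ $$\frac1{k^n}\,|\langle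 d\sigma_k,\phi\rangle|\le C\,k^{-1/2}\,\|d\phi\|_\infty,$$ where $\|\cdot\|_\infty$ is the supremum over $M$ of the pointwise operator norm with respect to the fixed metric $g$. -/

import Mathlib

open Set Filter Topology MeasureTheory Manifold
open scoped ContDiff

noncomputable section

namespace HL

/-! ### Differential forms on a manifold modelled on `ℝ^d` -/

section Forms

variable {d : ℕ} {M : Type*} [TopologicalSpace M] [ChartedSpace (EuclideanSpace ℝ (Fin d)) M]

/-- The inverse of the chart of `M` centred at `c`, as a map from `ℝ^d` to `M`. -/
def param (c : M) (y : EuclideanSpace ℝ (Fin d)) : M := (extChartAt (𝓡 d) c).symm y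

/-- The domain in `ℝ^d` on which the inverse chart centred at `c` lives. -/
def dom (c : M) : Set (EuclideanSpace ℝ (Fin d)) := (extChartAt (𝓡 d) c).target

/-- The differential at `y` of the inverse chart centred at `c`; its value on the `j`-th basis
vector is the coordinate vector field `∂/∂x_j` of this chart. -/
def dparam (c : M) (y : EuclideanSpace ℝ (Fin d)) :
    EuclideanSpace ℝ (Fin d) →L[ℝ] TangentSpace (𝓡 d) (param c y) :=
  mfderiv (𝓡 d) (𝓡 d) (param c) y

variable (d M) in
/-- Differential forms of degree `p` with values in the real vector space `G` (no smoothness). -/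
abbrev DForm (p : ℕ) (G : Type*) [NormedAddCommGroup G] [NormedSpace ℝ G] :=
  ∀ x : M, TangentSpace (𝓡 d) x [⋀^Fin p]→L[ℝ] G

variable (d M) in
/-- One-forms with values in `G`, as fields of linear maps. -/
abbrev OneForm (G : Type*) [NormedAddCommGroup G] [NormedSpace ℝ G] :=
  ∀ x : M, TangentSpace (𝓡 d) x →L[ℝ] G

variable {G : Type*} [NormedAddCommGroup G] [NormedSpace ℝ G] {p : ℕ}

/-- The coordinate expression of a form in the chart centred at `c`. -/
def DForm.inChart (α : DForm d M p G) (c : M) (y : EuclideanSpace ℝ (Fin d)) :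
    EuclideanSpace ℝ (Fin d) [⋀^Fin p]→L[ℝ] G :=
  (α (param c y)).compContinuousLinearMap (dparam c y)

/-- The form `α` is `C^∞` on the open set `U`: its coordinate expressions are. -/
def DForm.SmoothOn (α : DForm d M p G) (U : Set M) : Prop :=
  ∀ c : M, ContDiffOn ℝ ∞ (α.inChart c) (dom c ∩ param c ⁻¹' U)

/-- The exterior derivative, computed at `x` in the chart centred at `x`. -/
def DForm.extD (α : DForm d M p G) : DForm d M (p + 1) G := fun x =>
  (extDeriv (α.inChart x) (extChartAt (𝓡 d) x x)).compContinuousLinearMap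
    (mvfderiv (𝓡 d) (extChartAt (𝓡 d) x) x)

/-- The coordinate expression of a one-form in the chart centred at `c`. -/
def OneForm.inChart (θ : OneForm d M G) (c : M) (y : EuclideanSpace ℝ (Fin d)) :
    EuclideanSpace ℝ (Fin d) →L[ℝ] G :=
  (θ (param c y)) ∘L (dparam c y)

/-- The one-form `θ` is `C^∞` on the open set `U`. -/
def OneForm.SmoothOn (θ : OneForm d M G) (U : Set M) : Prop :=
  ∀ c : M, ContDiffOn ℝ ∞ (θ.inChart c) (dom c ∩ param c ⁻¹' U)

/-- A one-form seen as a differential form of degree `1`. -/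
def OneForm.toDForm (θ : OneForm d M G) : DForm d M 1 G := fun x =>
  ContinuousAlternatingMap.ofSubsingleton ℝ (TangentSpace (𝓡 d) x) G (0 : Fin 1) (θ x)

end Forms

/-! ### Wedge products at a point -/

section Wedge

variable {T : Type*} [AddCommGroup T] [Module ℝ T]

/-- The wedge product of alternating forms with values in an `ℝ`-algebra, with the normalisation
`(α ∧ β)(v₁, …, v_{p+q}) = (1 / (p! q!)) ∑_π sgn π · α(v_{π 1}, …) · β(v_{π (p+1)}, …)`. -/
def wedge {A : Type*} [Ring A] [Module ℝ A] [SMulCommClass ℝ A A] [IsScalarTower ℝ A A] {p q : ℕ}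
    (α : T [⋀^Fin p]→ₗ[ℝ] A) (β : T [⋀^Fin q]→ₗ[ℝ] A) : T [⋀^Fin (p + q)]→ₗ[ℝ] A :=
  ((LinearMap.mul' ℝ A).compAlternatingMap (α.domCoprod β)).domDomCongr finSumFinEquiv

/-- The `m`-th exterior power `Ω ∧ ⋯ ∧ Ω` of a two-form. -/
def twoFormPow (Ω : T [⋀^Fin 2]→ₗ[ℝ] ℝ) : ∀ m : ℕ, T [⋀^Fin (2 * m)]→ₗ[ℝ] ℝ
  | 0 => AlternatingMap.constOfIsEmpty ℝ T (Fin 0) 1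
  | m + 1 => wedge (p := 2 * m) (q := 2) (twoFormPow Ω m) Ω

/-- The product `α ∧ β₀ ∧ ⋯ ∧ β_{r-1}` of a one-form and `r` two-forms. -/
def wedgeList (α : T [⋀^Fin 1]→ₗ[ℝ] ℂ) :
    ∀ r : ℕ, (Fin r → T [⋀^Fin 2]→ₗ[ℝ] ℂ) → T [⋀^Fin (2 * r + 1)]→ₗ[ℝ] ℂ
  | 0, _ => α
  | r + 1, β => wedge (p := 2 * r + 1) (q := 2) (wedgeList α r fun j => β j.castSucc) (β (Fin.last r))

/-- A linear functional as an alternating form of degree one. -/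
def toForm {A : Type*} [AddCommGroup A] [Module ℝ A] (f : T →ₗ[ℝ] A) : T [⋀^Fin 1]→ₗ[ℝ] A :=
  AlternatingMap.ofSubsingleton ℝ T A (0 : Fin 1) f

end Wedge


/-! ### Almost Kähler manifolds -/

section AlmostKahler

/-- A symplectic form with a compatible almost complex structure on a manifold of real
dimension `2m`. -/
structure AlmostKahler (m : ℕ) (M : Type*) [TopologicalSpace M]
    [ChartedSpace (EuclideanSpace ℝ (Fin (2 * m))) M] where
  /-- The symplectic form. -/
  Ω : DForm (2 * m) M 2 ℝ
  /-- The almost complex structure. -/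
  J : ∀ x : M, TangentSpace (𝓡 (2 * m)) x →L[ℝ] TangentSpace (𝓡 (2 * m)) x
  smooth_Ω : Ω.SmoothOn univ
  closed_Ω : ∀ x, Ω.extD x = 0
  smooth_J : ∀ c : M, ContDiffOn ℝ ∞
    (fun y => mvfderiv (𝓡 (2 * m)) (extChartAt (𝓡 (2 * m)) c) (param c y) ∘L
      (J (param c y) ∘L dparam c y) :
      EuclideanSpace ℝ (Fin (2 * m)) →
        EuclideanSpace ℝ (Fin (2 * m)) →L[ℝ] EuclideanSpace ℝ (Fin (2 * m))) (dom c)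
  J_sq : ∀ x v, J x (J x v) = -v
  compatible : ∀ x v w, Ω x ![J x v, J x w] = Ω x ![v, w]
  pos : ∀ x v, v ≠ 0 → 0 < Ω x ![v, J x v]

variable {m : ℕ} {M : Type*} [TopologicalSpace M]
  [ChartedSpace (EuclideanSpace ℝ (Fin (2 * m))) M] (K : AlmostKahler m M)

namespace AlmostKahler

/-- The Riemannian metric `g(v, w) = Ω(v, J w)`. -/
def g (x : M) (v w : TangentSpace (𝓡 (2 * m)) x) : ℝ := K.Ω x ![v, K.J x w]

/-- The length of a tangent vector for the dilated metric `g_k = k g`. -/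
def len (k : ℕ) (x : M) (v : TangentSpace (𝓡 (2 * m)) x) : ℝ := √(k * K.g x v v)

/-- The Gram matrix of `g` in the chart centred at `c`. -/
def gram (c : M) (y : EuclideanSpace ℝ (Fin (2 * m))) : Matrix (Fin (2 * m)) (Fin (2 * m)) ℝ :=
  Matrix.of fun i j => K.g (param c y) (dparam c y (EuclideanSpace.single i 1))
    (dparam c y (EuclideanSpace.single j 1))

/-- The partial derivative `∂_l g_{ij}` in the chart centred at `c`. -/
def dgram (c : M) (y : EuclideanSpace ℝ (Fin (2 * m))) (l i j : Fin (2 * m)) : ℝ :=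
  fderiv ℝ (fun y' => K.gram c y' i j) y (EuclideanSpace.single l 1)

/-- The Christoffel symbols of the Levi-Civita connection of `g` (which is also that of every
`g_k`), contracted with two vectors:
`∑ Γ^a_{ij} v_i w_j e_a`, `Γ^a_{ij} = 1/2 ∑_l g^{al} (∂_i g_{jl} + ∂_j g_{il} - ∂_l g_{ij})`. -/
def christoffel (c : M) (y v w : EuclideanSpace ℝ (Fin (2 * m))) :
    EuclideanSpace ℝ (Fin (2 * m)) :=
  WithLp.toLp 2 fun a => ∑ i, ∑ j, (1 / 2) * (∑ l, (K.gram c y)⁻¹ a l *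
    (K.dgram c y i j l + K.dgram c y j i l - K.dgram c y l i j)) * v i * w j

/-- The sup norm over `M` of a form, for the metric `g`: the least `B ≥ 0` such that
`|ψ(v₁, …, v_p)| ≤ B |v₁|_g ⋯ |v_p|_g` everywhere. -/
def supNorm {p : ℕ} (ψ : DForm (2 * m) M p ℂ) : ℝ :=
  sInf {B : ℝ | 0 ≤ B ∧ ∀ x v, ‖ψ x v‖ ≤ B * ∏ i, √(K.g x (v i) (v i))}

/-! ### Integration and currents -/

/-- The sign at `y` of the chart centred at `c`, for the orientation of `M` given by `Ω^m`. -/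
def orient (c : M) (y : EuclideanSpace ℝ (Fin (2 * m))) : ℝ :=
  SignType.sign (twoFormPow (K.Ω (param c y)).toAlternatingMap m
    fun j => dparam c y (EuclideanSpace.single j 1))

/-- A smooth partition of unity subordinate to the charts of `M`. -/
def partition (m : ℕ) (M : Type*) [TopologicalSpace M]
    [ChartedSpace (EuclideanSpace ℝ (Fin (2 * m))) M] [IsManifold (𝓡 (2 * m)) ∞ M]
    [CompactSpace M] [T2Space M] : SmoothPartitionOfUnity M (𝓡 (2 * m)) M univ :=
  (SmoothPartitionOfUnity.exists_isSubordinate_chartAt_source (𝓡 (2 * m)) M).choose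

variable [IsManifold (𝓡 (2 * m)) ∞ M] [CompactSpace M] [T2Space M]

/-- The integral over the compact manifold `M`, oriented by `Ω^m`, of a form of top degree. -/
def integral (τ : ∀ x : M, TangentSpace (𝓡 (2 * m)) x [⋀^Fin (2 * m)]→ₗ[ℝ] ℂ) : ℂ :=
  ∑ᶠ c : M, ∫ y in dom c, ((partition m M c (param c y) * K.orient c y : ℝ) : ℂ) *
    τ (param c y) (fun j => dparam c y (EuclideanSpace.single j 1))

/-- The current `⟨T_σ, ψ⟩ = ∫_M σ ∧ ψ` of a form `σ` of degree `q`. -/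
def current {q p : ℕ} (h : q + p = 2 * m)
    (σ : ∀ x : M, TangentSpace (𝓡 (2 * m)) x [⋀^Fin q]→ₗ[ℝ] ℂ) (ψ : DForm (2 * m) M p ℂ) : ℂ :=
  K.integral fun x => (wedge (σ x) (ψ x).toAlternatingMap).domDomCongr (finCongr h)

/-- The exterior derivative of this current: `⟨dT_σ, φ⟩ = (-1)^{q+1} ⟨T_σ, dφ⟩`. -/
def dCurrent {q p : ℕ} (h : q + (p + 1) = 2 * m)
    (σ : ∀ x : M, TangentSpace (𝓡 (2 * m)) x [⋀^Fin q]→ₗ[ℝ] ℂ) (φ : DForm (2 * m) M p ℂ) : ℂ :=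
  (-1) ^ (q + 1) * K.current h σ φ.extD

end AlmostKahler

theorem degree_eq {m r p : ℕ} (hp : 2 * (r + 1) + p = 2 * m) :
    2 * r + 1 + (p + 1) = 2 * m := by omega

/-- The form `σ` has coefficients of class `L^1_loc` in the charts of `M`. -/
def IsLocallyIntegrable {q : ℕ}
    (σ : ∀ x : M, TangentSpace (𝓡 (2 * m)) x [⋀^Fin q]→ₗ[ℝ] ℂ) : Prop :=
  ∀ (c : M) (I : Fin q → Fin (2 * m)),
    LocallyIntegrableOn (fun y => σ (param c y) fun j => dparam c y (EuclideanSpace.single (I j) 1))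
      (dom c)

end AlmostKahler

/-! ### Hermitian bundles and connections -/

section Bundles

/-- A smooth complex vector bundle on `M` with a Hermitian metric, with fibre the Hermitian space
`F`, given by orthonormal local frames: `coordChange i j x` takes coordinates in the `i`-th frame
to coordinates in the `j`-th frame, and is unitary and smooth in `x`. -/
structure HermitianBundle (d : ℕ) (M : Type*) [TopologicalSpace M]
    [ChartedSpace (EuclideanSpace ℝ (Fin d)) M] (F : Type*) [NormedAddCommGroup F]
    [InnerProductSpace ℂ F] (ι : Type*) extends VectorBundleCore ℂ M F ι where
  norm_coordChange : ∀ i j, ∀ x ∈ baseSet i ∩ baseSet j, ∀ u, ‖coordChange i j x u‖ = ‖u‖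
  smooth_coordChange : ∀ i j,
    ContMDiffOn (𝓡 d) 𝓘(ℝ, F →L[ℂ] F) ∞ (coordChange i j) (baseSet i ∩ baseSet j)

variable {d : ℕ} {M : Type*} [TopologicalSpace M] [ChartedSpace (EuclideanSpace ℝ (Fin d)) M]
  {F : Type*} [NormedAddCommGroup F] [InnerProductSpace ℂ F] {ι κ : Type*}

/-- A Hermitian connection. In the `i`-th frame it is `D u = du + A_i u`, where `A_i = form i` is a
one-form with skew-Hermitian values; the last field is the rule of change of frame. -/
structure HermitianConnection (E : HermitianBundle d M F ι) where
  /-- The connection form in the `i`-th frame. -/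
  form : ι → OneForm d M (F →L[ℂ] F)
  smooth_form : ∀ i, (form i).SmoothOn (E.baseSet i)
  skew : ∀ i, ∀ x ∈ E.baseSet i, ∀ v u w,
    inner ℂ (form i x v u) w + inner ℂ u (form i x v w) = 0
  gauge : ∀ i j, ∀ x ∈ E.baseSet i ∩ E.baseSet j, ∀ v,
    form j x v ∘L E.coordChange i j x =
      E.coordChange i j x ∘L form i x v -
        mvfderiv (𝓡 d) (E.coordChange i j) x v

/-- The curvature `D² = dA + A ∧ A` in the `i`-th frame, a two-form with values in
endomorphisms. -/
def HermitianConnection.curvature {E : HermitianBundle d M F ι} (D : HermitianConnection E)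
    (i : ι) (x : M) : TangentSpace (𝓡 d) x [⋀^Fin 2]→ₗ[ℝ] (F →L[ℂ] F) :=
  ((D.form i).toDForm.extD x).toAlternatingMap +
    wedge ((D.form i).toDForm x).toAlternatingMap ((D.form i).toDForm x).toAlternatingMap

/-- A smooth section, given by its coordinates in the local frames. -/
structure SmoothSection (E : HermitianBundle d M F ι) where
  /-- The coordinates of the section in the `i`-th frame. -/
  coord : ι → M → F
  smooth_coord : ∀ i, ContMDiffOn (𝓡 d) 𝓘(ℝ, F) ∞ (coord i) (E.baseSet i)
  coord_change : ∀ i j, ∀ x ∈ E.baseSet i ∩ E.baseSet j,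
    E.coordChange i j x (coord i x) = coord j x

/-- The covariant derivative `D s = du + A_i u` in the `i`-th frame. -/
def HermitianConnection.covDeriv {E : HermitianBundle d M F ι} (D : HermitianConnection E)
    (s : SmoothSection E) (i : ι) : OneForm d M F := fun x =>
  mvfderiv (𝓡 d) (s.coord i) x +
    (ContinuousLinearMap.apply ℂ F (s.coord i x)).restrictScalars ℝ ∘L D.form i x

theorem contDiffOn_clm_comp {V G G' : Type*} [NormedAddCommGroup V] [NormedSpace ℝ V]
    [NormedAddCommGroup G] [NormedSpace ℝ G] [NormedAddCommGroup G'] [NormedSpace ℝ G']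
    (Λ : G →L[ℝ] G') {f : V → V →L[ℝ] G} {s : Set V} (hf : ContDiffOn ℝ ∞ f s) :
    ContDiffOn ℝ ∞ (fun y => Λ ∘L f y) s :=
  contDiffOn_const.clm_comp hf

theorem contDiff_pow_smul {W : Type*} [NormedAddCommGroup W] [NormedSpace ℂ W] (k : ℕ) :
    ContDiff ℝ ∞ (fun p : ℂ × W => p.1 ^ k • p.2) :=
  (contDiff_fst.pow k).smul contDiff_snd

theorem mvfderiv_pow_smul {W : Type*} [NormedAddCommGroup W] [NormedSpace ℂ W] (k : ℕ)
    {h : M → ℂ} {f : M → W} {x : M} (hh : MDifferentiableAt (𝓡 d) 𝓘(ℝ, ℂ) h x)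
    (hf : MDifferentiableAt (𝓡 d) 𝓘(ℝ, W) f x) (v : TangentSpace (𝓡 d) x) :
    mvfderiv (𝓡 d) (fun x => h x ^ k • f x) x v =
      h x ^ k • mvfderiv (𝓡 d) f x v + (k * h x ^ (k - 1) * mvfderiv (𝓡 d) h x v) • f x := by
  have h1 : HasFDerivAt (𝕜 := ℝ) (fun p : ℂ × W => p.1 ^ k)
      ((k * h x ^ (k - 1)) • ContinuousLinearMap.fst ℝ ℂ W) (h x, f x) := by
    have := (hasFDerivAt_fst (𝕜 := ℝ) (p := (h x, f x))).pow k
    simpa [mul_smul] using this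
  have h2 : HasFDerivAt (𝕜 := ℝ) (fun p : ℂ × W => p.1 ^ k • p.2)
      ((h x ^ k) • ContinuousLinearMap.snd ℝ ℂ W +
        ((k * h x ^ (k - 1)) • ContinuousLinearMap.fst ℝ ℂ W).smulRight (f x)) (h x, f x) :=
    h1.smul hasFDerivAt_snd
  have h3 : HasMFDerivAt (𝓡 d) 𝓘(ℝ, W) (fun x => h x ^ k • f x) x
      (((h x ^ k) • ContinuousLinearMap.snd ℝ ℂ W +
        ((k * h x ^ (k - 1)) • ContinuousLinearMap.fst ℝ ℂ W).smulRight (f x)) ∘L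
          ((mvfderiv (𝓡 d) h x).prod (mvfderiv (𝓡 d) f x))) := by
    refine ⟨(hh.continuousAt.pow k).smul hf.continuousAt, ?_⟩
    have a := hh.hasMFDerivAt.2.prodMk hf.hasMFDerivAt.2
    refine HasFDerivAt.comp_hasFDerivWithinAt (g := fun p : ℂ × W => p.1 ^ k • p.2) _ ?_ a
    have e1 : writtenInExtChartAt (𝓡 d) 𝓘(ℝ, ℂ) x h (extChartAt (𝓡 d) x x) = h x := by
      simp [writtenInExtChartAt, chartAt_self_eq]
    have e2 : writtenInExtChartAt (𝓡 d) 𝓘(ℝ, W) x f (extChartAt (𝓡 d) x x) = f x := by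
      simp [writtenInExtChartAt, chartAt_self_eq]
    rw [e1, e2]
    exact h2
  have h4 := congrArg (fun T => T v) h3.mfderiv
  exact h4

theorem mvfderiv_clm_comp {W W' : Type*} [NormedAddCommGroup W] [NormedSpace ℝ W]
    [NormedAddCommGroup W'] [NormedSpace ℝ W'] (Λ : W →L[ℝ] W')
    {f : M → W} {x : M}
    (hf : MDifferentiableAt (𝓡 d) 𝓘(ℝ, W) f x) (v : TangentSpace (𝓡 d) x) :
    mvfderiv (𝓡 d) (fun x => Λ (f x)) x v = Λ (mvfderiv (𝓡 d) f x v) := by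
  have h4 := congrArg (fun T => T v) (Λ.hasMFDerivAt.comp x hf.hasMFDerivAt).mfderiv
  exact h4

/-- The bundle `E ⊗ L^k`, for a line bundle `L`. If `(e_j)` is the `i`-th frame of `E` and `ℓ` the
`a`-th frame of `L`, its frame of index `(i, a)` is `(e_j ⊗ ℓ^k)`. -/
def HermitianBundle.tensorPow (E : HermitianBundle d M F ι) (L : HermitianBundle d M ℂ κ) (k : ℕ) :
    HermitianBundle d M F (ι × κ) where
  baseSet i := E.baseSet i.1 ∩ L.baseSet i.2
  isOpen_baseSet i := (E.isOpen_baseSet i.1).inter (L.isOpen_baseSet i.2)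
  indexAt x := (E.indexAt x, L.indexAt x)
  mem_baseSet_at x := ⟨E.mem_baseSet_at x, L.mem_baseSet_at x⟩
  coordChange i j x := (L.coordChange i.2 j.2 x 1) ^ k • E.coordChange i.1 j.1 x
  coordChange_self := by
    rintro i x ⟨hE, hL⟩ v
    simp [E.coordChange_self i.1 x hE, L.coordChange_self i.2 x hL]
  continuousOn_coordChange := by
    intro i j
    refine ContinuousOn.smul (f := fun x => (L.coordChange i.2 j.2 x 1) ^ k)
      (g := E.coordChange i.1 j.1) (ContinuousOn.pow ?_ k) ?_
    · exact ((L.continuousOn_coordChange i.2 j.2).clm_apply continuousOn_const).mono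
        fun x hx => ⟨hx.1.2, hx.2.2⟩
    · exact (E.continuousOn_coordChange i.1 j.1).mono fun x hx => ⟨hx.1.1, hx.2.1⟩
  coordChange_comp := by
    rintro i j l x ⟨⟨hi, hj⟩, hl⟩ v
    have h1 := E.coordChange_comp i.1 j.1 l.1 x ⟨⟨hi.1, hj.1⟩, hl.1⟩ v
    have h2 := L.coordChange_comp i.2 j.2 l.2 x ⟨⟨hi.2, hj.2⟩, hl.2⟩ 1
    have h3 : L.coordChange j.2 l.2 x 1 * L.coordChange i.2 j.2 x 1 = L.coordChange i.2 l.2 x 1 := by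
      rw [← h2, mul_comm, ← smul_eq_mul, ← map_smul, smul_eq_mul, mul_one]
    simp only [smul_apply, map_smul, h1, smul_smul, ← mul_pow]
    rw [mul_comm, h3]
  norm_coordChange := by
    rintro i j x ⟨hi, hj⟩ u
    have h1 := L.norm_coordChange i.2 j.2 x ⟨hi.2, hj.2⟩ 1
    simp [norm_smul, E.norm_coordChange i.1 j.1 x ⟨hi.1, hj.1⟩ u, h1]
  smooth_coordChange := by
    intro i j
    have hL : ContMDiffOn (𝓡 d) 𝓘(ℝ, ℂ) ∞ (fun x => L.coordChange i.2 j.2 x 1)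
        (L.baseSet i.2 ∩ L.baseSet j.2) :=
      ((ContinuousLinearMap.apply ℂ ℂ (1 : ℂ)).restrictScalars ℝ).contMDiff.comp_contMDiffOn
        (L.smooth_coordChange i.2 j.2)
    exact (contDiff_pow_smul k).contMDiff.comp_contMDiffOn
      ((hL.mono fun x hx => ⟨hx.1.2, hx.2.2⟩).prodMk_space
        ((E.smooth_coordChange i.1 j.1).mono fun x hx => ⟨hx.1.1, hx.2.1⟩))

/-- The Hermitian connection on `E ⊗ L^k` induced by connections on `E` and on `L`:
`D (e ⊗ ℓ^k) = D e ⊗ ℓ^k + k e ⊗ ℓ^{k-1} D ℓ`. -/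
def HermitianConnection.tensorPow {E : HermitianBundle d M F ι} {L : HermitianBundle d M ℂ κ}
    (DE : HermitianConnection E) (DL : HermitianConnection L) (k : ℕ) :
    HermitianConnection (E.tensorPow L k) where
  form i x := DE.form i.1 x +
    ((k : ℂ) • (ContinuousLinearMap.apply ℂ ℂ (1 : ℂ)).restrictScalars ℝ ∘L
      DL.form i.2 x).smulRight (ContinuousLinearMap.id ℂ F)
  smooth_form := by
    intro i c
    have hE := (DE.smooth_form i.1 c).mono (t := dom c ∩ param c ⁻¹' (E.tensorPow L k).baseSet i)
      fun y hy => ⟨hy.1, hy.2.1⟩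
    have hL := (DL.smooth_form i.2 c).mono (t := dom c ∩ param c ⁻¹' (E.tensorPow L k).baseSet i)
      fun y hy => ⟨hy.1, hy.2.2⟩
    have hΛ := contDiffOn_clm_comp (((k : ℂ) • (ContinuousLinearMap.apply ℂ ℂ (1 : ℂ)).restrictScalars
      ℝ).smulRight (ContinuousLinearMap.id ℂ F)) hL
    exact hE.add hΛ
  skew := by
    rintro i x ⟨hE, hL⟩ v u w
    have h1 := DE.skew i.1 x hE v u w
    have h2 := DL.skew i.2 x hL v 1 1
    simp at h2
    have e : ∀ u : F, (DE.form i.1 x + ((k : ℂ) • (ContinuousLinearMap.apply ℂ ℂ (1 : ℂ)).restrictScalars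
        ℝ ∘L DL.form i.2 x).smulRight (ContinuousLinearMap.id ℂ F)) v u =
        DE.form i.1 x v u + (k * DL.form i.2 x v 1) • u := fun _ => rfl
    rw [e, e, inner_add_left, inner_add_right, inner_smul_left, inner_smul_right]
    simp only [map_mul, Complex.conj_natCast]
    linear_combination h1 + k * inner ℂ u w * h2
  gauge := by
    rintro i j x ⟨⟨hEi, hLi⟩, ⟨hEj, hLj⟩⟩ v
    have h1 := DE.gauge i.1 j.1 x ⟨hEi, hEj⟩ v
    have h2 := DL.gauge i.2 j.2 x ⟨hLi, hLj⟩ v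
    have dE : MDifferentiableAt (𝓡 d) 𝓘(ℝ, F →L[ℂ] F) (E.coordChange i.1 j.1) x :=
      ((E.smooth_coordChange i.1 j.1).contMDiffAt (((E.isOpen_baseSet _).inter
        (E.isOpen_baseSet _)).mem_nhds ⟨hEi, hEj⟩)).mdifferentiableAt (by simp)
    have dL : MDifferentiableAt (𝓡 d) 𝓘(ℝ, ℂ →L[ℂ] ℂ) (L.coordChange i.2 j.2) x :=
      ((L.smooth_coordChange i.2 j.2).contMDiffAt (((L.isOpen_baseSet _).inter
        (L.isOpen_baseSet _)).mem_nhds ⟨hLi, hLj⟩)).mdifferentiableAt (by simp)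
    let ev : (ℂ →L[ℂ] ℂ) →L[ℝ] ℂ := (ContinuousLinearMap.apply ℂ ℂ (1 : ℂ)).restrictScalars ℝ
    have dL1 : MDifferentiableAt (𝓡 d) 𝓘(ℝ, ℂ) (fun x => L.coordChange i.2 j.2 x 1) x :=
      (ev.contMDiff (n := 1)).mdifferentiable (by simp) _ |>.comp x dL
    have h3 : mvfderiv (𝓡 d) ((E.tensorPow L k).coordChange i j) x v = _ :=
      mvfderiv_pow_smul k dL1 dE v
    have h4 : mvfderiv (𝓡 d) (fun x => L.coordChange i.2 j.2 x 1) x v =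
      mvfderiv (𝓡 d) (L.coordChange i.2 j.2) x v 1 := mvfderiv_clm_comp ev dL v
    rw [h3, h4]
    have h5 := congrArg (fun T => T (1 : ℂ)) h2
    replace h5 : DL.form j.2 x v 1 * L.coordChange i.2 j.2 x 1 =
        L.coordChange i.2 j.2 x 1 * DL.form i.2 x v 1 -
          mvfderiv (𝓡 d) (L.coordChange i.2 j.2) x v 1 := by
      have a1 : ∀ (T : ℂ →L[ℂ] ℂ) (z : ℂ), T z = z * T 1 := fun T z => by
        rw [← smul_eq_mul, ← map_smul, smul_eq_mul, mul_one]
      have h6 : DL.form j.2 x v (L.coordChange i.2 j.2 x 1) =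
        L.coordChange i.2 j.2 x (DL.form i.2 x v 1) -
          mvfderiv (𝓡 d) (L.coordChange i.2 j.2) x v 1 := h5
      rw [a1 (DL.form j.2 x v) (L.coordChange i.2 j.2 x 1),
        a1 (L.coordChange i.2 j.2 x) (DL.form i.2 x v 1)] at h6
      rw [mul_comm, h6, mul_comm (DL.form i.2 x v 1)]
    ext u
    have h6 : DE.form j.1 x v (E.coordChange i.1 j.1 x u) =
        E.coordChange i.1 j.1 x (DE.form i.1 x v u) -
          mvfderiv (𝓡 d) (E.coordChange i.1 j.1) x v u := congrArg (fun T => T u) h1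
    change DE.form j.1 x v (L.coordChange i.2 j.2 x 1 ^ k • E.coordChange i.1 j.1 x u) +
        (k * DL.form j.2 x v 1) • (L.coordChange i.2 j.2 x 1 ^ k • E.coordChange i.1 j.1 x u) =
      L.coordChange i.2 j.2 x 1 ^ k •
          E.coordChange i.1 j.1 x (DE.form i.1 x v u + (k * DL.form i.2 x v 1) • u) -
        (L.coordChange i.2 j.2 x 1 ^ k • mvfderiv (𝓡 d) (E.coordChange i.1 j.1) x v u +
          (k * L.coordChange i.2 j.2 x 1 ^ (k - 1) *
            mvfderiv (𝓡 d) (L.coordChange i.2 j.2) x v 1) • E.coordChange i.1 j.1 x u)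
    rw [map_smul, h6, map_add, map_smul]
    generalize L.coordChange i.2 j.2 x 1 = h at *
    generalize mvfderiv (𝓡 d) (L.coordChange i.2 j.2) x v 1 = dh at *
    generalize E.coordChange i.1 j.1 x u = w
    have h7 : k * DL.form j.2 x v 1 * h ^ k =
        h ^ k * (k * DL.form i.2 x v 1) - k * h ^ (k - 1) * dh := by
      rcases k with _ | k
      · simp
      · simp only [Nat.add_sub_cancel, pow_succ]
        linear_combination ((k + 1 : ℕ) : ℂ) * h ^ k * h5
    rw [smul_smul, h7, sub_smul, mul_smul (h ^ k)]
    module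

end Bundles

/-! ### Asymptotically holomorphic sections -/

section AsymptoticallyHolomorphic

variable {m : ℕ} {M : Type*} [TopologicalSpace M]
  [ChartedSpace (EuclideanSpace ℝ (Fin (2 * m))) M] (K : AlmostKahler m M)
  {F : Type*} [NormedAddCommGroup F] [InnerProductSpace ℂ F] {ι κ : Type*}

/-- The `(0,1)`-part `θ^{0,1}(v) = (θ(v) + i θ(J v)) / 2` of a one-form. -/
def AlmostKahler.zeroOne (θ : OneForm (2 * m) M F) : OneForm (2 * m) M F := fun x =>
  (1 / 2 : ℂ) • (θ x + Complex.I • (θ x ∘L K.J x))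

/-- The covariant derivative `(∇θ)(v, w)` of a bundle-valued one-form `θ`, in the `i`-th frame and
the chart centred at `c`, for the connection `D` and the Levi-Civita connection of `g`:
`(∇_v θ)(w) = ∂_v (θ(w)) + A(v) θ(w) - θ(Γ(v, w))` for constant `v`, `w` in `ℝ^{2m}`. -/
def HermitianConnection.covDerivOneForm {E : HermitianBundle (2 * m) M F ι}
    (D : HermitianConnection E) (θ : OneForm (2 * m) M F) (i : ι) (c : M)
    (y v w : EuclideanSpace ℝ (Fin (2 * m))) : F :=
  fderiv ℝ (θ.inChart c) y v w + (D.form i).inChart c y v (θ.inChart c y w) -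
    θ.inChart c y (K.christoffel c y v w)

variable {E : HermitianBundle (2 * m) M F ι} {L : HermitianBundle (2 * m) M ℂ κ}
  (DE : HermitianConnection E) (DL : HermitianConnection L)

/-- The connection `D` on the line bundle `L` has curvature `-iΩ`. -/
def HasCurvature (DL : HermitianConnection L) : Prop :=
  ∀ a, ∀ x ∈ L.baseSet a, ∀ v w : TangentSpace (𝓡 (2 * m)) x, ∀ z : ℂ,
    DL.curvature a x ![v, w] z = -Complex.I * (K.Ω x ![v, w] : ℂ) * z

/-- The sections `s_k` of `E ⊗ L^k` satisfy, for the metrics `g_k = k g` and with `D^k` the induced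
connection, the bounds `|s_k| ≤ C`, `|D^k s_k| ≤ C`, `|D^k D^k s_k| ≤ C`, `|∂̄ s_k| ≤ C k^{-1/2}`,
`|D^k ∂̄ s_k| ≤ C k^{-1/2}` with a constant `C` independent of `k`. -/
def AsymptoticBounds (s : ∀ k : ℕ, SmoothSection (E.tensorPow L k)) : Prop :=
  ∃ C : ℝ, ∀ k : ℕ, 1 ≤ k → ∀ i : ι × κ,
    (∀ x ∈ (E.tensorPow L k).baseSet i,
      ‖(s k).coord i x‖ ≤ C ∧
      (∀ v, ‖(DE.tensorPow DL k).covDeriv (s k) i x v‖ ≤ C * K.len k x v) ∧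
      (∀ v, ‖K.zeroOne ((DE.tensorPow DL k).covDeriv (s k) i) x v‖ ≤
        C * (k : ℝ) ^ (-(1 / 2) : ℝ) * K.len k x v)) ∧
    (∀ c : M, ∀ y ∈ dom c, param c y ∈ (E.tensorPow L k).baseSet i → ∀ v w,
      ‖(DE.tensorPow DL k).covDerivOneForm K ((DE.tensorPow DL k).covDeriv (s k) i) i c y v w‖ ≤
        C * K.len k (param c y) (dparam c y v) * K.len k (param c y) (dparam c y w) ∧
      ‖(DE.tensorPow DL k).covDerivOneForm K
          (K.zeroOne ((DE.tensorPow DL k).covDeriv (s k) i)) i c y v w‖ ≤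
        C * (k : ℝ) ^ (-(1 / 2) : ℝ) *
          K.len k (param c y) (dparam c y v) * K.len k (param c y) (dparam c y w))

/-- Uniform transversality: there is `η > 0` such that for all `k ≥ k₀`, at every point where
`|s_k| ≤ η`, the covariant derivative `D^k s_k` has a right inverse of norm at most `η⁻¹` for the
metric `g_k`. -/
def UniformlyTransverse (k₀ : ℕ) (s : ∀ k : ℕ, SmoothSection (E.tensorPow L k)) : Prop :=
  ∃ η : ℝ, 0 < η ∧ ∀ k : ℕ, 1 ≤ k → k₀ ≤ k → ∀ i : ι × κ, ∀ x ∈ (E.tensorPow L k).baseSet i,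
    ‖(s k).coord i x‖ ≤ η →
      ∃ R : F →ₗ[ℝ] TangentSpace (𝓡 (2 * m)) x, ∀ u : F,
        (DE.tensorPow DL k).covDeriv (s k) i x (R u) = u ∧ K.len k x (R u) ≤ η⁻¹ * ‖u‖

end AsymptoticallyHolomorphic

/-! ### The Harvey-Lawson potential -/

section Potential

variable {T : Type*} [AddCommGroup T] [Module ℝ T] {r : ℕ}

/-- The entry `Φ_i^j` of an endomorphism, with `Φ e_i = ∑_j Φ_i^j e_j`. -/
def entry (i j : Fin (r + 1)) :
    (EuclideanSpace ℂ (Fin (r + 1)) →L[ℂ] EuclideanSpace ℂ (Fin (r + 1))) →ₗ[ℝ] ℂ where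
  toFun Φ := Φ (EuclideanSpace.single i 1) j
  map_add' _ _ := rfl
  map_smul' _ _ := rfl

/-- The one-form `(Du)_j`. -/
def comp (Du : T →ₗ[ℝ] EuclideanSpace ℂ (Fin (r + 1))) (j : Fin (r + 1)) : T →ₗ[ℝ] ℂ :=
  ((EuclideanSpace.proj j : EuclideanSpace ℂ (Fin (r + 1)) →L[ℂ] ℂ).restrictScalars ℝ).toLinearMap
    ∘ₗ Du

/-- The one-form `(Du^*)_j`, the complex conjugate of `(Du)_j` (the frame is orthonormal and the
connection Hermitian). -/
def compStar (Du : T →ₗ[ℝ] EuclideanSpace ℂ (Fin (r + 1))) (j : Fin (r + 1)) : T →ₗ[ℝ] ℂ :=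
  Complex.conjAe.toLinearMap ∘ₗ comp Du j

/-- The form `τ` with `τ λ(f) = (f^* α f) ∧ (f^* β₀ f) ∧ ⋯ ∧ (f^* β_{r-1} f)`, where
`λ(f) = f₁^* ∧ f₁ ∧ ⋯ ∧ f_n^* ∧ f_n`, `n = r + 1`, `f^* β f = ∑_{i,j} β_i^j f_i^* ∧ f_j`, `α` is
a matrix of one-forms and the `β_l` are matrices of two-forms. As the `f_i^* ∧ f_j` commute, the
coefficient of `λ(f)` in `f_{π 0}^* ∧ f_{ρ 0} ∧ ⋯ ∧ f_{π r}^* ∧ f_{ρ r}` is `sgn π · sgn ρ`. -/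
def berezin (α : Fin (r + 1) → Fin (r + 1) → T [⋀^Fin 1]→ₗ[ℝ] ℂ)
    (β : Fin r → Fin (r + 1) → Fin (r + 1) → T [⋀^Fin 2]→ₗ[ℝ] ℂ) :
    T [⋀^Fin (2 * r + 1)]→ₗ[ℝ] ℂ :=
  ∑ π : Equiv.Perm (Fin (r + 1)), ∑ ρ : Equiv.Perm (Fin (r + 1)),
    (((Equiv.Perm.sign π : ℤ) : ℂ) * ((Equiv.Perm.sign ρ : ℤ) : ℂ)) •
      wedgeList (α (π 0) (ρ 0)) r fun l => β l (π l.succ) (ρ l.succ)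

/-- The matrix `u^* Du / |u|²` of one-forms. -/
def firstFactor (u : EuclideanSpace ℂ (Fin (r + 1))) (Du : T →ₗ[ℝ] EuclideanSpace ℂ (Fin (r + 1)))
    (i j : Fin (r + 1)) : T [⋀^Fin 1]→ₗ[ℝ] ℂ :=
  ((starRingEnd ℂ (u i)) / ((‖u‖ : ℂ) ^ 2)) • toForm (comp Du j)

/-- The matrix `Θ - Du^* ∧ Du / |u|²` of two-forms, where `Θ` is the curvature. -/
def secondFactor (u : EuclideanSpace ℂ (Fin (r + 1))) (Du : T →ₗ[ℝ] EuclideanSpace ℂ (Fin (r + 1)))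
    (Θ : T [⋀^Fin 2]→ₗ[ℝ] (EuclideanSpace ℂ (Fin (r + 1)) →L[ℂ] EuclideanSpace ℂ (Fin (r + 1))))
    (i j : Fin (r + 1)) : T [⋀^Fin 2]→ₗ[ℝ] ℂ :=
  (entry i j).compAlternatingMap Θ -
    (1 / ((‖u‖ : ℂ) ^ 2)) • wedge (toForm (compStar Du i)) (toForm (comp Du j))

/-- The Harvey-Lawson potential at a point, in an orthonormal frame, with `n = r + 1`:
`σ λ(f) = (1/n!) (i/2π)^n (f^* (u^* Du / |u|²) f) ∧
  ∑_{k=0}^{n-1} (f^* Θ f - f^* (Du^* ∧ Du / |u|²) f)^k ∧ (f^* Θ f)^{n-1-k}`. -/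
def potentialForm (u : EuclideanSpace ℂ (Fin (r + 1)))
    (Du : T →ₗ[ℝ] EuclideanSpace ℂ (Fin (r + 1)))
    (Θ : T [⋀^Fin 2]→ₗ[ℝ] (EuclideanSpace ℂ (Fin (r + 1)) →L[ℂ] EuclideanSpace ℂ (Fin (r + 1)))) :
    T [⋀^Fin (2 * r + 1)]→ₗ[ℝ] ℂ :=
  ((1 / ((r + 1).factorial : ℂ)) * (Complex.I / (2 * (Real.pi : ℂ))) ^ (r + 1)) •
    ∑ k ∈ Finset.range (r + 1), berezin (firstFactor u Du) fun l : Fin r =>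
      if (l : ℕ) < k then secondFactor u Du Θ else fun i j => (entry i j).compAlternatingMap Θ

variable {d : ℕ} {M : Type*} [TopologicalSpace M] [ChartedSpace (EuclideanSpace ℝ (Fin d)) M]
  {ι : Type*}

/-- The Harvey-Lawson potential of a section `s` of a Hermitian bundle of rank `r + 1` with a
Hermitian connection: a form of degree `2(r + 1) - 1`, whose values do not depend on the
orthonormal frame. It is meaningful outside the zero set of `s`. -/
def potential {E : HermitianBundle d M (EuclideanSpace ℂ (Fin (r + 1))) ι}
    (D : HermitianConnection E) (s : SmoothSection E) (x : M) :
    TangentSpace (𝓡 d) x [⋀^Fin (2 * r + 1)]→ₗ[ℝ] ℂ :=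
  potentialForm (s.coord (E.indexAt x) x) (D.covDeriv s (E.indexAt x) x).toLinearMap
    (D.curvature (E.indexAt x) x)

end Potential

end HL

end

/-!
The Harvey–Lawson potential `σ` of a section `s` with values in a bundle of rank `n = r + 1` is
bounded pointwise by `|Ds| ^ (2n - 1) / |s| ^ (2n - 1)`, up to terms of smaller order in `1 / |s|`.
With respect to the fixed metric `g` the derivative and the curvature have sizes `|D^k s_k| ≲ √k`
and `|Θ_k| ≲ k`, so that

`|σ_k|_g ≲ √k ^ (2n - 1) · |s_k| ^ (-(2n - 1))`.

Everything therefore reduces to a bound, uniform in `k`, of the integral of `|s_k| ^ (-(2n - 1))`: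
as `k ^ (-n) · √k ^ (2n - 1) = k ^ (-1/2)`, it gives the estimate of `σ_k ∧ dφ`.

The fibre has real dimension `2n`, and `|z| ^ (-(2n - 1))` is integrable on the unit ball of a space
of this dimension. This is transported to `s_k` by transversality. Around a point where `|s_k|` is
small let `R` be the right inverse of `D^k s_k`, and consider a ball of radius `ρ₀ / √k`. The
curvature of `L^k` is of size `k`, hence, after multiplication by a unimodular factor that makes the
connection form of `L^k` vanish at the centre, this form has size at most of order `√k` on the ball.
In this gauge the derivative of `s_k` differs little from `D^k s_k`, and the latter varies little
since the second covariant derivative is bounded; so along the affine slices parallel to the image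
of `R` the section is close to the identity, up to a translation, and `|s_k| ^ (-(2n - 1))` has an
integral comparable to that of `|z| ^ (-(2n - 1))`. Averaging over slices, and then over all small
balls, yields `exists_lintegral_inv_norm_pow_le`. Averages over translates replace both a covering
argument and a decomposition of the tangent space into kernel and image.

The potential is compared in different frames by `potentialForm_change_of_frame`, and bounded by
`exists_norm_potentialForm_apply_le`. These facts are combined in `exists_potential_bound`, and
compactness of `M` passes from small balls in charts to the current in `exists_norm_current_le`.
-/

namespace HL

/-! ### Integrals of `‖w‖ ^ (-q)` for maps close to a submersion -/

section Analysis

/-- A function `h ≥ 0` such that distances are bounded by `2 (h z + h z')` grows at least linearly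
away from some point: a limit `a` of a minimizing sequence. It need not attain its infimum, nor
need `a` lie in `Z`. -/
theorem exists_center_of_quasi_antilipschitz {F : Type*} [NormedAddCommGroup F] [ProperSpace F]
    {Z : Set F} {r : ℝ} (hr : 0 ≤ r) (hZ : Z ⊆ Metric.closedBall 0 r) {h : F → ℝ}
    (h0 : ∀ z, 0 ≤ h z) (hh : ∀ z ∈ Z, ∀ z' ∈ Z, ‖z - z'‖ ≤ 2 * (h z + h z')) :
    ∃ a ∈ Metric.closedBall (0 : F) r, ∀ z ∈ Z, ‖z - a‖ ≤ 4 * h z := by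
  rcases Z.eq_empty_or_nonempty with rfl | hne
  · exact ⟨0, by simpa using hr, by simp⟩
  have hbdd : BddBelow (h '' Z) := ⟨0, by rintro _ ⟨z, -, rfl⟩; exact h0 z⟩
  obtain ⟨t, -, ht, htm⟩ := exists_seq_tendsto_sInf (hne.image h) hbdd
  choose z hz hzt using htm
  obtain ⟨a, har, φ, hφ, ha⟩ := (isCompact_closedBall (0 : F) r).tendsto_subseq fun n => hZ (hz n)
  refine ⟨a, har, fun x hx => ?_⟩
  have h1 : Tendsto (fun n => ‖x - z (φ n)‖) atTop (𝓝 ‖x - a‖) :=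
    (tendsto_const_nhds.sub ha).norm
  have h2 : Tendsto (fun n => 2 * (h x + t (φ n))) atTop (𝓝 (2 * (h x + sInf (h '' Z)))) :=
    ((ht.comp hφ.tendsto_atTop).const_add _).const_mul _
  have h3 := le_of_tendsto_of_tendsto' h1 h2 fun n => by
    have := hh x hx (z (φ n)) (hz _)
    rwa [hzt] at this
  have h4 : sInf (h '' Z) ≤ h x := csInf_le hbdd ⟨x, hx, rfl⟩
  linarith

variable {F : Type*} [NormedAddCommGroup F] [NormedSpace ℝ F] [FiniteDimensional ℝ F]
  [MeasurableSpace F] [BorelSpace F]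

/-- In polar coordinates the factor `‖z‖ ^ (dim F - 1)` cancels against the Jacobian. -/
theorem lintegral_ball_inv_norm_pow_lt_top [Nontrivial F] (ν : Measure F) [ν.IsAddHaarMeasure]
    (r : ℝ) :
    ∫⁻ z in Metric.ball (0 : F) r, (‖z‖ₑ ^ (Module.finrank ℝ F - 1))⁻¹ ∂ν < ⊤ := by
  set q := Module.finrank ℝ F - 1 with hq
  have h1 : IntegrableOn (fun z : F => (fun t : ℝ => (t ^ q)⁻¹) ‖z‖) (Metric.ball 0 r) ν := by
    refine (integrableOn_fun_norm_addHaar ν (f := fun t : ℝ => (t ^ q)⁻¹)).2 ?_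
    refine IntegrableOn.congr_fun (f := fun _ => (1 : ℝ)) (by simp) (fun y hy => ?_)
      measurableSet_Ioo
    have : y ^ q ≠ 0 := pow_ne_zero _ hy.1.ne'
    simp [← hq, this]
  have h2 := h1.2
  rw [HasFiniteIntegral] at h2
  refine lt_of_eq_of_lt ?_ h2
  apply lintegral_congr_ae
  have h3 : ∀ᵐ z ∂ν, z ≠ (0 : F) := by
    simp [ae_iff]
  filter_upwards [ae_restrict_of_ae h3] with z hz
  have : ‖z‖ ^ q ≠ 0 := pow_ne_zero _ (norm_ne_zero_iff.2 hz)
  rw [enorm_inv this, enorm_pow, enorm_norm]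

/-- The integral of `‖g‖ ^ (-q)` is compared with that of `‖z - a‖ ^ (-q)`, where `a` is the point
away from which `‖g‖` grows linearly. The hypothesis on `g` holds when `g` is, up to a factor, an
expanding map. -/
theorem lintegral_inv_norm_pow_le_of_quasi_antilipschitz (ν : Measure F) [ν.IsAddHaarMeasure]
    (q : ℕ) {Z : Set F} {r : ℝ} (hr : 0 ≤ r) (hZ : Z ⊆ Metric.ball 0 r) (hZm : MeasurableSet Z)
    {G : Type*} [NormedAddCommGroup G] {g : F → G}
    (hg : ∀ z ∈ Z, ∀ z' ∈ Z, ‖z - z'‖ ≤ 2 * (‖g z‖ + ‖g z'‖)) :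
    ∫⁻ z in Z, (‖g z‖ₑ ^ q)⁻¹ ∂ν ≤
      4 ^ q * ∫⁻ z in Metric.ball (0 : F) (2 * r), (‖z‖ₑ ^ q)⁻¹ ∂ν := by
  obtain ⟨a, har, ha⟩ := exists_center_of_quasi_antilipschitz hr
    (hZ.trans Metric.ball_subset_closedBall) (fun z => norm_nonneg (g z)) hg
  have key : ∀ z ∈ Z, (‖g z‖ₑ ^ q)⁻¹ ≤ 4 ^ q *
      (Metric.ball (0 : F) (2 * r)).indicator (fun z => (‖z‖ₑ ^ q)⁻¹) (z - a) := by
    intro z hz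
    have h1 : z - a ∈ Metric.ball (0 : F) (2 * r) := by
      have h2 := hZ hz
      simp only [mem_ball_zero_iff, mem_closedBall_zero_iff] at h2 har ⊢
      linarith [norm_sub_le z a]
    rw [indicator_of_mem h1]
    have h2 : ‖z - a‖ₑ ≤ 4 * ‖g z‖ₑ := by
      have := ENNReal.ofReal_le_ofReal (ha z hz)
      rw [ENNReal.ofReal_mul (by norm_num)] at this
      simpa [← ofReal_norm] using this
    have h3 : ‖z - a‖ₑ ^ q ≤ 4 ^ q * ‖g z‖ₑ ^ q := by
      rw [← mul_pow]; gcongr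
    have h4 : (4 ^ q * ‖g z‖ₑ ^ q)⁻¹ ≤ (‖z - a‖ₑ ^ q)⁻¹ := ENNReal.inv_le_inv.2 h3
    have h40 : (4 : ENNReal) ^ q ≠ 0 := by simp
    have h4t : (4 : ENNReal) ^ q ≠ ⊤ := by finiteness
    rw [ENNReal.mul_inv (Or.inl h40) (Or.inl h4t)] at h4
    calc (‖g z‖ₑ ^ q)⁻¹ = 4 ^ q * ((4 ^ q)⁻¹ * (‖g z‖ₑ ^ q)⁻¹) := by
          rw [← mul_assoc, ENNReal.mul_inv_cancel h40 h4t, one_mul]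
      _ ≤ _ := by gcongr
  calc ∫⁻ z in Z, (‖g z‖ₑ ^ q)⁻¹ ∂ν
      ≤ ∫⁻ z in Z, 4 ^ q *
        (Metric.ball (0 : F) (2 * r)).indicator (fun z => (‖z‖ₑ ^ q)⁻¹) (z - a) ∂ν :=
        setLIntegral_mono' hZm key
    _ ≤ ∫⁻ z, 4 ^ q *
        (Metric.ball (0 : F) (2 * r)).indicator (fun z => (‖z‖ₑ ^ q)⁻¹) (z - a) ∂ν :=
        setLIntegral_le_lintegral _ _
    _ = _ := by
      rw [lintegral_const_mul' _ _ (by finiteness),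
        lintegral_sub_right_eq_self
          (fun z => (Metric.ball (0 : F) (2 * r)).indicator (fun z => (‖z‖ₑ ^ q)⁻¹) z) a,
        lintegral_indicator measurableSet_ball]

variable {V : Type*} [NormedAddCommGroup V] [NormedSpace ℝ V] [FiniteDimensional ℝ V]
  [MeasurableSpace V] [BorelSpace V]

/-- Averaging over translates along the image of a linear map bounds an integral over `V` by the
integrals over the slices; no choice of complement and no determinant enters. -/
theorem lintegral_le_of_slices (μ : Measure V) [μ.IsAddHaarMeasure] (ν : Measure F)
    [ν.IsAddHaarMeasure] {f : V → ENNReal} (hf : Measurable f) {y₁ : V} {ρ r : ℝ}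
    (hfs : ∀ y ∉ Metric.ball y₁ ρ, f y = 0) (R : F →L[ℝ] V)
    (hR : ∀ z ∈ Metric.ball (0 : F) r, ‖R z‖ ≤ ρ) {c : ENNReal}
    (hc : ∀ y, ∫⁻ z in Metric.ball (0 : F) r, f (y + R z) ∂ν ≤ c) :
    ν (Metric.ball (0 : F) r) * ∫⁻ y, f y ∂μ ≤ μ (Metric.ball y₁ (2 * ρ)) * c := by
  -- every translate by `R z` has the same integral, carried by a ball of twice the radius
  have h1 : ∀ z ∈ Metric.ball (0 : F) r,
      ∫⁻ y, f y ∂μ = ∫⁻ y in Metric.ball y₁ (2 * ρ), f (y + R z) ∂μ := by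
    intro z hz
    rw [← lintegral_add_right_eq_self f (R z), ← lintegral_indicator measurableSet_ball]
    congr 1
    ext y
    by_cases hy : y ∈ Metric.ball y₁ (2 * ρ)
    · rw [indicator_of_mem hy]
    · rw [indicator_of_notMem hy]
      apply hfs
      intro h
      apply hy
      have h2 := hR z hz
      rw [mem_ball_iff_norm] at h ⊢
      have h3 : y - y₁ = (y + R z - y₁) - R z := by abel
      rw [h3]
      linarith [norm_sub_le (y + R z - y₁) (R z)]
  calc ν (Metric.ball (0 : F) r) * ∫⁻ y, f y ∂μ
      = ∫⁻ z in Metric.ball (0 : F) r, ∫⁻ y, f y ∂μ ∂ν := by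
        rw [setLIntegral_const, mul_comm]
    _ = ∫⁻ z in Metric.ball (0 : F) r, ∫⁻ y in Metric.ball y₁ (2 * ρ), f (y + R z) ∂μ ∂ν :=
        setLIntegral_congr_fun measurableSet_ball h1
    _ = ∫⁻ y in Metric.ball y₁ (2 * ρ), ∫⁻ z in Metric.ball (0 : F) r, f (y + R z) ∂ν ∂μ := by
        apply lintegral_lintegral_swap
        apply Measurable.aemeasurable
        exact hf.comp (measurable_snd.add (R.continuous.measurable.comp measurable_fst))
    _ ≤ ∫⁻ y in Metric.ball y₁ (2 * ρ), c ∂μ := lintegral_mono fun y => hc y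
    _ = _ := by rw [setLIntegral_const, mul_comm]

/-- Averaging over small balls bounds the integral over a large ball. -/
theorem lintegral_ball_le_of_small_balls (μ : Measure V) [μ.IsAddHaarMeasure] {f : V → ENNReal}
    (hf : Measurable f) {y₀ : V} {R ρ : ℝ} (hρ : 0 < ρ) (hρR : ρ ≤ R) {c : ENNReal}
    (hc : ∀ y₁ ∈ Metric.ball y₀ (2 * R),
      ∫⁻ y in Metric.ball y₁ ρ, f y ∂μ ≤ c * μ (Metric.ball 0 ρ)) :
    ∫⁻ y in Metric.ball y₀ R, f y ∂μ ≤ c * μ (Metric.ball y₀ (2 * R)) := by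
  have hb : ∀ y, μ (Metric.ball y ρ) = μ (Metric.ball 0 ρ) := fun y =>
    Measure.addHaar_ball_center μ y ρ
  have h0 : μ (Metric.ball (0 : V) ρ) ≠ 0 := (Metric.measure_ball_pos μ _ hρ).ne'
  have ht : μ (Metric.ball (0 : V) ρ) ≠ ⊤ := measure_ball_lt_top.ne
  set S : Set (V × V) := {p | dist p.1 p.2 < ρ} with hS
  have hSm : MeasurableSet S := (isOpen_lt continuous_dist continuous_const).measurableSet
  have h1 : ∀ y ∈ Metric.ball y₀ R, f y * μ (Metric.ball 0 ρ) ≤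
      ∫⁻ y₁ in Metric.ball y₀ (2 * R), S.indicator (fun p => f p.1) (y, y₁) ∂μ := by
    intro y hy
    calc f y * μ (Metric.ball 0 ρ) = ∫⁻ y₁ in Metric.ball y ρ, f y ∂μ := by
          rw [setLIntegral_const, hb y]
      _ = ∫⁻ y₁ in Metric.ball y ρ, S.indicator (fun p => f p.1) (y, y₁) ∂μ := by
          refine setLIntegral_congr_fun measurableSet_ball fun y₁ hy₁ => ?_
          have : (y, y₁) ∈ S := by rw [hS, mem_ofPred_eq, dist_comm]; exact hy₁
          simp only [indicator_of_mem this]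
      _ ≤ _ := by
          refine lintegral_mono_set (Metric.ball_subset_ball' ?_)
          have := Metric.mem_ball.1 hy
          linarith
  have h2 : (∫⁻ y in Metric.ball y₀ R, f y ∂μ) * μ (Metric.ball 0 ρ) ≤
      c * μ (Metric.ball y₀ (2 * R)) * μ (Metric.ball 0 ρ) := by
    calc (∫⁻ y in Metric.ball y₀ R, f y ∂μ) * μ (Metric.ball 0 ρ)
        = ∫⁻ y in Metric.ball y₀ R, f y * μ (Metric.ball 0 ρ) ∂μ := by
          rw [lintegral_mul_const' _ _ ht]
      _ ≤ ∫⁻ y in Metric.ball y₀ R, ∫⁻ y₁ in Metric.ball y₀ (2 * R),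
            S.indicator (fun p => f p.1) (y, y₁) ∂μ ∂μ := setLIntegral_mono' measurableSet_ball h1
      _ = ∫⁻ y₁ in Metric.ball y₀ (2 * R), ∫⁻ y in Metric.ball y₀ R,
            S.indicator (fun p => f p.1) (y, y₁) ∂μ ∂μ := by
          apply lintegral_lintegral_swap
          exact ((hf.comp measurable_fst).indicator hSm).aemeasurable
      _ ≤ ∫⁻ y₁ in Metric.ball y₀ (2 * R), c * μ (Metric.ball 0 ρ) ∂μ := by
          refine setLIntegral_mono' measurableSet_ball fun y₁ hy₁ => ?_
          refine le_trans ?_ (hc y₁ hy₁)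
          refine (setLIntegral_le_lintegral _ _).trans_eq ?_
          rw [← lintegral_indicator measurableSet_ball]
          congr 1
      _ = _ := by rw [setLIntegral_const]; ring
  exact (ENNReal.mul_le_mul_iff_left h0 ht).1 h2

/-- The small ball estimate: where `w` is, up to a factor of relative size `1/2`, a submersion with
right inverse `R`, the function `‖w‖ ^ (-q)` is integrated over slices parallel to the image
of `R`, on which `w` is close to the identity. -/
theorem lintegral_small_ball_le (μ : Measure V) [μ.IsAddHaarMeasure] (ν : Measure F)
    [ν.IsAddHaarMeasure] (q : ℕ) {w : V → F} {w' : V → V →L[ℝ] F} {y₁ : V} {ρ r : ℝ} (hr : 0 < r)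
    (hw : ∀ y ∈ Metric.ball y₁ ρ, HasFDerivAt w (w' y) y) (R : F →L[ℝ] V)
    (hR : ∀ z, ‖R z‖ * r ≤ ρ * ‖z‖) (hρ : 0 < ρ)
    (hwR : ∀ y ∈ Metric.ball y₁ ρ, ‖w' y ∘L R - ContinuousLinearMap.id ℝ F‖ ≤ 1 / 2) :
    ν (Metric.ball (0 : F) r) * ∫⁻ y in Metric.ball y₁ ρ, (‖w y‖ₑ ^ q)⁻¹ ∂μ ≤
      μ (Metric.ball y₁ (2 * ρ)) *
        (4 ^ q * ∫⁻ z in Metric.ball (0 : F) (2 * r), (‖z‖ₑ ^ q)⁻¹ ∂ν) := by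
  classical
  -- `w` is only known to be measurable on the ball, whence the truncation
  have hwm : Measurable ((Metric.ball y₁ ρ).piecewise w 0) :=
    ContinuousOn.measurable_piecewise
      (fun y hy => (hw y hy).continuousAt.continuousWithinAt) continuousOn_const measurableSet_ball
  set f : V → ENNReal := (Metric.ball y₁ ρ).indicator
    fun y => (‖(Metric.ball y₁ ρ).piecewise w 0 y‖ₑ ^ q)⁻¹ with hf
  have hfm : Measurable f :=
    ((hwm.enorm.pow_const q).inv).indicator measurableSet_ball
  have hfw : ∀ y ∈ Metric.ball y₁ ρ, f y = (‖w y‖ₑ ^ q)⁻¹ := fun y hy => by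
    rw [hf, indicator_of_mem hy, piecewise_eq_of_mem _ _ _ hy]
  have h0 : ∫⁻ y in Metric.ball y₁ ρ, (‖w y‖ₑ ^ q)⁻¹ ∂μ = ∫⁻ y, f y ∂μ := by
    rw [← setLIntegral_congr_fun measurableSet_ball hfw,
      ← lintegral_indicator measurableSet_ball, hf, indicator_indicator, inter_self]
  rw [h0]
  refine lintegral_le_of_slices μ ν hfm (fun y hy => indicator_of_notMem hy _) R ?_ fun y => ?_
  · intro z hz
    have h1 := hR z
    rw [mem_ball_zero_iff] at hz
    have : ‖R z‖ * r ≤ ρ * r := h1.trans (by gcongr)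
    exact le_of_mul_le_mul_right this hr
  set Z : Set F := Metric.ball 0 r ∩ (fun z => y + R z) ⁻¹' Metric.ball y₁ ρ with hZ
  have hcont : Continuous fun z : F => y + R z := by fun_prop
  have hZo : IsOpen Z := Metric.isOpen_ball.inter (Metric.isOpen_ball.preimage hcont)
  have hZc : Convex ℝ Z := by
    refine (convex_ball _ _).inter ?_
    have := ((convex_ball y₁ ρ).translate_preimage_right y).linear_preimage R.toLinearMap
    exact this
  have h2 : ∫⁻ z in Metric.ball (0 : F) r, f (y + R z) ∂ν =
      ∫⁻ z in Z, (‖w (y + R z)‖ₑ ^ q)⁻¹ ∂ν := by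
    rw [← lintegral_indicator measurableSet_ball, ← lintegral_indicator hZo.measurableSet]
    congr 1
    ext z
    by_cases hz : z ∈ Metric.ball (0 : F) r
    · rw [indicator_of_mem hz]
      by_cases hz' : y + R z ∈ Metric.ball y₁ ρ
      · rw [indicator_of_mem (show z ∈ Z from ⟨hz, hz'⟩), hfw _ hz']
      · rw [indicator_of_notMem (show z ∉ Z from fun h => hz' h.2), hf, indicator_of_notMem hz']
    · rw [indicator_of_notMem hz, indicator_of_notMem (show z ∉ Z from fun h => hz h.1)]
  rw [h2]
  refine lintegral_inv_norm_pow_le_of_quasi_antilipschitz ν q hr.le inter_subset_left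
    hZo.measurableSet fun z hz z' hz' => ?_
  -- on the convex set `Z` the map `z ↦ w (y + R z) - z` is `1 / 2`-Lipschitz
  have h3 : ∀ x ∈ Z, HasFDerivWithinAt (fun z => w (y + R z)) (w' (y + R x) ∘L R) Z x := fun x hx =>
    ((hw _ hx.2).comp x (R.hasFDerivAt.const_add y)).hasFDerivWithinAt
  have h4 := hZc.norm_image_sub_le_of_norm_hasFDerivWithin_le' h3 (fun x hx => hwR _ hx.2) hz' hz
  simp only [ContinuousLinearMap.id_apply] at h4
  have h5 : ‖z - z'‖ ≤ ‖w (y + R z) - w (y + R z')‖ + 1 / 2 * ‖z - z'‖ := by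
    calc ‖z - z'‖ = ‖(w (y + R z) - w (y + R z')) - (w (y + R z) - w (y + R z') - (z - z'))‖ := by
          congr 1; abel
      _ ≤ _ := (norm_sub_le _ _).trans (by gcongr)
  linarith [norm_sub_le (w (y + R z)) (w (y + R z'))]

end Analysis

/-! ### Transverse sections at scale `τ` -/

section LocalEstimate

variable {F : Type*} [NormedAddCommGroup F] [NormedSpace ℂ F]
variable {V : Type*} [NormedAddCommGroup V] [NormedSpace ℝ V]

/-- The coordinate data, on a set `U` of a chart, of a section `u` with covariant derivative `θ`,
with bounds that are uniform in the scale `τ = √k`. The connection is `A + i τ² α`, and `Γ` stands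
for the Christoffel symbols; the lengths are Euclidean, which is why `θ` is bounded by a multiple of
`τ`, its covariant derivative by a multiple of `τ²`, and its right inverse by one of `τ⁻¹`. Only the
variation of `α` is controlled, not its size. -/
structure TransverseBounds (B η τ : ℝ) (U : Set V) (u : V → F) (θ : V → V →L[ℝ] F)
    (A : V → V →L[ℝ] F →L[ℝ] F) (α : V → V →L[ℝ] ℝ) (Γ : V → V → V → V) : Prop where
  hasFDerivAt : ∀ y ∈ U, ∃ u' : V →L[ℝ] F, HasFDerivAt u u' y ∧
    ∀ v, θ y v = u' v + A y v (u y) + (Complex.I * ((τ ^ 2 * α y v : ℝ) : ℂ)) • u y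
  bound_u : ∀ y ∈ U, ‖u y‖ ≤ B
  bound_θ : ∀ y ∈ U, ∀ v, ‖θ y v‖ ≤ B * τ * ‖v‖
  bound_A : ∀ y ∈ U, ∀ v z, ‖A y v z‖ ≤ B * ‖v‖ * ‖z‖
  lipschitz_α : ∀ y ∈ U, ∀ y' ∈ U, ∀ v, |α y v - α y' v| ≤ B * ‖y - y'‖ * ‖v‖
  bound_Γ : ∀ y ∈ U, ∀ v w, ‖Γ y v w‖ ≤ B * ‖v‖ * ‖w‖
  bound_dθ : ∀ y ∈ U, ∃ θ' : V →L[ℝ] V →L[ℝ] F, HasFDerivAt θ θ' y ∧ ∀ v w,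
    ‖θ' v w + A y v (θ y w) + (Complex.I * ((τ ^ 2 * α y v : ℝ) : ℂ)) • θ y w - θ y (Γ y v w)‖ ≤
      B * τ ^ 2 * ‖v‖ * ‖w‖
  transverse : ∀ y ∈ U, ‖u y‖ ≤ η →
    ∃ R : F →ₗ[ℝ] V, ∀ z, θ y (R z) = z ∧ ‖R z‖ ≤ B * τ⁻¹ * ‖z‖

variable {B η τ : ℝ} {U : Set V} {u : V → F} {θ : V → V →L[ℝ] F}
    {A : V → V →L[ℝ] F →L[ℝ] F} {α : V → V →L[ℝ] ℝ} {Γ : V → V → V → V}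

/-- The gauge factor that makes the connection form `i τ² α` vanish at `y₁`. -/
noncomputable def gaugeFactor (τ : ℝ) (a : V →L[ℝ] ℝ) (y₁ y : V) : ℂ :=
  Complex.exp (Complex.I * ((τ ^ 2 * a (y - y₁) : ℝ) : ℂ))

theorem norm_gaugeFactor (a : V →L[ℝ] ℝ) (y₁ y : V) : ‖gaugeFactor τ a y₁ y‖ = 1 := by
  rw [gaugeFactor, mul_comm, Complex.norm_exp_ofReal_mul_I]

theorem gaugeFactor_self (a : V →L[ℝ] ℝ) (y₁ : V) : gaugeFactor τ a y₁ y₁ = 1 := by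
  simp [gaugeFactor]

/-- The gauge factor conjugates the derivative into the covariant derivative of the constant
connection form `i τ² a`. -/
theorem hasFDerivAt_gaugeFactor_smul {G : Type*} [NormedAddCommGroup G] [NormedSpace ℂ G]
    (a : V →L[ℝ] ℝ) (y₁ : V) {f : V → G} {f' : V →L[ℝ] G} {y : V} (hf : HasFDerivAt f f' y) :
    ∃ h' : V →L[ℝ] G, HasFDerivAt (fun y => gaugeFactor τ a y₁ y • f y) h' y ∧
      ∀ v, h' v = gaugeFactor τ a y₁ y • (f' v + (Complex.I * ((τ ^ 2 * a v : ℝ) : ℂ)) • f y) := by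
  have h1 : HasFDerivAt (fun y : V => τ ^ 2 * a (y - y₁)) ((τ ^ 2) • a) y :=
    (a.hasFDerivAt.comp y (hasFDerivAt_id y |>.sub_const y₁)).const_mul (τ ^ 2)
  have h2 := (((Complex.ofRealCLM.hasFDerivAt.comp y h1).const_mul Complex.I).cexp).smul hf
  refine ⟨_, h2, fun v => ?_⟩
  simp [gaugeFactor, smul_smul, smul_add, mul_assoc]

/-- In the gauge of `y₁` the derivative of the section is its covariant derivative up to an error of
order `τ`, although the connection form is of order `τ²`: at distance at most `1 / τ` from `y₁` the
form `τ² α` has varied by a multiple of `τ` only. -/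
theorem TransverseBounds.hasFDerivAt_gauge (h : TransverseBounds B η τ U u θ A α Γ)
    (hB : 1 ≤ B) (hτ : 1 ≤ τ) {ρ₀ : ℝ} (hρ1 : ρ₀ ≤ 1) {y₁ y : V} (hy₁ : y₁ ∈ U) (hy : y ∈ U)
    (hyy : ‖y - y₁‖ ≤ ρ₀ / τ) :
    ∃ w' : V →L[ℝ] F, HasFDerivAt (fun y => gaugeFactor τ (α y₁) y₁ y • u y) w' y ∧
      ∀ v, ‖w' v - gaugeFactor τ (α y₁) y₁ y • θ y v‖ ≤ 2 * B * τ * ‖u y‖ * ‖v‖ := by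
  obtain ⟨u', hu', hθ⟩ := h.hasFDerivAt y hy
  obtain ⟨w', hw', hv⟩ := hasFDerivAt_gaugeFactor_smul (τ := τ) (α y₁) y₁ hu'
  refine ⟨w', hw', fun v => ?_⟩
  have e : w' v - gaugeFactor τ (α y₁) y₁ y • θ y v = gaugeFactor τ (α y₁) y₁ y •
      (-(A y v (u y)) - (Complex.I * ((τ ^ 2 * (α y v - α y₁ v) : ℝ) : ℂ)) • u y) := by
    rw [hv, hθ, ← smul_sub]
    congr 1
    push_cast
    module
  rw [e, norm_smul, norm_gaugeFactor, one_mul]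
  have hτ0 : 0 < τ := by linarith
  have h1 := h.bound_A y hy v (u y)
  have h2 := h.lipschitz_α y hy y₁ hy₁ v
  have h3 : ‖(Complex.I * ((τ ^ 2 * (α y v - α y₁ v) : ℝ) : ℂ)) • u y‖ ≤ B * τ * ‖v‖ * ‖u y‖ := by
    rw [norm_smul, norm_mul, Complex.norm_I, one_mul, Complex.norm_real, Real.norm_eq_abs, abs_mul,
      abs_of_nonneg (by positivity : 0 ≤ τ ^ 2)]
    refine mul_le_mul_of_nonneg_right ?_ (norm_nonneg _)
    calc τ ^ 2 * |α y v - α y₁ v| ≤ τ ^ 2 * (B * (1 / τ) * ‖v‖) := by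
          gcongr
          refine h2.trans ?_
          gcongr
          exact hyy.trans (by gcongr)
      _ = B * τ * ‖v‖ := by field_simp
  have h4 : B * ‖v‖ * ‖u y‖ ≤ B * τ * ‖v‖ * ‖u y‖ := by
    gcongr
    nlinarith
  calc _ ≤ ‖-(A y v (u y))‖ + ‖(Complex.I * ((τ ^ 2 * (α y v - α y₁ v) : ℝ) : ℂ)) • u y‖ :=
        norm_sub_le _ _
    _ ≤ B * τ * ‖v‖ * ‖u y‖ + B * τ * ‖v‖ * ‖u y‖ := by
        rw [norm_neg]; gcongr; exact h1.trans h4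
    _ = _ := by ring

/-- The norm of the section hardly varies on a ball of radius `ρ₀ / τ`. The gauge factor is
unimodular, so that the section may be replaced by its expression in the gauge of the centre, whose
derivative is of order `τ`. -/
theorem TransverseBounds.norm_gauge_sub_le (h : TransverseBounds B η τ U u θ A α Γ)
    (hB : 1 ≤ B) (hτ : 1 ≤ τ) {ρ₀ : ℝ} (hρ1 : ρ₀ ≤ 1) {y₁ : V}
    (hU : Metric.ball y₁ (ρ₀ / τ) ⊆ U) {y : V} (hy : y ∈ Metric.ball y₁ (ρ₀ / τ)) :
    |‖u y‖ - ‖u y₁‖| ≤ 3 * B ^ 2 * ρ₀ := by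
  have hτ0 : 0 < τ := by linarith
  have hy₁ : y₁ ∈ Metric.ball y₁ (ρ₀ / τ) := Metric.mem_ball_self
    ((dist_nonneg).trans_lt (Metric.mem_ball.1 hy))
  have hd : ∀ x ∈ Metric.ball y₁ (ρ₀ / τ), ‖x - y₁‖ ≤ ρ₀ / τ := fun x hx =>
    (mem_ball_iff_norm.1 hx).le
  have key : ∀ x ∈ Metric.ball y₁ (ρ₀ / τ), ∃ w' : V →L[ℝ] F,
      HasFDerivAt (fun y => gaugeFactor τ (α y₁) y₁ y • u y) w' x ∧ ‖w'‖ ≤ 3 * B ^ 2 * τ := by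
    intro x hx
    obtain ⟨w', hw', hv⟩ := h.hasFDerivAt_gauge hB hτ hρ1 (hU hy₁) (hU hx) (hd x hx)
    refine ⟨w', hw', ContinuousLinearMap.opNorm_le_bound _ (by positivity) fun v => ?_⟩
    have h1 : ‖gaugeFactor τ (α y₁) y₁ x • θ x v‖ ≤ B * τ * ‖v‖ := by
      rw [norm_smul, norm_gaugeFactor, one_mul]; exact h.bound_θ x (hU hx) v
    have h2 : 2 * B * τ * ‖u x‖ * ‖v‖ ≤ 2 * B * τ * B * ‖v‖ := by
      gcongr; exact h.bound_u x (hU hx)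
    have h3 : B * τ * ‖v‖ ≤ B * B * τ * ‖v‖ := by
      gcongr; nlinarith
    calc ‖w' v‖ ≤ ‖w' v - gaugeFactor τ (α y₁) y₁ x • θ x v‖ +
          ‖gaugeFactor τ (α y₁) y₁ x • θ x v‖ := by
          have := norm_add_le (w' v - gaugeFactor τ (α y₁) y₁ x • θ x v)
            (gaugeFactor τ (α y₁) y₁ x • θ x v)
          rwa [sub_add_cancel] at this
      _ ≤ 2 * B * τ * B * ‖v‖ + B * B * τ * ‖v‖ := add_le_add ((hv v).trans h2) (h1.trans h3)
      _ = 3 * B ^ 2 * τ * ‖v‖ := by ring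
  choose! w' hw' hn using key
  have h1 := (convex_ball y₁ (ρ₀ / τ)).norm_image_sub_le_of_norm_hasFDerivWithin_le
    (fun x hx => (hw' x hx).hasFDerivWithinAt) hn hy₁ hy
  have h2 : ∀ x, ‖u x‖ = ‖gaugeFactor τ (α y₁) y₁ x • u x‖ := fun x => by
    rw [norm_smul, norm_gaugeFactor, one_mul]
  calc |‖u y‖ - ‖u y₁‖|
      ≤ ‖gaugeFactor τ (α y₁) y₁ y • u y - gaugeFactor τ (α y₁) y₁ y₁ • u y₁‖ := by
        rw [h2 y, h2 y₁]; exact abs_norm_sub_norm_le _ _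
    _ ≤ 3 * B ^ 2 * τ * ‖y - y₁‖ := h1
    _ ≤ 3 * B ^ 2 * τ * (ρ₀ / τ) := by gcongr; exact hd y hy
    _ = _ := by field_simp

/-- In the gauge of `y₁` the covariant derivative varies slowly near `y₁`. -/
theorem TransverseBounds.norm_gauge_θ_sub_le (h : TransverseBounds B η τ U u θ A α Γ)
    (hB : 1 ≤ B) (hτ : 1 ≤ τ) {ρ₀ : ℝ} (hρ1 : ρ₀ ≤ 1) {y₁ : V}
    (hU : Metric.ball y₁ (ρ₀ / τ) ⊆ U) {y : V} (hy : y ∈ Metric.ball y₁ (ρ₀ / τ)) (v : V) :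
    ‖gaugeFactor τ (α y₁) y₁ y • θ y v - θ y₁ v‖ ≤ 4 * B ^ 2 * ρ₀ * τ * ‖v‖ := by
  have hτ0 : 0 < τ := by linarith
  have hy₁ : y₁ ∈ Metric.ball y₁ (ρ₀ / τ) := Metric.mem_ball_self
    ((dist_nonneg).trans_lt (Metric.mem_ball.1 hy))
  have hd : ∀ x ∈ Metric.ball y₁ (ρ₀ / τ), ‖x - y₁‖ ≤ ρ₀ / τ := fun x hx =>
    (mem_ball_iff_norm.1 hx).le
  have key : ∀ x ∈ Metric.ball y₁ (ρ₀ / τ), ∃ G' : V →L[ℝ] F,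
      HasFDerivAt (fun y => gaugeFactor τ (α y₁) y₁ y • θ y v) G' x ∧
        ‖G'‖ ≤ 4 * B ^ 2 * τ ^ 2 * ‖v‖ := by
    intro x hx
    obtain ⟨θ', hθ', hb⟩ := h.bound_dθ x (hU hx)
    have hθv : HasFDerivAt (fun y => θ y v) (θ'.flip v) x := by
      have := hθ'.clm_apply (hasFDerivAt_const v x)
      convert this using 1
      ext z; simp
    obtain ⟨G', hG', hv⟩ := hasFDerivAt_gaugeFactor_smul (τ := τ) (α y₁) y₁ hθv
    refine ⟨G', hG', ContinuousLinearMap.opNorm_le_bound _ (by positivity) fun z => ?_⟩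
    rw [hv, norm_smul, norm_gaugeFactor, one_mul]
    -- up to the second covariant derivative there remain terms in `A`, `α - α y₁` and `Γ`
    have e : (θ'.flip v) z + (Complex.I * ((τ ^ 2 * α y₁ z : ℝ) : ℂ)) • θ x v =
        (θ' z v + A x z (θ x v) + (Complex.I * ((τ ^ 2 * α x z : ℝ) : ℂ)) • θ x v -
          θ x (Γ x z v)) - A x z (θ x v) -
          (Complex.I * ((τ ^ 2 * (α x z - α y₁ z) : ℝ) : ℂ)) • θ x v + θ x (Γ x z v) := by
      rw [ContinuousLinearMap.flip_apply]
      push_cast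
      module
    rw [e]
    have h0 := h.bound_θ x (hU hx) v
    have h1 := hb z v
    have h2 : ‖A x z (θ x v)‖ ≤ B ^ 2 * τ ^ 2 * ‖z‖ * ‖v‖ := by
      calc ‖A x z (θ x v)‖ ≤ B * ‖z‖ * (B * τ * ‖v‖) :=
            (h.bound_A x (hU hx) z _).trans (by gcongr)
        _ = B ^ 2 * τ * ‖z‖ * ‖v‖ := by ring
        _ ≤ _ := by gcongr; nlinarith
    have h3 : ‖(Complex.I * ((τ ^ 2 * (α x z - α y₁ z) : ℝ) : ℂ)) • θ x v‖ ≤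
        B ^ 2 * τ ^ 2 * ‖z‖ * ‖v‖ := by
      rw [norm_smul, norm_mul, Complex.norm_I, one_mul, Complex.norm_real, Real.norm_eq_abs,
        abs_mul, abs_of_nonneg (by positivity : 0 ≤ τ ^ 2)]
      calc τ ^ 2 * |α x z - α y₁ z| * ‖θ x v‖
          ≤ τ ^ 2 * (B * (1 / τ) * ‖z‖) * (B * τ * ‖v‖) := by
            gcongr
            refine (h.lipschitz_α x (hU hx) y₁ (hU hy₁) z).trans ?_
            gcongr
            exact (hd x hx).trans (by gcongr)
        _ = _ := by field_simp
    have h4 : ‖θ x (Γ x z v)‖ ≤ B ^ 2 * τ ^ 2 * ‖z‖ * ‖v‖ := by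
      calc ‖θ x (Γ x z v)‖ ≤ B * τ * (B * ‖z‖ * ‖v‖) :=
            (h.bound_θ x (hU hx) _).trans (by gcongr; exact h.bound_Γ x (hU hx) z v)
        _ = B ^ 2 * τ * ‖z‖ * ‖v‖ := by ring
        _ ≤ _ := by gcongr; nlinarith
    have h5 : B * τ ^ 2 * ‖z‖ * ‖v‖ ≤ B ^ 2 * τ ^ 2 * ‖z‖ * ‖v‖ := by gcongr; nlinarith
    refine (norm_add_le _ _).trans ?_
    refine (add_le_add (norm_sub_le _ _) le_rfl).trans ?_
    refine (add_le_add (add_le_add (norm_sub_le _ _) le_rfl) le_rfl).trans ?_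
    linarith
  choose! G' hG' hn using key
  have h1 := (convex_ball y₁ (ρ₀ / τ)).norm_image_sub_le_of_norm_hasFDerivWithin_le
    (fun x hx => (hG' x hx).hasFDerivWithinAt) hn hy₁ hy
  simp only [gaugeFactor_self, one_smul] at h1
  calc _ ≤ 4 * B ^ 2 * τ ^ 2 * ‖v‖ * ‖y - y₁‖ := h1
    _ ≤ 4 * B ^ 2 * τ ^ 2 * ‖v‖ * (ρ₀ / τ) := by gcongr; exact hd y hy
    _ = _ := by field_simp

variable [FiniteDimensional ℝ F] [MeasurableSpace F] [BorelSpace F] [Nontrivial F]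
  [FiniteDimensional ℝ V] [MeasurableSpace V] [BorelSpace V]

/-- The estimate that uniform transversality is used for: the singularity of
`‖u‖ ^ (-(dim F - 1))` is integrable, with a bound that does not depend on the scale `τ`. -/
theorem exists_lintegral_inv_norm_pow_le (μ : Measure V) [μ.IsAddHaarMeasure] (hB : 1 ≤ B)
    (hη : 0 < η) {R : ℝ} (hR : 0 < R) (y₀ : V) :
    ∃ C : ENNReal, C ≠ ⊤ ∧ ∀ (τ : ℝ) (u : V → F) (θ : V → V →L[ℝ] F)
      (A : V → V →L[ℝ] F →L[ℝ] F) (α : V → V →L[ℝ] ℝ) (Γ : V → V → V → V), 1 ≤ τ →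
      TransverseBounds B η τ (Metric.ball y₀ (4 * R)) u θ A α Γ →
      ∫⁻ y in Metric.ball y₀ R, (‖u y‖ₑ ^ (Module.finrank ℝ F - 1))⁻¹ ∂μ ≤ C := by
  classical
  set q := Module.finrank ℝ F - 1 with hq
  let ν : Measure F := Measure.addHaar
  -- `ε` separates the points where transversality is used from those where `u` is not small; `ρ₀`
  -- is the radius, at scale `1 / τ`, of the balls on which `u` and its derivative hardly vary.
  set ε := min η (1 / (16 * B ^ 2)) with hε
  have hε0 : 0 < ε := by positivity
  set ρ₀ := min (min R 1) (ε / (40 * B ^ 4)) with hρ₀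
  have hρ0 : 0 < ρ₀ := by positivity
  have hρR : ρ₀ ≤ R := (min_le_left _ _).trans (min_le_left _ _)
  have hρ1 : ρ₀ ≤ 1 := (min_le_left _ _).trans (min_le_right _ _)
  have hρε : 40 * B ^ 4 * ρ₀ ≤ ε := by
    have := min_le_right (min R 1) (ε / (40 * B ^ 4))
    rw [← hρ₀, le_div_iff₀ (by positivity)] at this
    linarith
  have hεη : ε ≤ η := min_le_left _ _
  have hεB : 16 * B ^ 2 * ε ≤ 1 := by
    have := min_le_right η (1 / (16 * B ^ 2))
    rw [← hε, le_div_iff₀ (by positivity)] at this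
    linarith
  have hB2 : B ^ 2 ≤ B ^ 4 := pow_le_pow_right₀ hB (by norm_num)
  have hB3 : B ^ 3 ≤ B ^ 4 := pow_le_pow_right₀ hB (by norm_num)
  have hB22 : 1 ≤ B ^ 2 := one_le_pow₀ hB
  have hε1 : ε ≤ 1 := by nlinarith
  have hB0 : 0 < B := by linarith
  set r := ρ₀ / B with hr
  have hr0 : 0 < r := by positivity
  set I := 4 ^ q * ∫⁻ z in Metric.ball (0 : F) (2 * r), (‖z‖ₑ ^ q)⁻¹ ∂ν with hI
  have hIt : I ≠ ⊤ := ENNReal.mul_ne_top (by finiteness)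
    (lintegral_ball_inv_norm_pow_lt_top ν _).ne
  set d := Module.finrank ℝ V
  have hν0 : ν (Metric.ball (0 : F) r) ≠ 0 := (Metric.measure_ball_pos ν _ hr0).ne'
  have hνt : ν (Metric.ball (0 : F) r) ≠ ⊤ := measure_ball_lt_top.ne
  set c := (ν (Metric.ball (0 : F) r))⁻¹ * (ENNReal.ofReal (2 ^ d) * I) +
    (ENNReal.ofReal (ε / 2) ^ q)⁻¹ with hc
  have hct : c ≠ ⊤ := by
    refine ENNReal.add_ne_top.2 ⟨ENNReal.mul_ne_top (ENNReal.inv_ne_top.2 hν0)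
      (ENNReal.mul_ne_top ENNReal.ofReal_ne_top hIt), ENNReal.inv_ne_top.2 (pow_ne_zero _ ?_)⟩
    rw [Ne, ENNReal.ofReal_eq_zero, not_le]
    positivity
  refine ⟨c * μ (Metric.ball y₀ (2 * R)), ENNReal.mul_ne_top hct measure_ball_lt_top.ne,
    fun τ u θ A α Γ hτ h => ?_⟩
  have hτ0 : 0 < τ := by linarith
  set U := Metric.ball y₀ (4 * R) with hUdef
  have hum : Measurable (U.piecewise u 0) :=
    ContinuousOn.measurable_piecewise
      (fun y hy => let ⟨_, h1, _⟩ := h.hasFDerivAt y hy; h1.continuousAt.continuousWithinAt)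
      continuousOn_const measurableSet_ball
  have hfm : Measurable fun y => (‖U.piecewise u 0 y‖ₑ ^ q)⁻¹ := (hum.enorm.pow_const q).inv
  have hfu : ∀ y ∈ U, (‖U.piecewise u 0 y‖ₑ ^ q)⁻¹ = (‖u y‖ₑ ^ q)⁻¹ := fun y hy => by
    rw [piecewise_eq_of_mem _ _ _ hy]
  rw [← setLIntegral_congr_fun measurableSet_ball
    fun y hy => hfu y (Metric.ball_subset_ball (by linarith) hy)]
  have hρτ : ρ₀ / τ ≤ ρ₀ := div_le_self hρ0.le hτ
  refine lintegral_ball_le_of_small_balls μ hfm (ρ := ρ₀ / τ) (by positivity) (hρτ.trans hρR)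
    fun y₁ hy₁ => ?_
  have hsub : Metric.ball y₁ (ρ₀ / τ) ⊆ U := by
    refine Metric.ball_subset_ball' ?_
    have := Metric.mem_ball.1 hy₁
    linarith
  have hy₁U : y₁ ∈ U := Metric.ball_subset_ball (by linarith) hy₁
  rw [setLIntegral_congr_fun measurableSet_ball fun y hy => hfu y (hsub hy)]
  have hvar : ∀ y ∈ Metric.ball y₁ (ρ₀ / τ), |‖u y‖ - ‖u y₁‖| ≤ 3 * B ^ 2 * ρ₀ := fun y hy =>
    h.norm_gauge_sub_le hB hτ hρ1 hsub hy
  have hsmall : 3 * B ^ 2 * ρ₀ ≤ ε / 2 := by nlinarith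
  rcases lt_or_ge ε (‖u y₁‖) with hu | hu
  -- `‖u‖ ≥ ε / 2` on the whole small ball
  · calc ∫⁻ y in Metric.ball y₁ (ρ₀ / τ), (‖u y‖ₑ ^ q)⁻¹ ∂μ
        ≤ ∫⁻ y in Metric.ball y₁ (ρ₀ / τ), (ENNReal.ofReal (ε / 2) ^ q)⁻¹ ∂μ := by
          refine setLIntegral_mono' measurableSet_ball fun y hy => ?_
          refine ENNReal.inv_le_inv.2 ?_
          gcongr
          rw [← ofReal_norm]
          refine ENNReal.ofReal_le_ofReal ?_
          have := (abs_le.1 (hvar y hy)).1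
          linarith
      _ = (ENNReal.ofReal (ε / 2) ^ q)⁻¹ * μ (Metric.ball 0 (ρ₀ / τ)) := by
          rw [setLIntegral_const, Measure.addHaar_ball_center μ y₁]
      _ ≤ _ := by gcongr; exact le_add_self
  -- transversality at the centre; in its gauge `u` is close to a submersion on the small ball
  · obtain ⟨S, hS⟩ := h.transverse y₁ hy₁U (hu.trans hεη)
    have hw : ∀ y ∈ Metric.ball y₁ (ρ₀ / τ), ∃ w' : V →L[ℝ] F,
        HasFDerivAt (fun y => gaugeFactor τ (α y₁) y₁ y • u y) w' y ∧
        ‖w' ∘L S.toContinuousLinearMap - ContinuousLinearMap.id ℝ F‖ ≤ 1 / 2 := by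
      intro y hy
      obtain ⟨w', hw', hv⟩ := h.hasFDerivAt_gauge hB hτ hρ1 hy₁U (hsub hy)
        (mem_ball_iff_norm.1 hy).le
      refine ⟨w', hw', ContinuousLinearMap.opNorm_le_bound _ (by norm_num) fun z => ?_⟩
      have h1 := hv (S z)
      have h2 := h.norm_gauge_θ_sub_le hB hτ hρ1 hsub hy (S z)
      rw [(hS z).1] at h2
      have h3 : ‖u y‖ ≤ ε + 3 * B ^ 2 * ρ₀ := by
        have := (abs_le.1 (hvar y hy)).2
        linarith
      have h4 : ‖w' (S z) - z‖ ≤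
          (2 * B * τ * (ε + 3 * B ^ 2 * ρ₀) + 4 * B ^ 2 * ρ₀ * τ) * ‖S z‖ := by
        calc ‖w' (S z) - z‖ = ‖(w' (S z) - gaugeFactor τ (α y₁) y₁ y • θ y (S z)) +
              (gaugeFactor τ (α y₁) y₁ y • θ y (S z) - z)‖ := by congr 1; abel
          _ ≤ 2 * B * τ * (ε + 3 * B ^ 2 * ρ₀) * ‖S z‖ + 4 * B ^ 2 * ρ₀ * τ * ‖S z‖ :=
              (norm_add_le _ _).trans (add_le_add (h1.trans (by gcongr)) h2)
          _ = _ := by ring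
      calc ‖w' (S z) - z‖
          ≤ (2 * B * τ * (ε + 3 * B ^ 2 * ρ₀) + 4 * B ^ 2 * ρ₀ * τ) * (B * τ⁻¹ * ‖z‖) :=
            h4.trans (by gcongr; exact (hS z).2)
        _ = (2 * B ^ 2 * ε + 6 * B ^ 4 * ρ₀ + 4 * B ^ 3 * ρ₀) * ‖z‖ := by field_simp; ring
        _ ≤ 1 / 2 * ‖z‖ := by
            gcongr
            have : B ^ 3 * ρ₀ ≤ B ^ 4 * ρ₀ := by gcongr
            linarith
    choose! w' hw' hn using hw
    have h5 := lintegral_small_ball_le μ ν q hr0 hw' S.toContinuousLinearMap (fun z => ?_)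
      (by positivity) hn
    · have h6 : ∀ y, ‖gaugeFactor τ (α y₁) y₁ y • u y‖ₑ = ‖u y‖ₑ := fun y => by
        rw [← ofReal_norm, norm_smul, norm_gaugeFactor, one_mul, ofReal_norm]
      simp only [h6] at h5
      rw [Measure.addHaar_ball_center μ y₁, Measure.addHaar_ball_mul_of_pos μ _ (by norm_num)] at h5
      calc ∫⁻ y in Metric.ball y₁ (ρ₀ / τ), (‖u y‖ₑ ^ q)⁻¹ ∂μ
          = (ν (Metric.ball (0 : F) r))⁻¹ * (ν (Metric.ball (0 : F) r) *
            ∫⁻ y in Metric.ball y₁ (ρ₀ / τ), (‖u y‖ₑ ^ q)⁻¹ ∂μ) := by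
            rw [← mul_assoc, ENNReal.inv_mul_cancel hν0 hνt, one_mul]
        _ ≤ (ν (Metric.ball (0 : F) r))⁻¹ *
            (ENNReal.ofReal (2 ^ d) * μ (Metric.ball 0 (ρ₀ / τ)) * I) := by gcongr
        _ = (ν (Metric.ball (0 : F) r))⁻¹ * (ENNReal.ofReal (2 ^ d) * I) *
            μ (Metric.ball 0 (ρ₀ / τ)) := by ring
        _ ≤ _ := by gcongr; exact le_self_add
    · calc ‖S z‖ * r ≤ B * τ⁻¹ * ‖z‖ * r := by gcongr; exact (hS z).2
        _ = ρ₀ / τ * ‖z‖ := by rw [hr]; field_simp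

end LocalEstimate

/-! ### Calculus in charts -/

section ChartCalculus

variable {d : ℕ} {M : Type*} [TopologicalSpace M] [ChartedSpace (EuclideanSpace ℝ (Fin d)) M]

theorem isOpen_dom (c : M) : IsOpen (dom c : Set (EuclideanSpace ℝ (Fin d))) :=
  isOpen_extChartAt_target c

theorem continuousOn_param (c : M) :
    ContinuousOn (param c : EuclideanSpace ℝ (Fin d) → M) (dom c) :=
  continuousOn_extChartAt_symm c

theorem isOpen_dom_inter (c : M) {U : Set M} (hU : IsOpen U) :
    IsOpen (dom c ∩ param c ⁻¹' U : Set (EuclideanSpace ℝ (Fin d))) :=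
  (continuousOn_param c).isOpen_inter_preimage (isOpen_dom c) hU

theorem param_mem_source {c : M} {y : EuclideanSpace ℝ (Fin d)} (hy : y ∈ dom c) :
    param c y ∈ (extChartAt (𝓡 d) c).source :=
  (extChartAt (𝓡 d) c).map_target hy

theorem extChartAt_param {c : M} {y : EuclideanSpace ℝ (Fin d)} (hy : y ∈ dom c) :
    extChartAt (𝓡 d) c (param c y) = y :=
  (extChartAt (𝓡 d) c).right_inv hy

theorem param_extChartAt {c x : M} (hx : x ∈ (extChartAt (𝓡 d) c).source) :
    param c (extChartAt (𝓡 d) c x) = x :=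
  (extChartAt (𝓡 d) c).left_inv hx

theorem extChartAt_mem_dom {c x : M} (hx : x ∈ (extChartAt (𝓡 d) c).source) :
    extChartAt (𝓡 d) c x ∈ (dom c : Set (EuclideanSpace ℝ (Fin d))) :=
  (extChartAt (𝓡 d) c).map_source hx

variable {G : Type*} [NormedAddCommGroup G] [NormedSpace ℝ G] {p : ℕ}

/-- All tangent spaces are the same space `ℝ^d`, so that the values of a form at two equal points
can be compared without a transport. -/
theorem DForm.apply_congr (α : DForm d M p G) {x x' : M} (h : x = x')
    (v : Fin p → EuclideanSpace ℝ (Fin d)) :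
    (α x : EuclideanSpace ℝ (Fin d) [⋀^Fin p]→L[ℝ] G) v =
      (α x' : EuclideanSpace ℝ (Fin d) [⋀^Fin p]→L[ℝ] G) v := by
  subst h; rfl

theorem DForm.SmoothOn.contDiffAt {α : DForm d M p G} {U : Set M} (hα : α.SmoothOn U)
    (hU : IsOpen U) {c : M} {y : EuclideanSpace ℝ (Fin d)} (hy : y ∈ dom c) (hyU : param c y ∈ U) :
    ContDiffAt ℝ ∞ (α.inChart c) y :=
  (hα c).contDiffAt ((isOpen_dom_inter c hU).mem_nhds ⟨hy, hyU⟩)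

variable [IsManifold (𝓡 d) ∞ M]

theorem contMDiffAt_param {c : M} {y : EuclideanSpace ℝ (Fin d)} (hy : y ∈ dom c) :
    ContMDiffAt 𝓘(ℝ, EuclideanSpace ℝ (Fin d)) (𝓡 d) ∞ (param c) y :=
  (contMDiffOn_extChartAt_symm c).contMDiffAt ((isOpen_dom c).mem_nhds hy)

theorem mdifferentiableAt_param {c : M} {y : EuclideanSpace ℝ (Fin d)} (hy : y ∈ dom c) :
    MDifferentiableAt 𝓘(ℝ, EuclideanSpace ℝ (Fin d)) (𝓡 d) (param c) y :=
  (contMDiffAt_param hy).mdifferentiableAt (by simp)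

theorem fderiv_comp_param {f : M → G} {c : M} {y : EuclideanSpace ℝ (Fin d)} (hy : y ∈ dom c)
    (hf : MDifferentiableAt (𝓡 d) 𝓘(ℝ, G) f (param c y)) (v : EuclideanSpace ℝ (Fin d)) :
    fderiv ℝ (fun y => f (param c y)) y v = mvfderiv (𝓡 d) f (param c y) (dparam c y v) := by
  have h1 := (hf.hasMFDerivAt.comp y (mdifferentiableAt_param hy).hasMFDerivAt).mfderiv
  have h2 := congrArg (fun T => T v) h1
  rw [← mfderiv_eq_fderiv]
  exact h2

theorem contDiffOn_comp_param {f : M → G} {U : Set M} (hU : IsOpen U)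
    (hf : ContMDiffOn (𝓡 d) 𝓘(ℝ, G) ∞ f U) (c : M) :
    ContDiffOn ℝ ∞ (fun y : EuclideanSpace ℝ (Fin d) => f (param c y)) (dom c ∩ param c ⁻¹' U) := by
  intro y hy
  have h1 := (hf.contMDiffAt (hU.mem_nhds hy.2)).comp y (contMDiffAt_param hy.1)
  exact h1.contDiffAt.contDiffWithinAt

theorem mvfderiv_extChartAt_dparam {c : M} {y : EuclideanSpace ℝ (Fin d)} (hy : y ∈ dom c)
    (v : EuclideanSpace ℝ (Fin d)) :
    mvfderiv (𝓡 d) (extChartAt (𝓡 d) c) (param c y) (dparam c y v) = v := by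
  have hc : MDifferentiableAt (𝓡 d) 𝓘(ℝ, EuclideanSpace ℝ (Fin d)) (extChartAt (𝓡 d) c)
      (param c y) :=
    ((contMDiffAt_extChartAt' (n := ∞)
      (by simpa using param_mem_source hy)).mdifferentiableAt (by simp))
  rw [← fderiv_comp_param hy hc]
  have : (fun y => extChartAt (𝓡 d) c (param c y)) =ᶠ[𝓝 y] id := by
    filter_upwards [(isOpen_dom c).mem_nhds hy] with z hz using extChartAt_param hz
  rw [this.fderiv_eq]
  simp

theorem dparam_mvfderiv_extChartAt {c : M} {y : EuclideanSpace ℝ (Fin d)} (hy : y ∈ dom c)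
    (v : TangentSpace (𝓡 d) (param c y)) :
    dparam c y (mvfderiv (𝓡 d) (extChartAt (𝓡 d) c) (param c y) v) = v := by
  -- a left inverse of an endomorphism of `ℝ^d` is a right inverse
  let f : EuclideanSpace ℝ (Fin d) →ₗ[ℝ] EuclideanSpace ℝ (Fin d) :=
    (mvfderiv (𝓡 d) (extChartAt (𝓡 d) c) (param c y)).toLinearMap
  let g : EuclideanSpace ℝ (Fin d) →ₗ[ℝ] EuclideanSpace ℝ (Fin d) := (dparam c y).toLinearMap
  have h1 : f * g = 1 := by
    ext1 w
    exact mvfderiv_extChartAt_dparam hy w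
  have h2 : g * f = 1 := mul_eq_one_comm.1 h1
  exact congrArg (fun T => T v) h2

theorem dparam_injective {c : M} {y : EuclideanSpace ℝ (Fin d)} (hy : y ∈ dom c)
    {v : EuclideanSpace ℝ (Fin d)} (hv : dparam c y v = 0) : v = 0 := by
  rw [← mvfderiv_extChartAt_dparam hy v, hv, map_zero]

/-- The change of charts is smooth. -/
theorem contDiffAt_transition (c x : M) {y : EuclideanSpace ℝ (Fin d)} (hy : y ∈ dom c)
    (hx : param c y ∈ (extChartAt (𝓡 d) x).source) :
    ContDiffAt ℝ ∞ (fun y => extChartAt (𝓡 d) x (param c y)) y := by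
  have h1 : ContMDiffAt (𝓡 d) 𝓘(ℝ, EuclideanSpace ℝ (Fin d)) ∞ (extChartAt (𝓡 d) x) (param c y) :=
    contMDiffAt_extChartAt' (by simpa using hx)
  exact (h1.comp y (contMDiffAt_param hy)).contDiffAt

/-- The chain rule for the change of charts. -/
theorem dparam_transition (c x : M) {y : EuclideanSpace ℝ (Fin d)} (hy : y ∈ dom c)
    (hx : param c y ∈ (extChartAt (𝓡 d) x).source) (v : EuclideanSpace ℝ (Fin d)) :
    (dparam x (extChartAt (𝓡 d) x (param c y))
      (fderiv ℝ (fun y => extChartAt (𝓡 d) x (param c y)) y v) : EuclideanSpace ℝ (Fin d)) =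
      dparam c y v := by
  have hz : extChartAt (𝓡 d) x (param c y) ∈ dom x := extChartAt_mem_dom hx
  have hc : MDifferentiableAt (𝓡 d) 𝓘(ℝ, EuclideanSpace ℝ (Fin d)) (extChartAt (𝓡 d) x)
      (param c y) :=
    ((contMDiffAt_extChartAt' (n := ∞) (by simpa using hx)).mdifferentiableAt (by simp))
  rw [fderiv_comp_param hy hc]
  have h1 := fun w => dparam_mvfderiv_extChartAt (c := x) hz w
  have h2 : param x (extChartAt (𝓡 d) x (param c y)) = param c y := param_extChartAt hx
  rw [h2] at h1
  exact h1 _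

/-- The expression of a form in one chart is the pullback of its expression in another chart. -/
theorem DForm.inChart_eq_pullback (α : DForm d M p G) (c x : M) {y : EuclideanSpace ℝ (Fin d)}
    (hy : y ∈ dom c) (hx : param c y ∈ (extChartAt (𝓡 d) x).source) :
    α.inChart c y = (α.inChart x (extChartAt (𝓡 d) x (param c y))).compContinuousLinearMap
      (fderiv ℝ (fun y => extChartAt (𝓡 d) x (param c y)) y) := by
  ext v
  have h1 : α.inChart c y v = (α (param c y) : EuclideanSpace ℝ (Fin d) [⋀^Fin p]→L[ℝ] G)
      (fun i => dparam c y (v i)) := rfl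
  have h2 : (α.inChart x (extChartAt (𝓡 d) x (param c y))).compContinuousLinearMap
      (fderiv ℝ (fun y => extChartAt (𝓡 d) x (param c y)) y) v =
      (α (param x (extChartAt (𝓡 d) x (param c y))) : EuclideanSpace ℝ (Fin d) [⋀^Fin p]→L[ℝ] G)
      (fun i => dparam x (extChartAt (𝓡 d) x (param c y))
        (fderiv ℝ (fun y => extChartAt (𝓡 d) x (param c y)) y (v i))) := rfl
  rw [h1, h2]
  refine (α.apply_congr (param_extChartAt hx).symm _).trans ?_
  congr 1
  ext1 i
  exact (dparam_transition c x hy hx (v i)).symm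

/-- The exterior derivative, defined at each point by means of the chart centred there, can be
computed in every chart, as it commutes with the pullback by the change of charts. -/
theorem DForm.SmoothOn.extD_inChart {α : DForm d M p G} {U : Set M} (hα : α.SmoothOn U)
    (hU : IsOpen U) {c : M} {y : EuclideanSpace ℝ (Fin d)} (hy : y ∈ dom c)
    (hyU : param c y ∈ U) :
    α.extD.inChart c y = extDeriv (α.inChart c) y := by
  set x := param c y with hxdef
  have hx : x ∈ (extChartAt (𝓡 d) x).source := mem_extChartAt_source x
  have h1 : α.inChart c =ᶠ[𝓝 y] fun y => (α.inChart x
      (extChartAt (𝓡 d) x (param c y))).compContinuousLinearMap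
      (fderiv ℝ (fun y => extChartAt (𝓡 d) x (param c y)) y) := by
    filter_upwards [(isOpen_dom_inter c (isOpen_extChartAt_source (I := 𝓡 d) x)).mem_nhds ⟨hy, hx⟩]
      with z hz using α.inChart_eq_pullback c x hz.1 hz.2
  have hz : extChartAt (𝓡 d) x x ∈ dom x := extChartAt_mem_dom hx
  have h2 : DifferentiableAt ℝ (α.inChart x) (extChartAt (𝓡 d) x (param c y)) :=
    (hα.contDiffAt hU hz (by rw [param_extChartAt hx]; exact hyU)).differentiableAt (by simp)
  have h3 := extDeriv_pullback (r := ∞) (f := fun y => extChartAt (𝓡 d) x (param c y)) h2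
    (contDiffAt_transition c x hy hx) (by
      simpa using WithTop.coe_le_coe.2 (le_top : (2 : ℕ∞) ≤ ⊤))
  rw [h1.extDeriv_eq, h3]
  ext v
  have hc : MDifferentiableAt (𝓡 d) 𝓘(ℝ, EuclideanSpace ℝ (Fin d)) (extChartAt (𝓡 d) x)
      (param c y) :=
    ((contMDiffAt_extChartAt' (n := ∞) (by simp [x])).mdifferentiableAt (by simp))
  change extDeriv (α.inChart x) (extChartAt (𝓡 d) x x)
    (fun i => mvfderiv (𝓡 d) (extChartAt (𝓡 d) x) x (dparam c y (v i))) =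
    extDeriv (α.inChart x) (extChartAt (𝓡 d) x x)
    (fun i => fderiv ℝ (fun y => extChartAt (𝓡 d) x (param c y)) y (v i))
  congr 1
  ext1 i
  rw [fderiv_comp_param hy hc]

/-- The value of the exterior derivative of a one-form on two coordinate vectors. -/
theorem OneForm.SmoothOn.extD_apply {θ : OneForm d M G} {U : Set M} (hθ : θ.SmoothOn U)
    (hU : IsOpen U) {c : M} {y : EuclideanSpace ℝ (Fin d)} (hy : y ∈ dom c)
    (hyU : param c y ∈ U) (v w : EuclideanSpace ℝ (Fin d)) :
    θ.toDForm.extD (param c y) ![dparam c y v, dparam c y w] =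
      fderiv ℝ (θ.inChart c) y v w - fderiv ℝ (θ.inChart c) y w v := by
  have e : ∀ c, θ.toDForm.inChart c = fun y =>
      ContinuousAlternatingMap.ofSubsingletonLIE (𝕜 := ℝ) (0 : Fin 1) (θ.inChart c y) :=
    fun c => rfl
  have hs : θ.toDForm.SmoothOn U := by
    intro c
    rw [e]
    exact (ContinuousAlternatingMap.ofSubsingletonLIE (𝕜 := ℝ) (E := EuclideanSpace ℝ (Fin d))
      (F := G) (0 : Fin 1)).toContinuousLinearEquiv.contDiff.comp_contDiffOn (hθ c)
  have hdiff : DifferentiableAt ℝ (θ.inChart c) y :=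
    ((hθ c).contDiffAt ((isOpen_dom_inter c hU).mem_nhds ⟨hy, hyU⟩)).differentiableAt (by simp)
  have h1 := congrArg (fun T => T ![v, w]) (hs.extD_inChart hU hy hyU)
  have h2 : θ.toDForm.extD.inChart c y ![v, w] =
      θ.toDForm.extD (param c y) ![dparam c y v, dparam c y w] := by
    change θ.toDForm.extD (param c y) (fun i => dparam c y (![v, w] i)) = _
    congr 1
    ext i : 1
    fin_cases i <;> rfl
  rw [← h2]
  refine h1.trans ?_
  have h3 : DifferentiableAt ℝ (θ.toDForm.inChart c) y :=
    (hs.contDiffAt hU hy hyU).differentiableAt (by simp)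
  rw [extDeriv_apply h3, Fin.sum_univ_two]
  have h4 : ∀ (b z : EuclideanSpace ℝ (Fin d)) (f : Fin 1 → EuclideanSpace ℝ (Fin d)), f 0 = z →
      fderiv ℝ (fun y => θ.toDForm.inChart c y f) y b = fderiv ℝ (θ.inChart c) y b z := by
    intro b z f hf
    have : (fun y => θ.toDForm.inChart c y f) = fun y => θ.inChart c y z := by
      ext1 y
      rw [← hf]
      rfl
    rw [this]
    have h5 := hdiff.hasFDerivAt.clm_apply (hasFDerivAt_const z y)
    rw [h5.fderiv]
    simp
  rw [h4 _ w _ (by rfl), h4 _ v _ (by rfl)]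
  simp [sub_eq_add_neg]

end ChartCalculus

/-! ### Explicit wedge products -/

section WedgeFormulas

variable {T : Type*} [AddCommGroup T] [Module ℝ T]
  {A : Type*} [Ring A] [Module ℝ A] [SMulCommClass ℝ A A] [IsScalarTower ℝ A A] {p q : ℕ}

/-- The wedge product as an alternating sum over all permutations, not only over shuffles. -/
theorem factorial_smul_wedge_apply (α : T [⋀^Fin p]→ₗ[ℝ] A) (β : T [⋀^Fin q]→ₗ[ℝ] A)
    (v : Fin (p + q) → T) :
    ((p.factorial * q.factorial : ℕ) : ℝ) • wedge α β v =
      ∑ σ : Equiv.Perm (Fin p ⊕ Fin q), (Equiv.Perm.sign σ : ℤ) •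
        (α (fun i => v (finSumFinEquiv (σ (Sum.inl i)))) *
          β (fun j => v (finSumFinEquiv (σ (Sum.inr j))))) := by
  have h1 := congrArg (fun f => LinearMap.mul' ℝ A (f (fun i => v (finSumFinEquiv i))))
    (MultilinearMap.domCoprod_alternization_eq α β)
  simp only [MultilinearMap.alternatization_apply, Fintype.card_fin, map_sum,
    AlternatingMap.smul_apply, map_nsmul] at h1
  rw [Nat.cast_smul_eq_nsmul]
  refine Eq.trans (Eq.symm ?_) (h1.symm.trans ?_)
  · rfl
  · refine Finset.sum_congr rfl fun σ _ => ?_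
    rw [Units.smul_def, map_zsmul]
    rfl

theorem wedge_one_one_apply (α β : T [⋀^Fin 1]→ₗ[ℝ] A) (v : Fin 2 → T) :
    wedge α β v = α (fun _ => v 0) * β (fun _ => v 1) - α (fun _ => v 1) * β (fun _ => v 0) := by
  have h := factorial_smul_wedge_apply α β v
  have hu : (Finset.univ : Finset (Equiv.Perm (Fin 1 ⊕ Fin 1))) =
      {1, Equiv.swap (Sum.inl 0) (Sum.inr 0)} := by decide
  rw [hu, Finset.sum_pair (by decide)] at h
  simp only [Nat.factorial_one, mul_one, Nat.cast_one, one_smul, Equiv.Perm.sign_one,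
    Units.val_one, Equiv.Perm.coe_one, id_eq] at h
  rw [h, Equiv.Perm.sign_swap (by decide), sub_eq_add_neg]
  have e0 : ∀ i : Fin 1, (finSumFinEquiv (Sum.inl i : Fin 1 ⊕ Fin 1) : Fin (1 + 1)) = 0 := by decide
  have e1 : ∀ i : Fin 1, (finSumFinEquiv (Sum.inr i : Fin 1 ⊕ Fin 1) : Fin (1 + 1)) = 1 := by decide
  have s0 : ∀ i : Fin 1, Equiv.swap (Sum.inl 0) (Sum.inr 0) (Sum.inl i : Fin 1 ⊕ Fin 1) =
      Sum.inr 0 := by decide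
  have s1 : ∀ i : Fin 1, Equiv.swap (Sum.inl 0) (Sum.inr 0) (Sum.inr i : Fin 1 ⊕ Fin 1) =
      Sum.inl 0 := by decide
  simp only [e0, e1, s0, s1]
  simp

end WedgeFormulas

/-! ### Curvature: change of frame and tensor powers -/

section Curvature

theorem two_le_infty : (2 : WithTop ℕ∞) ≤ (∞ : WithTop ℕ∞) :=
  WithTop.coe_le_coe.2 (le_top : (2 : ℕ∞) ≤ ⊤)

theorem hasFDerivAt_apply_const {V G : Type*} [NormedAddCommGroup V] [NormedSpace ℝ V]
    [NormedAddCommGroup G] [NormedSpace ℝ G] {f : V → V →L[ℝ] G} {f' : V →L[ℝ] V →L[ℝ] G} {y : V}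
    (hf : HasFDerivAt f f' y) (v : V) : HasFDerivAt (fun z => f z v) (f'.flip v) y :=
  (ContinuousLinearMap.apply ℝ G v).hasFDerivAt.comp y hf

variable {d : ℕ} {M : Type*} [TopologicalSpace M] [ChartedSpace (EuclideanSpace ℝ (Fin d)) M]
  {F : Type*} [NormedAddCommGroup F] [InnerProductSpace ℂ F] {ι κ : Type*}

theorem OneForm.SmoothOn.contDiffAt {G : Type*} [NormedAddCommGroup G] [NormedSpace ℝ G]
    {θ : OneForm d M G} {U : Set M} (hθ : θ.SmoothOn U)
    (hU : IsOpen U) {c : M} {y : EuclideanSpace ℝ (Fin d)} (hy : y ∈ dom c) (hyU : param c y ∈ U) :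
    ContDiffAt ℝ ∞ (θ.inChart c) y :=
  (hθ c).contDiffAt ((isOpen_dom_inter c hU).mem_nhds ⟨hy, hyU⟩)

theorem exists_param (x : M) :
    ∃ (c : M) (y : EuclideanSpace ℝ (Fin d)), y ∈ dom c ∧ param c y = x :=
  have hs := mem_extChartAt_source (I := 𝓡 d) x
  ⟨x, _, extChartAt_mem_dom hs, param_extChartAt hs⟩

variable {E : HermitianBundle d M F ι} (D : HermitianConnection E)

variable {L : HermitianBundle d M ℂ κ} (DL : HermitianConnection L)

theorem HermitianConnection.tensorPow_form_inChart (k : ℕ) (i : ι × κ) (c : M)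
    (y v : EuclideanSpace ℝ (Fin d)) :
    ((D.tensorPow DL k).form i).inChart c y v = (D.form i.1).inChart c y v +
      ((k : ℂ) * (DL.form i.2).inChart c y v 1) • (1 : F →L[ℂ] F) := rfl

variable [IsManifold (𝓡 d) ∞ M]

theorem dparam_surjective {c : M} {y : EuclideanSpace ℝ (Fin d)} (hy : y ∈ dom c) :
    Function.Surjective (dparam c y) :=
  fun v => ⟨_, dparam_mvfderiv_extChartAt hy v⟩

theorem HermitianConnection.curvature_apply {i : ι} {c : M} {y : EuclideanSpace ℝ (Fin d)}
    (hy : y ∈ dom c) (hi : param c y ∈ E.baseSet i) (v w : EuclideanSpace ℝ (Fin d)) :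
    D.curvature i (param c y) ![dparam c y v, dparam c y w] =
      fderiv ℝ ((D.form i).inChart c) y v w - fderiv ℝ ((D.form i).inChart c) y w v +
        ((D.form i).inChart c y v * (D.form i).inChart c y w -
          (D.form i).inChart c y w * (D.form i).inChart c y v) := by
  have h1 := (D.smooth_form i).extD_apply (E.isOpen_baseSet i) hy hi v w
  rw [HermitianConnection.curvature, AlternatingMap.add_apply, wedge_one_one_apply]
  exact congrArg₂ (· + ·) h1 rfl

/-- The rule of change of frame for connection forms, in a chart. -/
theorem HermitianConnection.form_inChart_gauge {i j : ι} {c : M} {y : EuclideanSpace ℝ (Fin d)}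
    (hy : y ∈ dom c) (h : param c y ∈ E.baseSet i ∩ E.baseSet j) (v : EuclideanSpace ℝ (Fin d)) :
    (D.form j).inChart c y v * E.coordChange i j (param c y) =
      E.coordChange i j (param c y) * (D.form i).inChart c y v -
        fderiv ℝ (fun y => E.coordChange i j (param c y)) y v := by
  have hd : MDifferentiableAt (𝓡 d) 𝓘(ℝ, F →L[ℂ] F) (E.coordChange i j) (param c y) :=
    ((E.smooth_coordChange i j).contMDiffAt (((E.isOpen_baseSet _).inter
      (E.isOpen_baseSet _)).mem_nhds h)).mdifferentiableAt (by simp)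
  rw [fderiv_comp_param hy hd]
  exact D.gauge i j _ h _

/-- The curvature is a tensor: a change of frame conjugates it. The second derivatives of the change
of frame cancel by symmetry. -/
theorem HermitianConnection.curvature_gauge {i j : ι} {x : M}
    (hx : x ∈ E.baseSet i ∩ E.baseSet j) (v w : TangentSpace (𝓡 d) x) :
    D.curvature j x ![v, w] * E.coordChange i j x =
      E.coordChange i j x * D.curvature i x ![v, w] := by
  obtain ⟨c, y, hy, rfl⟩ := exists_param (d := d) x
  obtain ⟨v, rfl⟩ := dparam_surjective hy v
  obtain ⟨w, rfl⟩ := dparam_surjective hy w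
  rw [D.curvature_apply hy hx.1, D.curvature_apply hy hx.2]
  set h : EuclideanSpace ℝ (Fin d) → F →L[ℂ] F := fun y => E.coordChange i j (param c y) with hh
  set a := (D.form i).inChart c with ha
  set b := (D.form j).inChart c with hb
  have hO := E.isOpen_baseSet i |>.inter (E.isOpen_baseSet j)
  have hnhds := (isOpen_dom_inter c hO).mem_nhds ⟨hy, hx⟩
  have hh2 : ContDiffAt ℝ ∞ h y :=
    (contDiffOn_comp_param hO (E.smooth_coordChange i j) c).contDiffAt hnhds
  have hhd : DifferentiableAt ℝ h y := hh2.differentiableAt (by simp)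
  have hh' : DifferentiableAt ℝ (fderiv ℝ h) y :=
    (hh2.fderiv_right (m := 1)
      (by simpa [one_add_one_eq_two] using two_le_infty)).differentiableAt (by simp)
  have had : DifferentiableAt ℝ a y :=
    ((D.smooth_form i).contDiffAt (E.isOpen_baseSet i) hy hx.1).differentiableAt (by simp)
  have hbd : DifferentiableAt ℝ b y :=
    ((D.smooth_form j).contDiffAt (E.isOpen_baseSet j) hy hx.2).differentiableAt (by simp)
  -- the rule of change of frame for the connection forms, differentiated
  have key : ∀ v w, fderiv ℝ b y w v * h y + b y v * fderiv ℝ h y w =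
      h y * fderiv ℝ a y w v + fderiv ℝ h y w * a y v - fderiv ℝ (fderiv ℝ h) y w v := by
    intro v w
    have e : (fun z => b z v * h z) =ᶠ[𝓝 y] fun z => h z * a z v - fderiv ℝ h z v := by
      filter_upwards [hnhds] with z hz using D.form_inChart_gauge hz.1 hz.2 v
    have h1 := (hasFDerivAt_apply_const hbd.hasFDerivAt v).mul' hhd.hasFDerivAt
    have h2 := (hhd.hasFDerivAt.mul' (hasFDerivAt_apply_const had.hasFDerivAt v)).sub
      (hasFDerivAt_apply_const hh'.hasFDerivAt v)
    have h3 := congrArg (fun T => T w) ((h1.congr_of_eventuallyEq e.symm).unique h2)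
    simp only [add_apply, sub_apply, smul_apply, ContinuousLinearMap.flip_apply, smul_eq_mul,
      MulOpposite.smul_eq_mul_unop, MulOpposite.unop_op] at h3
    rw [add_comm, h3]
  have hsymm : fderiv ℝ (fderiv ℝ h) y w v = fderiv ℝ (fderiv ℝ h) y v w :=
    hh2.isSymmSndFDerivAt (by simpa using two_le_infty) w v
  have g : ∀ v, b y v * h y = h y * a y v - fderiv ℝ h y v := fun v =>
    D.form_inChart_gauge hy hx v
  have k1 := key v w
  have k2 := key w v
  have hhy : E.coordChange i j (param c y) = h y := rfl
  rw [hhy, add_mul, sub_mul, sub_mul, mul_assoc, mul_assoc, g v, g w, mul_sub, mul_sub,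
    ← mul_assoc, ← mul_assoc, g v, g w]
  simp only [mul_add, mul_sub, sub_mul]
  have k3 : fderiv ℝ b y v w * h y = h y * fderiv ℝ a y v w + fderiv ℝ h y v * a y w -
    fderiv ℝ (fderiv ℝ h) y v w - b y w * fderiv ℝ h y v := eq_sub_of_add_eq k2
  have k4 : fderiv ℝ b y w v * h y = h y * fderiv ℝ a y w v + fderiv ℝ h y w * a y v -
    fderiv ℝ (fderiv ℝ h) y w v - b y v * fderiv ℝ h y w := eq_sub_of_add_eq k1
  rw [k3, k4, hsymm]
  noncomm_ring

/-- The curvature of `E ⊗ L^k` is that of `E` plus `k` times that of `L`. There are no cross terms,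
as the connection form of `L` acts by scalars. -/
theorem HermitianConnection.curvature_tensorPow (k : ℕ) {i : ι × κ} {x : M}
    (hx : x ∈ (E.tensorPow L k).baseSet i) (v w : TangentSpace (𝓡 d) x) :
    (D.tensorPow DL k).curvature i x ![v, w] = D.curvature i.1 x ![v, w] +
      ((k : ℂ) * DL.curvature i.2 x ![v, w] 1) • (1 : F →L[ℂ] F) := by
  obtain ⟨c, y, hy, rfl⟩ := exists_param (d := d) x
  obtain ⟨v, rfl⟩ := dparam_surjective hy v
  obtain ⟨w, rfl⟩ := dparam_surjective hy w
  rw [(D.tensorPow DL k).curvature_apply hy hx, D.curvature_apply hy hx.1,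
    DL.curvature_apply hy hx.2]
  have hLd : DifferentiableAt ℝ ((DL.form i.2).inChart c) y :=
    ((DL.smooth_form i.2).contDiffAt (L.isOpen_baseSet i.2) hy hx.2).differentiableAt (by simp)
  have hEd : DifferentiableAt ℝ ((D.form i.1).inChart c) y :=
    ((D.smooth_form i.1).contDiffAt (E.isOpen_baseSet i.1) hy hx.1).differentiableAt (by simp)
  have hd : ∀ v w, fderiv ℝ (((D.tensorPow DL k).form i).inChart c) y v w =
      fderiv ℝ ((D.form i.1).inChart c) y v w +
        ((k : ℂ) * fderiv ℝ ((DL.form i.2).inChart c) y v w 1) • (1 : F →L[ℂ] F) := by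
    intro v w
    set Λ : (ℂ →L[ℂ] ℂ) →L[ℝ] (F →L[ℂ] F) := ((k : ℂ) • (ContinuousLinearMap.apply ℂ ℂ
      (1 : ℂ)).restrictScalars ℝ).smulRight (1 : F →L[ℂ] F) with hΛ
    have e : ((D.tensorPow DL k).form i).inChart c = fun y =>
        (D.form i.1).inChart c y + ContinuousLinearMap.compL ℝ _ _ _ Λ
          ((DL.form i.2).inChart c y) := rfl
    have h1 := hEd.hasFDerivAt.add
      ((ContinuousLinearMap.compL ℝ (EuclideanSpace ℝ (Fin d)) _ _ Λ).hasFDerivAt.comp y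
        hLd.hasFDerivAt)
    have h2 : HasFDerivAt (((D.tensorPow DL k).form i).inChart c) _ y := h1
    rw [h2.fderiv]
    rfl
  have hcomm : ∀ S T : ℂ →L[ℂ] ℂ, S * T - T * S = 0 := by
    intro S T
    have a1 : ∀ (T : ℂ →L[ℂ] ℂ) (z : ℂ), T z = z * T 1 := fun T z => by
      rw [← smul_eq_mul, ← map_smul, smul_eq_mul, mul_one]
    ext
    change S (T 1) - T (S 1) = 0
    rw [a1 S (T 1), a1 T (S 1)]
    ring
  rw [hd, hd, hcomm, D.tensorPow_form_inChart, D.tensorPow_form_inChart, add_zero]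
  have e1 : (fderiv ℝ ((DL.form i.2).inChart c) y v w -
      fderiv ℝ ((DL.form i.2).inChart c) y w v) 1 =
      fderiv ℝ ((DL.form i.2).inChart c) y v w 1 - fderiv ℝ ((DL.form i.2).inChart c) y w v 1 := rfl
  rw [e1]
  generalize fderiv ℝ ((DL.form i.2).inChart c) y v w 1 = s
  generalize fderiv ℝ ((DL.form i.2).inChart c) y w v 1 = t
  generalize (DL.form i.2).inChart c y v 1 = a
  generalize (DL.form i.2).inChart c y w 1 = b
  generalize (D.form i.1).inChart c y v = P
  generalize (D.form i.1).inChart c y w = Q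
  simp only [mul_add, add_mul, mul_smul_comm, smul_mul_assoc, mul_one, one_mul]
  module

end Curvature

/-! ### The Berezin integral under a change of frame -/

section Berezin

variable {T : Type*} [AddCommGroup T] [Module ℝ T] {p q r : ℕ}

theorem alternatingMap_sum_apply {X A : Type*} [AddCommGroup A] [Module ℝ A] (s : Finset X)
    (f : X → T [⋀^Fin p]→ₗ[ℝ] A) (v : Fin p → T) : (∑ x ∈ s, f x) v = ∑ x ∈ s, f x v := by
  classical
  induction s using Finset.induction_on with
  | empty => simp
  | insert x s hx ih =>
    rw [Finset.sum_insert hx, Finset.sum_insert hx, AlternatingMap.add_apply, ih]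

theorem wedge_sum_smul {X Y : Type*} [Fintype X] [Fintype Y] (a : X → ℂ) (b : Y → ℂ)
    (α : X → T [⋀^Fin p]→ₗ[ℝ] ℂ) (β : Y → T [⋀^Fin q]→ₗ[ℝ] ℂ) :
    wedge (∑ x, a x • α x) (∑ y, b y • β y) = ∑ x, ∑ y, (a x * b y) • wedge (α x) (β y) := by
  ext v
  have hpq : ((p.factorial * q.factorial : ℕ) : ℝ) ≠ 0 := by positivity
  apply smul_right_injective ℂ hpq
  simp only [factorial_smul_wedge_apply, alternatingMap_sum_apply, AlternatingMap.smul_apply,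
    smul_eq_mul, Finset.sum_mul_sum, Finset.smul_sum]
  rw [Finset.sum_comm]
  refine Finset.sum_congr rfl fun x _ => ?_
  rw [Finset.sum_comm]
  refine Finset.sum_congr rfl fun y _ => ?_
  rw [← mul_smul_comm, factorial_smul_wedge_apply, Finset.mul_sum]
  refine Finset.sum_congr rfl fun σ _ => ?_
  simp only [zsmul_eq_mul]
  ring

/-- Multilinear expansion of a product of a one-form and two-forms. -/
theorem wedgeList_sum_smul {X : Type*} [Fintype X] (r : ℕ) (a : Fin (r + 1) → X → ℂ)
    (α : X → T [⋀^Fin 1]→ₗ[ℝ] ℂ) (β : Fin r → X → T [⋀^Fin 2]→ₗ[ℝ] ℂ) :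
    wedgeList (∑ x, a 0 x • α x) r (fun l => ∑ x, a l.succ x • β l x) =
      ∑ f : Fin (r + 1) → X, (∏ l, a l (f l)) • wedgeList (α (f 0)) r fun l => β l (f l.succ) := by
  induction r with
  | zero =>
    rw [← (Equiv.funUnique (Fin 1) X).symm.sum_comp]
    simp [wedgeList]
  | succ r ih =>
    have h1 := ih (fun l => a l.castSucc) fun l => β l.castSucc
    simp only [wedgeList]
    simp only [Fin.castSucc_zero, ← Fin.succ_castSucc] at h1 ⊢
    rw [h1, wedge_sum_smul, ← Equiv.sum_comp (Fin.snocEquiv fun _ : Fin (r + 2) => X),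
      Fintype.sum_prod_type, Finset.sum_comm]
    refine Finset.sum_congr rfl fun x _ => Finset.sum_congr rfl fun f _ => ?_
    have e0 : ∀ l : Fin (r + 1), (Fin.snocEquiv fun _ : Fin (r + 2) => X) (x, f) l.castSucc = f l :=
      fun l => Fin.snoc_castSucc (α := fun _ : Fin (r + 2) => X) x f l
    have e1 : (Fin.snocEquiv fun _ : Fin (r + 2) => X) (x, f) (Fin.last (r + 1)) = x :=
      Fin.snoc_last (α := fun _ : Fin (r + 2) => X) x f
    have e2 : (Fin.snocEquiv fun _ : Fin (r + 2) => X) (x, f) 0 = f 0 := e0 0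
    have e3 : ∏ l, a l ((Fin.snocEquiv fun _ : Fin (r + 2) => X) (x, f) l) =
        (∏ l : Fin (r + 1), a l.castSucc (f l)) * a (Fin.last (r + 1)) x := by
      rw [Fin.prod_univ_castSucc]
      simp only [e0, e1]
    rw [e3, e2, Fin.succ_last]
    simp only [e0, e1, Fin.succ_castSucc]

/-- The alternating sum of products of entries of `P` reduces a sum over all maps to a sum over
permutations. -/
theorem sum_sign_smul_sum_prod_smul {n : ℕ} {W : Type*} [AddCommGroup W] [Module ℂ W]
    (P : Matrix (Fin n) (Fin n) ℂ) (w : (Fin n → Fin n) → W) :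
    ∑ π : Equiv.Perm (Fin n), ((Equiv.Perm.sign π : ℤ) : ℂ) •
        ∑ a : Fin n → Fin n, (∏ l, P (π l) (a l)) • w a =
      P.det • ∑ π : Equiv.Perm (Fin n), ((Equiv.Perm.sign π : ℤ) : ℂ) • w π := by
  have h1 : ∀ a : Fin n → Fin n, (∑ π : Equiv.Perm (Fin n), ((Equiv.Perm.sign π : ℤ) : ℂ) *
      ∏ l, P (π l) (a l)) = (P.submatrix id a).det := by
    intro a
    rw [Matrix.det_apply']
    rfl
  simp only [Finset.smul_sum, smul_smul]
  rw [Finset.sum_comm]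
  simp only [← Finset.sum_smul, h1]
  symm
  refine Finset.sum_of_injOn (fun π : Equiv.Perm (Fin n) => (π : Fin n → Fin n))
    DFunLike.coe_injective.injOn (fun _ _ => by simp) (fun a _ ha => ?_) fun π _ => ?_
  · have h2 : ¬ Function.Injective a := fun h => ha
      ⟨Equiv.ofBijective a (Finite.injective_iff_bijective.1 h), by simp, rfl⟩
    obtain ⟨i, j, hij, hne⟩ : ∃ i j, a i = a j ∧ i ≠ j := by
      simpa [Function.Injective] using h2
    rw [Matrix.det_zero_of_column_eq hne (by simp [hij]), zero_smul]
  · rw [Matrix.det_permute', mul_comm]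

/-- Under `α ↦ P α Qᵗ`, `β ↦ P β Qᵗ` the Berezin integral is multiplied by `det P det Q`. -/
theorem berezin_change_of_frame (P Q : Matrix (Fin (r + 1)) (Fin (r + 1)) ℂ)
    (α : Fin (r + 1) → Fin (r + 1) → T [⋀^Fin 1]→ₗ[ℝ] ℂ)
    (β : Fin r → Fin (r + 1) → Fin (r + 1) → T [⋀^Fin 2]→ₗ[ℝ] ℂ) :
    berezin (fun i j => ∑ x : Fin (r + 1) × Fin (r + 1), (P i x.1 * Q j x.2) • α x.1 x.2)
      (fun l i j => ∑ x : Fin (r + 1) × Fin (r + 1), (P i x.1 * Q j x.2) • β l x.1 x.2) =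
    (P.det * Q.det) • berezin α β := by
  set w : (Fin (r + 1) → Fin (r + 1)) → (Fin (r + 1) → Fin (r + 1)) →
      T [⋀^Fin (2 * r + 1)]→ₗ[ℝ] ℂ :=
    fun a b => wedgeList (α (a 0) (b 0)) r fun l => β l (a l.succ) (b l.succ) with hw
  have h1 : ∀ π ρ : Equiv.Perm (Fin (r + 1)),
      wedgeList (∑ x : Fin (r + 1) × Fin (r + 1), (P (π 0) x.1 * Q (ρ 0) x.2) • α x.1 x.2) r
        (fun l => ∑ x : Fin (r + 1) × Fin (r + 1),
          (P (π l.succ) x.1 * Q (ρ l.succ) x.2) • β l x.1 x.2) =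
      ∑ a : Fin (r + 1) → Fin (r + 1), (∏ l, P (π l) (a l)) •
        ∑ b : Fin (r + 1) → Fin (r + 1), (∏ l, Q (ρ l) (b l)) • w a b := by
    intro π ρ
    rw [wedgeList_sum_smul r (fun l (x : Fin (r + 1) × Fin (r + 1)) => P (π l) x.1 * Q (ρ l) x.2)
      (fun x => α x.1 x.2) (fun l x => β l x.1 x.2),
      ← Equiv.sum_comp (Equiv.arrowProdEquivProdArrow (Fin (r + 1)) (fun _ => Fin (r + 1))
        (fun _ => Fin (r + 1))).symm, Fintype.sum_prod_type]
    simp only [Finset.smul_sum, smul_smul, ← Finset.prod_mul_distrib]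
    rfl
  simp only [berezin, h1]
  have h2 : ∀ π : Equiv.Perm (Fin (r + 1)), ∑ ρ : Equiv.Perm (Fin (r + 1)),
      (((Equiv.Perm.sign π : ℤ) : ℂ) * ((Equiv.Perm.sign ρ : ℤ) : ℂ)) •
        ∑ a : Fin (r + 1) → Fin (r + 1), (∏ l, P (π l) (a l)) •
          ∑ b : Fin (r + 1) → Fin (r + 1), (∏ l, Q (ρ l) (b l)) • w a b =
      ((Equiv.Perm.sign π : ℤ) : ℂ) • ∑ a : Fin (r + 1) → Fin (r + 1), (∏ l, P (π l) (a l)) •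
        (Q.det • ∑ ρ : Equiv.Perm (Fin (r + 1)), ((Equiv.Perm.sign ρ : ℤ) : ℂ) • w a ρ) := by
    intro π
    simp only [← sum_sign_smul_sum_prod_smul Q, Finset.smul_sum, smul_smul]
    rw [Finset.sum_comm]
    refine Finset.sum_congr rfl fun a _ => Finset.sum_congr rfl fun ρ _ =>
      Finset.sum_congr rfl fun b _ => ?_
    congr 1
    ring
  simp only [h2]
  rw [sum_sign_smul_sum_prod_smul P]
  simp only [Finset.smul_sum, smul_smul]
  refine Finset.sum_congr rfl fun π _ => Finset.sum_congr rfl fun ρ _ => ?_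
  congr 1
  ring

end Berezin

/-! ### Frame independence of the potential -/

section PotentialFrame

variable {T : Type*} [AddCommGroup T] [Module ℝ T] {r : ℕ}

theorem firstFactor_apply (u : EuclideanSpace ℂ (Fin (r + 1)))
    (Du : T →ₗ[ℝ] EuclideanSpace ℂ (Fin (r + 1))) (i j : Fin (r + 1)) (v : Fin 1 → T) :
    firstFactor u Du i j v = starRingEnd ℂ (u i) / ((‖u‖ : ℂ) ^ 2) * Du (v 0) j := rfl

theorem entry_compAlternatingMap_apply
    (Θ : T [⋀^Fin 2]→ₗ[ℝ] (EuclideanSpace ℂ (Fin (r + 1)) →L[ℂ] EuclideanSpace ℂ (Fin (r + 1))))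
    (i j : Fin (r + 1)) (v : Fin 2 → T) :
    (entry i j).compAlternatingMap Θ v = Θ v (EuclideanSpace.single i 1) j := rfl

theorem secondFactor_apply (u : EuclideanSpace ℂ (Fin (r + 1)))
    (Du : T →ₗ[ℝ] EuclideanSpace ℂ (Fin (r + 1)))
    (Θ : T [⋀^Fin 2]→ₗ[ℝ] (EuclideanSpace ℂ (Fin (r + 1)) →L[ℂ] EuclideanSpace ℂ (Fin (r + 1))))
    (i j : Fin (r + 1)) (v : Fin 2 → T) :
    secondFactor u Du Θ i j v = Θ v (EuclideanSpace.single i 1) j - 1 / ((‖u‖ : ℂ) ^ 2) *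
      (starRingEnd ℂ (Du (v 0) i) * Du (v 1) j - starRingEnd ℂ (Du (v 1) i) * Du (v 0) j) := by
  rw [secondFactor, AlternatingMap.sub_apply, AlternatingMap.smul_apply, wedge_one_one_apply]
  rfl

/-- The Harvey–Lawson potential does not depend on the orthonormal frame. All matrices in it are
conjugated by a unitary matrix `U`, which multiplies the Berezin integral by `|det U|² = 1`. -/
theorem potentialForm_change_of_frame
    (g : EuclideanSpace ℂ (Fin (r + 1)) →L[ℂ] EuclideanSpace ℂ (Fin (r + 1)))
    (hg : ∀ u, ‖g u‖ = ‖u‖) (u : EuclideanSpace ℂ (Fin (r + 1)))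
    {Du Du' : T →ₗ[ℝ] EuclideanSpace ℂ (Fin (r + 1))} (hD : ∀ v, Du' v = g (Du v))
    {Θ Θ' : T [⋀^Fin 2]→ₗ[ℝ] (EuclideanSpace ℂ (Fin (r + 1)) →L[ℂ] EuclideanSpace ℂ (Fin (r + 1)))}
    (hΘ : ∀ v, Θ' v * g = g * Θ v) :
    potentialForm (g u) Du' Θ' = potentialForm u Du Θ := by
  set U : Matrix (Fin (r + 1)) (Fin (r + 1)) ℂ :=
    Matrix.of fun j a => g (EuclideanSpace.single a 1) j with hU
  set P : Matrix (Fin (r + 1)) (Fin (r + 1)) ℂ := U.conjTranspose.transpose with hP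
  have hPU : ∀ i a, P i a = starRingEnd ℂ (U i a) := fun _ _ => rfl
  have hsum : ∀ w : EuclideanSpace ℂ (Fin (r + 1)),
      w = ∑ a, w a • EuclideanSpace.single a (1 : ℂ) := fun w => by
    ext j
    simp [Finset.sum_apply, Pi.single_apply]
  have hgu : ∀ w j, g w j = ∑ a, U j a * w a := fun w j => by
    conv_lhs => rw [hsum w, map_sum]
    simp [Finset.sum_apply, hU, mul_comm]
  have hinner : ∀ a b, inner ℂ (g a) (g b) = inner ℂ a b :=
    (⟨g.toLinearMap, hg⟩ :
      EuclideanSpace ℂ (Fin (r + 1)) →ₗᵢ[ℂ] EuclideanSpace ℂ (Fin (r + 1))).inner_map_map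
  have hunit : U.conjTranspose * U = 1 := by
    ext a b
    have h1 := hinner (EuclideanSpace.single a 1) (EuclideanSpace.single b 1)
    rw [PiLp.inner_apply] at h1
    simp only [RCLike.inner_apply, EuclideanSpace.inner_single_left, map_one, one_mul] at h1
    rw [Matrix.mul_apply, Matrix.one_apply]
    simp only [Matrix.conjTranspose_apply, hU, Matrix.of_apply, RCLike.star_def]
    refine (Finset.sum_congr rfl fun j _ => mul_comm _ _).trans (h1.trans ?_)
    simp
  have hunit' : U * U.conjTranspose = 1 := mul_eq_one_comm.1 hunit
  have hdet : P.det * U.det = 1 := by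
    rw [hP, Matrix.det_transpose, ← Matrix.det_mul, hunit, Matrix.det_one]
  have hginv : ∀ i, g (∑ a, P i a • EuclideanSpace.single a 1) = EuclideanSpace.single i 1 := by
    intro i
    ext j
    have h1 := congrArg (fun X => X j i) hunit'
    simp only [Matrix.mul_apply, Matrix.conjTranspose_apply, Matrix.one_apply,
      RCLike.star_def] at h1
    rw [hgu]
    simp only [PiLp.single_apply, WithLp.ofLp_sum, Finset.sum_apply, PiLp.smul_apply, smul_eq_mul,
      mul_ite, mul_one, mul_zero, Finset.sum_ite_eq, Finset.mem_univ, if_true, hPU]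
    exact h1
  have hΘe : ∀ i j, (entry i j).compAlternatingMap Θ' = ∑ x : Fin (r + 1) × Fin (r + 1),
      (P i x.1 * U j x.2) • (entry x.1 x.2).compAlternatingMap Θ := by
    intro i j
    ext v
    rw [alternatingMap_sum_apply, entry_compAlternatingMap_apply, ← hginv i]
    have h1 := congrArg (fun X => X (∑ a, P i a • EuclideanSpace.single a 1)) (hΘ v)
    change Θ' v (g _) = g (Θ v _) at h1
    rw [h1, hgu, Fintype.sum_prod_type_right]
    refine Finset.sum_congr rfl fun b _ => ?_
    simp only [map_sum, map_smul, WithLp.ofLp_sum, Finset.sum_apply, PiLp.smul_apply, smul_eq_mul,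
      Finset.mul_sum, AlternatingMap.smul_apply, entry_compAlternatingMap_apply]
    refine Finset.sum_congr rfl fun a _ => ?_
    ring
  have hgg : ∀ w z i j, starRingEnd ℂ (g w i) * g z j = ∑ x : Fin (r + 1) × Fin (r + 1),
      P i x.1 * U j x.2 * (starRingEnd ℂ (w x.1) * z x.2) := by
    intro w z i j
    rw [hgu w, hgu z, map_sum, Finset.sum_mul_sum, Fintype.sum_prod_type]
    refine Finset.sum_congr rfl fun a _ => Finset.sum_congr rfl fun b _ => ?_
    rw [map_mul, hPU]
    ring
  have hfirst : ∀ i j, firstFactor (g u) Du' i j = ∑ x : Fin (r + 1) × Fin (r + 1),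
      (P i x.1 * U j x.2) • firstFactor u Du x.1 x.2 := by
    intro i j
    ext v
    rw [alternatingMap_sum_apply, firstFactor_apply, hD, hg, div_mul_eq_mul_div, hgg,
      Finset.sum_div]
    refine Finset.sum_congr rfl fun x _ => ?_
    rw [AlternatingMap.smul_apply, firstFactor_apply, smul_eq_mul]
    ring
  have hsecond : ∀ i j, secondFactor (g u) Du' Θ' i j = ∑ x : Fin (r + 1) × Fin (r + 1),
      (P i x.1 * U j x.2) • secondFactor u Du Θ x.1 x.2 := by
    intro i j
    ext v
    have h1 := congrArg (fun X => X v) (hΘe i j)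
    simp only [alternatingMap_sum_apply, AlternatingMap.smul_apply, smul_eq_mul,
      entry_compAlternatingMap_apply] at h1
    rw [alternatingMap_sum_apply, secondFactor_apply, hD, hD, hg, h1]
    simp only [AlternatingMap.smul_apply, secondFactor_apply, smul_eq_mul, mul_sub,
      Finset.sum_sub_distrib]
    simp only [hgg, Finset.mul_sum]
    congr 2 <;> exact Finset.sum_congr rfl fun x _ => by ring
  rw [potentialForm, potentialForm]
  congr 1
  refine Finset.sum_congr rfl fun k _ => ?_
  rw [← one_smul ℂ (berezin (firstFactor u Du) _), ← hdet, ← berezin_change_of_frame]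
  congr 1
  · ext i j : 2
    exact hfirst i j
  · ext l i j : 3
    split_ifs
    · exact hsecond i j
    · exact hΘe i j

end PotentialFrame

/-! ### Pointwise bound of the potential -/

section PotentialBound

variable {T : Type*} [AddCommGroup T] [Module ℝ T] {p q r : ℕ} {N : T → ℝ}

/-- A bound for wedge products of forms that are bounded with respect to a length function `N`; the
factorial counts the permutations. -/
theorem norm_wedge_apply_le {α : T [⋀^Fin p]→ₗ[ℝ] ℂ} {β : T [⋀^Fin q]→ₗ[ℝ] ℂ} {a b : ℝ}
    (ha : 0 ≤ a) (hN : ∀ v, 0 ≤ N v) (hα : ∀ v, ‖α v‖ ≤ a * ∏ i, N (v i))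
    (hβ : ∀ v, ‖β v‖ ≤ b * ∏ i, N (v i)) (v : Fin (p + q) → T) :
    ‖wedge α β v‖ ≤ (p + q).factorial * (a * b) * ∏ i, N (v i) := by
  have h1 : ‖((p.factorial * q.factorial : ℕ) : ℝ) • wedge α β v‖ ≤
      (p + q).factorial * (a * b) * ∏ i, N (v i) := by
    rw [factorial_smul_wedge_apply]
    refine (norm_sum_le _ _).trans ?_
    have h2 : ∀ σ : Equiv.Perm (Fin p ⊕ Fin q), ‖(Equiv.Perm.sign σ : ℤ) •
        (α (fun i => v (finSumFinEquiv (σ (Sum.inl i)))) *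
          β (fun j => v (finSumFinEquiv (σ (Sum.inr j)))))‖ ≤ a * b * ∏ i, N (v i) := by
      intro σ
      have h3 : ∏ i, N (v i) = (∏ i, N (v (finSumFinEquiv (σ (Sum.inl i))))) *
          ∏ j, N (v (finSumFinEquiv (σ (Sum.inr j)))) := by
        rw [← Fintype.prod_sum_type fun x => N (v (finSumFinEquiv (σ x))),
          Equiv.prod_comp σ fun x => N (v (finSumFinEquiv x)),
          Equiv.prod_comp finSumFinEquiv fun x => N (v x)]
      have h4 : ‖((Equiv.Perm.sign σ : ℤ) : ℂ)‖ = 1 := by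
        rcases Int.units_eq_one_or (Equiv.Perm.sign σ) with h | h <;> simp [h]
      rw [zsmul_eq_mul, norm_mul, norm_mul, h4, one_mul, h3]
      calc _ ≤ (a * ∏ i, N (v (finSumFinEquiv (σ (Sum.inl i))))) *
            (b * ∏ j, N (v (finSumFinEquiv (σ (Sum.inr j))))) :=
            mul_le_mul (hα _) (hβ _) (norm_nonneg _)
              (mul_nonneg ha (Finset.prod_nonneg fun _ _ => hN _))
        _ = _ := by ring
    refine (Finset.sum_le_sum fun σ _ => h2 σ).trans_eq ?_
    rw [Finset.sum_const, Finset.card_univ, Fintype.card_perm, Fintype.card_sum, Fintype.card_fin,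
      Fintype.card_fin, nsmul_eq_mul]
    ring
  rw [norm_smul] at h1
  refine le_trans ?_ h1
  have h2 : (1 : ℝ) ≤ ‖((p.factorial * q.factorial : ℕ) : ℝ)‖ := by
    rw [Real.norm_natCast]
    exact_mod_cast Nat.succ_le_of_lt (by positivity)
  nlinarith [norm_nonneg (wedge α β v)]

theorem norm_wedgeList_apply_le (hN : ∀ v, 0 ≤ N v) {a b : ℝ} (ha : 0 ≤ a) (hb : 0 ≤ b)
    {α : T [⋀^Fin 1]→ₗ[ℝ] ℂ} (hα : ∀ v, ‖α v‖ ≤ a * ∏ i, N (v i)) (r : ℕ)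
    {β : Fin r → T [⋀^Fin 2]→ₗ[ℝ] ℂ} (hβ : ∀ l v, ‖β l v‖ ≤ b * ∏ i, N (v i))
    (v : Fin (2 * r + 1) → T) :
    ‖wedgeList α r β v‖ ≤
      (∏ j ∈ Finset.range r, ((2 * j + 3).factorial : ℝ)) * (a * b ^ r) * ∏ i, N (v i) := by
  induction r with
  | zero => simpa [wedgeList] using hα v
  | succ r ih =>
    have h1 : ‖wedgeList α (r + 1) β v‖ ≤ ((2 * r + 3).factorial : ℝ) *
        ((∏ j ∈ Finset.range r, ((2 * j + 3).factorial : ℝ)) * (a * b ^ r) * b) *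
          ∏ i : Fin (2 * (r + 1) + 1), N (v i) :=
      norm_wedge_apply_le (p := 2 * r + 1) (q := 2) (by positivity) hN
        (ih (β := fun j => β j.castSucc) fun l v => hβ _ v) (hβ (Fin.last r)) v
    refine h1.trans_eq ?_
    rw [Finset.prod_range_succ, pow_succ]
    ring

theorem norm_berezin_apply_le (hN : ∀ v, 0 ≤ N v) {a b : ℝ} (ha : 0 ≤ a) (hb : 0 ≤ b)
    {α : Fin (r + 1) → Fin (r + 1) → T [⋀^Fin 1]→ₗ[ℝ] ℂ}
    {β : Fin r → Fin (r + 1) → Fin (r + 1) → T [⋀^Fin 2]→ₗ[ℝ] ℂ}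
    (hα : ∀ i j v, ‖α i j v‖ ≤ a * ∏ i, N (v i))
    (hβ : ∀ l i j v, ‖β l i j v‖ ≤ b * ∏ i, N (v i)) (v : Fin (2 * r + 1) → T) :
    ‖berezin α β v‖ ≤ ((r + 1).factorial ^ 2 *
      ∏ j ∈ Finset.range r, ((2 * j + 3).factorial : ℝ)) * (a * b ^ r) * ∏ i, N (v i) := by
  have h4 : ∀ σ : Equiv.Perm (Fin (r + 1)), ‖((Equiv.Perm.sign σ : ℤ) : ℂ)‖ = 1 := fun σ => by
    rcases Int.units_eq_one_or (Equiv.Perm.sign σ) with h | h <;> simp [h]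
  simp only [berezin, alternatingMap_sum_apply, AlternatingMap.smul_apply]
  calc _ ≤ ∑ π : Equiv.Perm (Fin (r + 1)), ∑ ρ : Equiv.Perm (Fin (r + 1)),
        (∏ j ∈ Finset.range r, ((2 * j + 3).factorial : ℝ)) * (a * b ^ r) * ∏ i, N (v i) := by
        refine norm_sum_le_of_le _ fun π _ => norm_sum_le_of_le _ fun ρ _ => ?_
        rw [norm_smul, norm_mul, h4, h4, one_mul, one_mul]
        exact norm_wedgeList_apply_le hN ha hb (hα _ _) r (fun l => hβ l _ _) v
    _ = _ := by
        simp only [Finset.sum_const, Finset.card_univ, Fintype.card_perm, Fintype.card_fin,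
          nsmul_eq_mul]
        ring

/-- The potential has a singularity of order `2n - 1`, `n = r + 1`, along the zero set. For `u = 0`
both sides vanish by the convention `0⁻¹ = 0`. -/
theorem exists_norm_potentialForm_apply_le (r : ℕ) {B : ℝ} (hB : 0 ≤ B) :
    ∃ C : ℝ, 0 ≤ C ∧ ∀ (T : Type*) [AddCommGroup T] [Module ℝ T] (N : T → ℝ) (τ : ℝ)
      (u : EuclideanSpace ℂ (Fin (r + 1))) (Du : T →ₗ[ℝ] EuclideanSpace ℂ (Fin (r + 1)))
      (Θ : T [⋀^Fin 2]→ₗ[ℝ] (EuclideanSpace ℂ (Fin (r + 1)) →L[ℂ] EuclideanSpace ℂ (Fin (r + 1)))),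
      0 ≤ τ → (∀ v, 0 ≤ N v) → ‖u‖ ≤ B → (∀ v, ‖Du v‖ ≤ B * τ * N v) →
      (∀ v, ‖Θ v‖ ≤ B * τ ^ 2 * ∏ i, N (v i)) → ∀ v : Fin (2 * r + 1) → T,
      ‖potentialForm u Du Θ v‖ ≤
        C * (τ ^ (2 * r + 1) * (‖u‖ ^ (2 * r + 1))⁻¹) * ∏ i, N (v i) := by
  set c : ℝ := (r + 1).factorial ^ 2 * ∏ j ∈ Finset.range r, ((2 * j + 3).factorial : ℝ) with hc
  set c' : ℝ := ‖(1 / ((r + 1).factorial : ℂ)) * (Complex.I / (2 * (Real.pi : ℂ))) ^ (r + 1)‖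
  have hc0 : 0 ≤ c := by positivity
  refine ⟨c' * ((r + 1 : ℕ) * (c * (B * (B ^ 3 + 2 * B ^ 2) ^ r))), by positivity,
    fun T _ _ N τ u Du Θ hτ hN hu hD hΘ v => ?_⟩
  set t := ‖u‖ with ht
  have ht0 : 0 ≤ t := norm_nonneg u
  have hcomp : ∀ (w : EuclideanSpace ℂ (Fin (r + 1))) j, ‖w j‖ ≤ ‖w‖ := fun w j =>
    PiLp.norm_apply_le w j
  have h1 : ∀ i j v, ‖firstFactor u Du i j v‖ ≤ t⁻¹ * (B * τ) * ∏ i, N (v i) := by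
    intro i j v
    rw [firstFactor_apply, norm_mul, norm_div, RCLike.norm_conj, norm_pow, Complex.norm_real,
      norm_norm, ← ht, Fin.prod_univ_one, mul_assoc]
    refine mul_le_mul ?_ ((hcomp _ _).trans (hD _)) (norm_nonneg _) (by positivity)
    rcases ht0.eq_or_lt with h | h
    · simp [← h]
    · rw [div_le_iff₀ (by positivity), pow_two, inv_mul_cancel_left₀ h.ne']
      exact hcomp u i
  have hsingle : ∀ i : Fin (r + 1), ‖(EuclideanSpace.single i (1 : ℂ))‖ = 1 := by simp
  have h2 : ∀ i j v, ‖(entry i j).compAlternatingMap Θ v‖ ≤ B * τ ^ 2 * ∏ i, N (v i) := by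
    intro i j v
    rw [entry_compAlternatingMap_apply]
    refine (hcomp _ _).trans ?_
    have h3 := (Θ v).le_opNorm (EuclideanSpace.single i 1)
    rw [hsingle, mul_one] at h3
    exact h3.trans (hΘ v)
  -- the common bound for the two kinds of two-forms
  set b : ℝ := B * τ ^ 2 + 2 * (B * τ) ^ 2 * (t ^ 2)⁻¹ with hb
  have hb0 : 0 ≤ b := by positivity
  have h3 : ∀ i j v, ‖secondFactor u Du Θ i j v‖ ≤ b * ∏ i, N (v i) := by
    intro i j v
    have h4 := h2 i j v
    rw [entry_compAlternatingMap_apply] at h4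
    rw [secondFactor_apply]
    refine (norm_sub_le _ _).trans ?_
    rw [norm_mul, norm_div, norm_one, norm_pow, Complex.norm_real, norm_norm, ← ht, one_div]
    have h5 : ∀ x y : T, ‖starRingEnd ℂ (Du x i) * Du y j‖ ≤ (B * τ) ^ 2 * (N x * N y) := by
      intro x y
      rw [norm_mul, RCLike.norm_conj]
      calc _ ≤ (B * τ * N x) * (B * τ * N y) :=
            mul_le_mul ((hcomp _ _).trans (hD _)) ((hcomp _ _).trans (hD _)) (norm_nonneg _)
              (mul_nonneg (by positivity) (hN _))
        _ = _ := by ring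
    have h6 : ‖starRingEnd ℂ (Du (v 0) i) * Du (v 1) j - starRingEnd ℂ (Du (v 1) i) * Du (v 0) j‖ ≤
        2 * (B * τ) ^ 2 * ∏ i, N (v i) := by
      rw [Fin.prod_univ_two]
      refine (norm_sub_le _ _).trans ((add_le_add (h5 _ _) (h5 _ _)).trans_eq ?_)
      ring
    calc _ ≤ B * τ ^ 2 * ∏ i, N (v i) + (t ^ 2)⁻¹ * (2 * (B * τ) ^ 2 * ∏ i, N (v i)) := by
          gcongr
      _ = _ := by rw [hb]; ring
  have h2' : ∀ i j v, ‖(entry i j).compAlternatingMap Θ v‖ ≤ b * ∏ i, N (v i) := fun i j v =>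
    (h2 i j v).trans (mul_le_mul_of_nonneg_right
      (by rw [hb]; exact le_add_of_nonneg_right (by positivity))
      (Finset.prod_nonneg fun _ _ => hN _))
  have h4 : ∀ k, ‖berezin (firstFactor u Du) (fun l : Fin r =>
      if (l : ℕ) < k then secondFactor u Du Θ else fun i j => (entry i j).compAlternatingMap Θ) v‖ ≤
      c * (t⁻¹ * (B * τ) * b ^ r) * ∏ i, N (v i) := by
    intro k
    refine norm_berezin_apply_le hN (by positivity) hb0 h1 (fun l i j v => ?_) v
    split_ifs
    · exact h3 i j v
    · exact h2' i j v
  have h5 : t⁻¹ * (B * τ) * b ^ r ≤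
      (B * (B ^ 3 + 2 * B ^ 2) ^ r) * (τ ^ (2 * r + 1) * (t ^ (2 * r + 1))⁻¹) := by
    rcases ht0.eq_or_lt with h | h
    · simp [← h]
    · have h6 : b ≤ (B ^ 3 + 2 * B ^ 2) * (τ ^ 2 * (t ^ 2)⁻¹) := by
        have h7 : B * τ ^ 2 ≤ B ^ 3 * (τ ^ 2 * (t ^ 2)⁻¹) := by
          rw [← div_eq_mul_inv, ← mul_div_assoc, le_div_iff₀ (by positivity)]
          calc B * τ ^ 2 * t ^ 2 ≤ B * τ ^ 2 * B ^ 2 := by gcongr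
            _ = _ := by ring
        rw [hb]
        linarith
      calc t⁻¹ * (B * τ) * b ^ r
          ≤ t⁻¹ * (B * τ) * ((B ^ 3 + 2 * B ^ 2) * (τ ^ 2 * (t ^ 2)⁻¹)) ^ r := by gcongr
        _ = _ := by
          rw [mul_pow, mul_pow, ← pow_mul, inv_pow, ← pow_mul, pow_succ τ, pow_succ t, mul_inv]
          ring
  rw [potentialForm, AlternatingMap.smul_apply, alternatingMap_sum_apply, norm_smul]
  have hP : 0 ≤ ∏ i, N (v i) := Finset.prod_nonneg fun _ _ => hN _
  calc _ ≤ c' * ∑ k ∈ Finset.range (r + 1), c * (t⁻¹ * (B * τ) * b ^ r) * ∏ i, N (v i) := by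
        gcongr
        exact norm_sum_le_of_le _ fun k _ => h4 k
    _ = c' * ((r + 1 : ℕ) * (c * (t⁻¹ * (B * τ) * b ^ r) * ∏ i, N (v i))) := by
        rw [Finset.sum_const, Finset.card_range, nsmul_eq_mul]
    _ ≤ c' * ((r + 1 : ℕ) * (c * ((B * (B ^ 3 + 2 * B ^ 2) ^ r) *
          (τ ^ (2 * r + 1) * (t ^ (2 * r + 1))⁻¹)) * ∏ i, N (v i))) := by gcongr
    _ = _ := by ring

end PotentialBound

/-! ### Measurability of the potential -/

section PotentialMeasurable

variable {Y κ : Type*} [MeasurableSpace Y] {μ : Measure Y} {T : Y → Type*}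
  [∀ y, AddCommGroup (T y)] [∀ y, Module ℝ (T y)] {e : ∀ y, κ → T y} {p q r : ℕ}

/-- A field of forms on varying spaces `T y` is measurable if its coefficients in a frame `e` are.
-/
theorem aemeasurable_wedge {α : ∀ y, T y [⋀^Fin p]→ₗ[ℝ] ℂ} {β : ∀ y, T y [⋀^Fin q]→ₗ[ℝ] ℂ}
    (hα : ∀ I : Fin p → κ, AEMeasurable (fun y => α y fun j => e y (I j)) μ)
    (hβ : ∀ I : Fin q → κ, AEMeasurable (fun y => β y fun j => e y (I j)) μ)
    (I : Fin (p + q) → κ) :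
    AEMeasurable (fun y => wedge (α y) (β y) fun j => e y (I j)) μ := by
  have hpq : ((p.factorial * q.factorial : ℕ) : ℝ) ≠ 0 := by positivity
  have h1 : (fun y => wedge (α y) (β y) fun j => e y (I j)) = fun y =>
      ((p.factorial * q.factorial : ℕ) : ℝ)⁻¹ • ∑ σ : Equiv.Perm (Fin p ⊕ Fin q),
        (Equiv.Perm.sign σ : ℤ) • (α y (fun i => e y (I (finSumFinEquiv (σ (Sum.inl i))))) *
          β y (fun j => e y (I (finSumFinEquiv (σ (Sum.inr j)))))) := by
    ext1 y
    rw [← factorial_smul_wedge_apply (α y) (β y) fun j => e y (I j), inv_smul_smul₀ hpq]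
  rw [h1]
  simp only [Complex.real_smul]
  refine AEMeasurable.const_mul ?_ _
  refine Finset.aemeasurable_fun_sum _ fun σ _ => ?_
  simp only [zsmul_eq_mul]
  exact ((hα _).mul (hβ _)).const_mul _

theorem aemeasurable_wedgeList {α : ∀ y, T y [⋀^Fin 1]→ₗ[ℝ] ℂ}
    (hα : ∀ I : Fin 1 → κ, AEMeasurable (fun y => α y fun j => e y (I j)) μ) (r : ℕ)
    {β : ∀ y, Fin r → T y [⋀^Fin 2]→ₗ[ℝ] ℂ}
    (hβ : ∀ l, ∀ I : Fin 2 → κ, AEMeasurable (fun y => β y l fun j => e y (I j)) μ)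
    (I : Fin (2 * r + 1) → κ) :
    AEMeasurable (fun y => wedgeList (α y) r (β y) fun j => e y (I j)) μ := by
  induction r with
  | zero => exact hα I
  | succ r ih =>
    exact aemeasurable_wedge (p := 2 * r + 1) (q := 2)
      (ih (β := fun y j => β y j.castSucc) fun l => hβ _) (hβ (Fin.last r)) I

theorem aemeasurable_potentialForm {u : Y → EuclideanSpace ℂ (Fin (r + 1))}
    {Du : ∀ y, T y →ₗ[ℝ] EuclideanSpace ℂ (Fin (r + 1))}
    {Θ : ∀ y, T y [⋀^Fin 2]→ₗ[ℝ]
      (EuclideanSpace ℂ (Fin (r + 1)) →L[ℂ] EuclideanSpace ℂ (Fin (r + 1)))}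
    (hu : ∀ i, AEMeasurable (fun y => u y i) μ) (hn : AEMeasurable (fun y => ‖u y‖) μ)
    (hD : ∀ a i, AEMeasurable (fun y => Du y (e y a) i) μ)
    (hΘ : ∀ (I : Fin 2 → κ) i j,
      AEMeasurable (fun y => Θ y (fun l => e y (I l)) (EuclideanSpace.single i 1) j) μ)
    (I : Fin (2 * r + 1) → κ) :
    AEMeasurable (fun y => potentialForm (u y) (Du y) (Θ y) fun j => e y (I j)) μ := by
  have hn2 : AEMeasurable (fun y => (‖u y‖ : ℂ) ^ 2) μ :=
    (Complex.measurable_ofReal.comp_aemeasurable hn).pow_const 2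
  have hconj : ∀ {f : Y → ℂ}, AEMeasurable f μ → AEMeasurable (fun y => starRingEnd ℂ (f y)) μ :=
    fun hf => Complex.continuous_conj.measurable.comp_aemeasurable hf
  have h1 : ∀ i j (I : Fin 1 → κ),
      AEMeasurable (fun y => firstFactor (u y) (Du y) i j fun l => e y (I l)) μ := by
    intro i j I
    simp only [firstFactor_apply]
    exact ((hconj (hu i)).div hn2).mul (hD _ _)
  have h2 : ∀ i j (I : Fin 2 → κ),
      AEMeasurable (fun y => (entry i j).compAlternatingMap (Θ y) fun l => e y (I l)) μ :=
    fun i j I => hΘ I i j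
  have h3 : ∀ i j (I : Fin 2 → κ),
      AEMeasurable (fun y => secondFactor (u y) (Du y) (Θ y) i j fun l => e y (I l)) μ := by
    intro i j I
    simp only [secondFactor_apply]
    exact (hΘ I i j).sub ((aemeasurable_const.div hn2).mul
      (((hconj (hD _ _)).mul (hD _ _)).sub ((hconj (hD _ _)).mul (hD _ _))))
  simp only [potentialForm, berezin, alternatingMap_sum_apply, AlternatingMap.smul_apply,
    smul_eq_mul]
  refine AEMeasurable.const_mul (Finset.aemeasurable_fun_sum _ fun k _ =>
    Finset.aemeasurable_fun_sum _ fun π _ => Finset.aemeasurable_fun_sum _ fun ρ _ =>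
      AEMeasurable.const_mul (aemeasurable_wedgeList (h1 _ _) r (fun l I => ?_) I) _) _
  split_ifs
  · exact h3 _ _ I
  · exact h2 _ _ I

end PotentialMeasurable

/-! ### Local bounds for the fixed geometry -/

section LocalGeometry

variable {m : ℕ} {M : Type*} [TopologicalSpace M]
  [ChartedSpace (EuclideanSpace ℝ (Fin (2 * m))) M] (K : AlmostKahler m M)

/-- The coordinate expression of the almost complex structure. -/
noncomputable def AlmostKahler.chartJ (c : M) (y : EuclideanSpace ℝ (Fin (2 * m))) :
    EuclideanSpace ℝ (Fin (2 * m)) →L[ℝ] EuclideanSpace ℝ (Fin (2 * m)) :=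
  mvfderiv (𝓡 (2 * m)) (extChartAt (𝓡 (2 * m)) c) (param c y) ∘L
    (K.J (param c y) ∘L dparam c y)

theorem alternatingMap_map_snd_add {V : Type*} [AddCommGroup V] [Module ℝ V]
    [TopologicalSpace V] (β : V [⋀^Fin 2]→L[ℝ] ℝ) (v w w' : V) :
    β ![v, w + w'] = β ![v, w] + β ![v, w'] := by
  have := β.map_update_add ![v, 0] (1 : Fin 2) w w'
  have e1 : ∀ w, Function.update ![v, (0 : V)] (1 : Fin 2) w = ![v, w] := fun w => by
    ext i : 1
    fin_cases i <;> rfl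
  rwa [e1, e1, e1] at this

theorem alternatingMap_map_snd_smul {V : Type*} [AddCommGroup V] [Module ℝ V]
    [TopologicalSpace V] (β : V [⋀^Fin 2]→L[ℝ] ℝ) (v w : V) (t : ℝ) :
    β ![v, t • w] = t • β ![v, w] := by
  have := β.map_update_smul ![v, 0] (1 : Fin 2) t w
  have e1 : ∀ w, Function.update ![v, (0 : V)] (1 : Fin 2) w = ![v, w] := fun w => by
    ext i : 1
    fin_cases i <;> rfl
  rwa [e1, e1] at this

theorem alternatingMap_map_fst_add {V : Type*} [AddCommGroup V] [Module ℝ V]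
    [TopologicalSpace V] (β : V [⋀^Fin 2]→L[ℝ] ℝ) (v v' w : V) :
    β ![v + v', w] = β ![v, w] + β ![v', w] := by
  have := β.map_update_add ![0, w] (0 : Fin 2) v v'
  have e1 : ∀ v, Function.update ![(0 : V), w] (0 : Fin 2) v = ![v, w] := fun v => by
    ext i : 1
    fin_cases i <;> rfl
  rwa [e1, e1, e1] at this

theorem alternatingMap_map_fst_smul {V : Type*} [AddCommGroup V] [Module ℝ V]
    [TopologicalSpace V] (β : V [⋀^Fin 2]→L[ℝ] ℝ) (v w : V) (t : ℝ) :
    β ![t • v, w] = t • β ![v, w] := by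
  have := β.map_update_smul ![0, w] (0 : Fin 2) t v
  have e1 : ∀ v, Function.update ![(0 : V), w] (0 : Fin 2) v = ![v, w] := fun v => by
    ext i : 1
    fin_cases i <;> rfl
  rwa [e1, e1] at this

theorem eventually_norm_le_of_continuousAt {X G : Type*} [TopologicalSpace X]
    [SeminormedAddCommGroup G] {f : X → G} {x : X} (hf : ContinuousAt f x) :
    ∃ C : ℝ, ∀ᶠ y in 𝓝 x, ‖f y‖ ≤ C :=
  ⟨‖f x‖ + 1, (hf.norm.eventually (gt_mem_nhds (lt_add_one _))).mono fun _ h => le_of_lt h⟩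

variable {c : M} {y₀ : EuclideanSpace ℝ (Fin (2 * m))}

theorem AlmostKahler.contDiffAt_Ω (hy : y₀ ∈ dom c) : ContDiffAt ℝ ∞ (K.Ω.inChart c) y₀ :=
  K.smooth_Ω.contDiffAt isOpen_univ hy (mem_univ _)

theorem AlmostKahler.contDiffAt_chartJ (hy : y₀ ∈ dom c) : ContDiffAt ℝ ∞ (K.chartJ c) y₀ :=
  (K.smooth_J c).contDiffAt ((isOpen_dom c).mem_nhds hy)

theorem AlmostKahler.abs_Ω_le (c : M) (y v w : EuclideanSpace ℝ (Fin (2 * m))) :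
    |K.Ω (param c y) ![dparam c y v, dparam c y w]| ≤ ‖K.Ω.inChart c y‖ * ‖v‖ * ‖w‖ := by
  have h1 := (K.Ω.inChart c y).le_opNorm ![v, w]
  have h2 : K.Ω.inChart c y ![v, w] = K.Ω (param c y) ![dparam c y v, dparam c y w] := by
    change K.Ω (param c y) (fun i => dparam c y (![v, w] i)) = _
    congr 1
    ext i : 1
    fin_cases i <;> rfl
  rw [h2, Fin.prod_univ_two, ← mul_assoc] at h1
  exact h1

theorem AlmostKahler.g_pos {x : M} {v : TangentSpace (𝓡 (2 * m)) x} (hv : v ≠ 0) : 0 < K.g x v v :=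
  K.pos x v hv

variable [IsManifold (𝓡 (2 * m)) ∞ M]

theorem AlmostKahler.g_dparam {y : EuclideanSpace ℝ (Fin (2 * m))} (hy : y ∈ dom c)
    (v w : EuclideanSpace ℝ (Fin (2 * m))) :
    K.g (param c y) (dparam c y v) (dparam c y w) = K.Ω.inChart c y ![v, K.chartJ c y w] := by
  have h1 : K.J (param c y) (dparam c y w) = dparam c y (K.chartJ c y w) :=
    (dparam_mvfderiv_extChartAt hy _).symm
  rw [AlmostKahler.g, h1]
  change _ = K.Ω (param c y) (fun i => dparam c y (![v, K.chartJ c y w] i))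
  congr 1
  ext i : 1
  fin_cases i <;> rfl

/-- In a chart the metric is locally comparable to the Euclidean metric. Positivity of `Ω(v, Jv)` on
the unit sphere at `y₀` persists nearby by continuity. -/
theorem AlmostKahler.exists_metric_comparison (hy : y₀ ∈ dom c) :
    ∃ B : ℝ, ∀ᶠ y in 𝓝 y₀, ∀ v : EuclideanSpace ℝ (Fin (2 * m)),
      √(K.g (param c y) (dparam c y v) (dparam c y v)) ≤ B * ‖v‖ ∧
      ‖v‖ ≤ B * √(K.g (param c y) (dparam c y v) (dparam c y v)) := by
  set Ω := K.Ω.inChart c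
  set J := K.chartJ c
  have hΩ : ContinuousAt Ω y₀ := (K.contDiffAt_Ω hy).continuousAt
  have hJ : ContinuousAt J y₀ := (K.contDiffAt_chartJ hy).continuousAt
  have hle : ∀ (β : EuclideanSpace ℝ (Fin (2 * m)) [⋀^Fin 2]→L[ℝ] ℝ) v w,
      |β ![v, w]| ≤ ‖β‖ * (‖v‖ * ‖w‖) := fun β v w => by
    have := β.le_opNorm ![v, w]
    rwa [Fin.prod_univ_two] at this
  -- positivity on the compact unit sphere
  obtain ⟨δ, hδ, hδv⟩ : ∃ δ > 0, ∀ v, δ * ‖v‖ ^ 2 ≤ Ω y₀ ![v, J y₀ v] := by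
    have hcont : Continuous fun v => Ω y₀ ![v, J y₀ v] := by
      refine (Ω y₀).cont.comp (continuous_pi fun i => ?_)
      fin_cases i
      · exact continuous_id
      · exact (J y₀).continuous
    rcases (Metric.sphere (0 : EuclideanSpace ℝ (Fin (2 * m))) 1).eq_empty_or_nonempty with he | hne
    · refine ⟨1, one_pos, fun v => ?_⟩
      have hv : v = 0 := by
        by_contra hv
        have : ‖v‖⁻¹ • v ∈ Metric.sphere (0 : EuclideanSpace ℝ (Fin (2 * m))) 1 := by
          simp [norm_smul, hv]
        rw [he] at this
        exact this
      subst hv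
      rw [(Ω y₀).map_coord_zero (0 : Fin 2) rfl]
      simp
    · obtain ⟨v₀, hv₀, hmin⟩ := (isCompact_sphere (0 : EuclideanSpace ℝ (Fin (2 * m)))
        1).exists_isMinOn hne hcont.continuousOn
      have hv0 : v₀ ≠ 0 := by
        rintro rfl
        simp at hv₀
      refine ⟨Ω y₀ ![v₀, J y₀ v₀], ?_, fun v => ?_⟩
      · have := K.g_pos (x := param c y₀) (v := dparam c y₀ v₀) fun h => hv0 (dparam_injective hy h)
        rwa [K.g_dparam hy] at this
      · by_cases hv : v = 0
        · subst hv
          rw [(Ω y₀).map_coord_zero (i := (0 : Fin 2)) (m := ![0, J y₀ 0]) rfl]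
          simp
        · have h1 : ‖v‖⁻¹ • v ∈ Metric.sphere (0 : EuclideanSpace ℝ (Fin (2 * m))) 1 := by
            simp [norm_smul, hv]
          have h2 : Ω y₀ ![v₀, J y₀ v₀] ≤ Ω y₀ ![‖v‖⁻¹ • v, J y₀ (‖v‖⁻¹ • v)] := hmin h1
          have h3 : Ω y₀ ![‖v‖⁻¹ • v, J y₀ (‖v‖⁻¹ • v)] = (‖v‖⁻¹) ^ 2 * Ω y₀ ![v, J y₀ v] := by
            have := (Ω y₀).toMultilinearMap.map_smul_univ (fun _ => ‖v‖⁻¹) ![v, J y₀ v]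
            rw [Fin.prod_univ_two, ← pow_two] at this
            refine Eq.trans ?_ this
            change Ω y₀ _ = Ω y₀ _
            congr 1
            ext i : 1
            fin_cases i
            · rfl
            · exact map_smul _ _ _
          have hv' : 0 < ‖v‖ := norm_pos_iff.2 hv
          rw [h3] at h2
          calc _ ≤ (‖v‖⁻¹) ^ 2 * Ω y₀ ![v, J y₀ v] * ‖v‖ ^ 2 := by gcongr
            _ = _ := by field_simp
  have hlim : Tendsto (fun y => ‖Ω y - Ω y₀‖ * ‖J y‖ + ‖Ω y₀‖ * ‖J y - J y₀‖) (𝓝 y₀) (𝓝 0) := by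
    have h1 : Tendsto (fun y => ‖Ω y - Ω y₀‖) (𝓝 y₀) (𝓝 0) := by
      simpa using (hΩ.sub (continuousAt_const (y := Ω y₀))).norm.tendsto
    have h2 : Tendsto (fun y => ‖J y - J y₀‖) (𝓝 y₀) (𝓝 0) := by
      simpa using (hJ.sub (continuousAt_const (y := J y₀))).norm.tendsto
    simpa using (h1.mul hJ.norm.tendsto).add (h2.const_mul ‖Ω y₀‖)
  obtain ⟨CΩ, hCΩ⟩ := eventually_norm_le_of_continuousAt hΩ
  obtain ⟨CJ, hCJ⟩ := eventually_norm_le_of_continuousAt hJ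
  refine ⟨max √(CΩ * CJ) √(2 / δ), ?_⟩
  filter_upwards [hCΩ, hCJ, hlim.eventually (gt_mem_nhds (half_pos hδ)),
    (isOpen_dom c).mem_nhds hy] with y h1 h2 h3 h4 v
  rw [K.g_dparam h4]
  change √(Ω y ![v, J y v]) ≤ _ ∧ _ ≤ _ * √(Ω y ![v, J y v])
  have h5 : Ω y ![v, J y v] ≤ CΩ * CJ * ‖v‖ ^ 2 := by
    calc Ω y ![v, J y v] ≤ ‖Ω y‖ * (‖v‖ * ‖J y v‖) := (le_abs_self _).trans (hle _ _ _)
      _ ≤ CΩ * (‖v‖ * (CJ * ‖v‖)) := by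
        have := (J y).le_opNorm v
        have h0 : 0 ≤ CΩ := (norm_nonneg _).trans h1
        gcongr
        exact this.trans (by gcongr)
      _ = _ := by ring
  have h6 : |Ω y ![v, J y v] - Ω y₀ ![v, J y₀ v]| ≤ δ / 2 * ‖v‖ ^ 2 := by
    have e : Ω y ![v, J y v] - Ω y₀ ![v, J y₀ v] =
        (Ω y - Ω y₀) ![v, J y v] + Ω y₀ ![v, (J y - J y₀) v] := by
      have h7 : Ω y₀ ![v, J y v] = Ω y₀ ![v, J y₀ v] + Ω y₀ ![v, (J y - J y₀) v] := by
        rw [← alternatingMap_map_snd_add]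
        simp
      rw [ContinuousAlternatingMap.sub_apply, h7]
      ring
    rw [e]
    calc _ ≤ ‖Ω y - Ω y₀‖ * (‖v‖ * ‖J y v‖) + ‖Ω y₀‖ * (‖v‖ * ‖(J y - J y₀) v‖) :=
          (abs_add_le _ _).trans (add_le_add (hle _ _ _) (hle _ _ _))
      _ ≤ ‖Ω y - Ω y₀‖ * (‖v‖ * (‖J y‖ * ‖v‖)) + ‖Ω y₀‖ * (‖v‖ * (‖J y - J y₀‖ * ‖v‖)) := by
          gcongr <;> exact ContinuousLinearMap.le_opNorm _ _
      _ = (‖Ω y - Ω y₀‖ * ‖J y‖ + ‖Ω y₀‖ * ‖J y - J y₀‖) * ‖v‖ ^ 2 := by ring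
      _ ≤ _ := by gcongr
  have h7 : δ / 2 * ‖v‖ ^ 2 ≤ Ω y ![v, J y v] := by
    have := (abs_le.1 h6).1
    have := hδv v
    linarith
  constructor
  · calc √(Ω y ![v, J y v]) ≤ √(CΩ * CJ * ‖v‖ ^ 2) := Real.sqrt_le_sqrt h5
      _ = √(CΩ * CJ) * ‖v‖ := by
        rw [Real.sqrt_mul (mul_nonneg ((norm_nonneg _).trans h1) ((norm_nonneg _).trans h2)),
          Real.sqrt_sq (norm_nonneg _)]
      _ ≤ _ := by gcongr; exact le_max_left _ _
  · calc ‖v‖ = √(‖v‖ ^ 2) := (Real.sqrt_sq (norm_nonneg _)).symm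
      _ ≤ √(2 / δ * Ω y ![v, J y v]) := by
        refine Real.sqrt_le_sqrt ?_
        calc ‖v‖ ^ 2 = 2 / δ * (δ / 2 * ‖v‖ ^ 2) := by field_simp
          _ ≤ _ := by gcongr
      _ = √(2 / δ) * √(Ω y ![v, J y v]) := Real.sqrt_mul (by positivity) _
      _ ≤ _ := by gcongr; exact le_max_right _ _

theorem AlmostKahler.gram_apply {y : EuclideanSpace ℝ (Fin (2 * m))} (hy : y ∈ dom c)
    (i j : Fin (2 * m)) : K.gram c y i j = K.Ω.inChart c y
      ![EuclideanSpace.single i 1, K.chartJ c y (EuclideanSpace.single j 1)] :=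
  K.g_dparam hy _ _

theorem AlmostKahler.contDiffAt_gram (hy : y₀ ∈ dom c) (i j : Fin (2 * m)) :
    ContDiffAt ℝ ∞ (fun y => K.gram c y i j) y₀ := by
  have h1 : ContDiffAt ℝ ∞ (fun y => K.Ω.inChart c y
      ![EuclideanSpace.single i 1, K.chartJ c y (EuclideanSpace.single j 1)]) y₀ := by
    -- the form as a bilinear map
    have h2 : ContDiffAt ℝ ∞ (fun y => ContinuousAlternatingMap.curryLeftLI (𝕜 := ℝ)
        (E := EuclideanSpace ℝ (Fin (2 * m))) (F := ℝ) (n := 1) (K.Ω.inChart c y)) y₀ :=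
      (LinearIsometry.contDiff _).contDiffAt.comp y₀ (K.contDiffAt_Ω hy)
    have h3 : ContDiffAt ℝ ∞ (fun y => (ContinuousAlternatingMap.ofSubsingletonLIE (𝕜 := ℝ)
        (E := EuclideanSpace ℝ (Fin (2 * m))) (F := ℝ) (0 : Fin 1)).symm
        (ContinuousAlternatingMap.curryLeftLI (𝕜 := ℝ) (E := EuclideanSpace ℝ (Fin (2 * m)))
          (F := ℝ) (n := 1) (K.Ω.inChart c y) (EuclideanSpace.single i 1))) y₀ :=
      (LinearIsometryEquiv.contDiff _).contDiffAt.comp y₀ (h2.clm_apply contDiffAt_const)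
    refine (h3.clm_apply ((K.contDiffAt_chartJ hy).clm_apply
      (contDiffAt_const (c := EuclideanSpace.single j (1 : ℝ))))).congr_of_eventuallyEq
        (.of_forall fun y => ?_)
    change K.Ω.inChart c y _ = K.Ω.inChart c y _
    congr 1
    ext l : 1
    fin_cases l <;> rfl
  refine h1.congr_of_eventuallyEq ?_
  filter_upwards [(isOpen_dom c).mem_nhds hy] with y hy using K.gram_apply hy i j

/-- A vector in the kernel of the Gram matrix has length zero. -/
theorem AlmostKahler.det_gram_ne_zero (hy : y₀ ∈ dom c) : (K.gram c y₀).det ≠ 0 := by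
  intro h
  obtain ⟨x, hx, hx0⟩ := Matrix.exists_mulVec_eq_zero_iff.2 h
  set v : EuclideanSpace ℝ (Fin (2 * m)) := WithLp.toLp 2 x with hv
  have hv0 : v ≠ 0 := fun h => hx (by simpa [hv] using h)
  have hvs : v = ∑ j, x j • EuclideanSpace.single j (1 : ℝ) := by
    ext j
    simp [hv, Finset.sum_apply, Pi.single_apply]
  have hpos : 0 < K.g (param c y₀) (dparam c y₀ v) (dparam c y₀ v) :=
    K.g_pos fun h => hv0 (dparam_injective hy h)
  have hlin : ∀ w : EuclideanSpace ℝ (Fin (2 * m)),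
      K.g (param c y₀) (dparam c y₀ w) (dparam c y₀ v) = ∑ j, x j *
        K.g (param c y₀) (dparam c y₀ w) (dparam c y₀ (EuclideanSpace.single j 1)) := by
    intro w
    set ℓ : EuclideanSpace ℝ (Fin (2 * m)) →ₗ[ℝ] ℝ :=
      { toFun := fun z => K.g (param c y₀) (dparam c y₀ w) (dparam c y₀ z)
        map_add' := fun z z' => by
          rw [K.g_dparam hy, K.g_dparam hy, K.g_dparam hy, map_add]
          exact alternatingMap_map_snd_add _ _ _ _
        map_smul' := fun t z => by
          rw [K.g_dparam hy, K.g_dparam hy, map_smul]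
          exact alternatingMap_map_snd_smul _ _ _ _ } with hℓ
    have h1 : ℓ v = ∑ j, x j * ℓ (EuclideanSpace.single j 1) := by
      conv_lhs => rw [hvs, map_sum]
      simp
    exact h1
  have hfst : ∀ w : EuclideanSpace ℝ (Fin (2 * m)),
      K.g (param c y₀) (dparam c y₀ v) (dparam c y₀ w) = ∑ j, x j *
        K.g (param c y₀) (dparam c y₀ (EuclideanSpace.single j 1)) (dparam c y₀ w) := by
    intro w
    set ℓ : EuclideanSpace ℝ (Fin (2 * m)) →ₗ[ℝ] ℝ :=
      { toFun := fun z => K.g (param c y₀) (dparam c y₀ z) (dparam c y₀ w)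
        map_add' := fun z z' => by
          rw [K.g_dparam hy, K.g_dparam hy, K.g_dparam hy]
          exact alternatingMap_map_fst_add _ _ _ _
        map_smul' := fun t z => by
          rw [K.g_dparam hy, K.g_dparam hy]
          exact alternatingMap_map_fst_smul _ _ _ _ } with hℓ
    have h1 : ℓ v = ∑ j, x j * ℓ (EuclideanSpace.single j 1) := by
      conv_lhs => rw [hvs, map_sum]
      simp
    exact h1
  rw [hfst] at hpos
  refine hpos.ne' (Finset.sum_eq_zero fun i _ => ?_)
  rw [hlin]
  have h1 := congrFun hx0 i
  have h2 : ∑ j, x j * K.g (param c y₀) (dparam c y₀ (EuclideanSpace.single i 1))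
      (dparam c y₀ (EuclideanSpace.single j 1)) = (K.gram c y₀).mulVec x i := by
    rw [Matrix.mulVec, dotProduct]
    exact Finset.sum_congr rfl fun j _ => mul_comm _ _
  rw [h2, h1, Pi.zero_apply, mul_zero]

theorem AlmostKahler.exists_christoffel_bound (hy : y₀ ∈ dom c) :
    ∃ B : ℝ, ∀ᶠ y in 𝓝 y₀, ∀ v w : EuclideanSpace ℝ (Fin (2 * m)),
      ‖K.christoffel c y v w‖ ≤ B * ‖v‖ * ‖w‖ := by
  have hgram : ContinuousAt (K.gram c) y₀ := by
    refine continuousAt_pi.2 fun i => continuousAt_pi.2 fun j => ?_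
    exact (K.contDiffAt_gram hy i j).continuousAt
  have hinv : ∀ a l, ContinuousAt (fun y => (K.gram c y)⁻¹ a l) y₀ := by
    intro a l
    have h1 : ContinuousAt (fun y => (K.gram c y).det) y₀ :=
      (Continuous.matrix_det continuous_id).continuousAt.comp hgram
    have h2 : ContinuousAt (fun y => (K.gram c y).adjugate a l) y₀ :=
      ((Continuous.matrix_adjugate continuous_id).matrix_elem a l).continuousAt.comp hgram
    have h3 : ContinuousAt (fun y => (K.gram c y).det⁻¹ * (K.gram c y).adjugate a l) y₀ :=
      (h1.inv₀ (K.det_gram_ne_zero hy)).mul h2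
    simpa [Matrix.inv_def, Ring.inverse_eq_inv'] using h3
  have hd : ∀ l i j, ContinuousAt (fun y => K.dgram c y l i j) y₀ := by
    intro l i j
    have h1 : ContinuousAt (fderiv ℝ fun y' => K.gram c y' i j) y₀ :=
      ((K.contDiffAt_gram hy i j).fderiv_right (m := 1)
        (by simpa [one_add_one_eq_two] using two_le_infty)).continuousAt
    exact h1.clm_apply continuousAt_const
  set q : EuclideanSpace ℝ (Fin (2 * m)) → Fin (2 * m) → Fin (2 * m) → Fin (2 * m) → ℝ :=
    fun y a i j => (1 / 2) * (∑ l, (K.gram c y)⁻¹ a l *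
      (K.dgram c y i j l + K.dgram c y j i l - K.dgram c y l i j)) with hq
  have hqc : ContinuousAt (fun y => ∑ a, ∑ i, ∑ j, |q y a i j|) y₀ := by
    refine tendsto_finsetSum _ fun a _ => tendsto_finsetSum _ fun i _ =>
      tendsto_finsetSum _ fun j _ => Tendsto.abs ?_
    exact (tendsto_finsetSum _ fun l _ => (hinv a l).mul
      (((hd i j l).add (hd j i l)).sub (hd l i j))).const_mul _
  obtain ⟨B, hB⟩ := eventually_norm_le_of_continuousAt hqc
  refine ⟨B, hB.mono fun y hy v w => ?_⟩
  have hcoord : ∀ (z : EuclideanSpace ℝ (Fin (2 * m))) i, |z i| ≤ ‖z‖ := fun z i =>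
    PiLp.norm_apply_le z i
  have hs : ∀ z : EuclideanSpace ℝ (Fin (2 * m)), ‖z‖ ≤ ∑ a, |z a| := fun z => by
    have h1 : z = ∑ a, z a • EuclideanSpace.single a (1 : ℝ) := by
      ext j
      simp [Finset.sum_apply, Pi.single_apply]
    conv_lhs => rw [h1]
    refine (norm_sum_le _ _).trans_eq (Finset.sum_congr rfl fun a _ => ?_)
    rw [norm_smul]
    simp
  calc ‖K.christoffel c y v w‖ ≤ ∑ a, |∑ i, ∑ j, q y a i j * v i * w j| := hs _
    _ ≤ ∑ a, ∑ i, ∑ j, |q y a i j| * (‖v‖ * ‖w‖) := by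
      refine Finset.sum_le_sum fun a _ => (Finset.abs_sum_le_sum_abs _ _).trans
        (Finset.sum_le_sum fun i _ => (Finset.abs_sum_le_sum_abs _ _).trans
          (Finset.sum_le_sum fun j _ => ?_))
      rw [abs_mul, abs_mul, mul_assoc]
      gcongr
      · exact hcoord v i
      · exact hcoord w j
    _ = (∑ a, ∑ i, ∑ j, |q y a i j|) * (‖v‖ * ‖w‖) := by simp only [Finset.sum_mul]
    _ ≤ B * (‖v‖ * ‖w‖) := by
      gcongr
      exact (le_abs_self _).trans hy
    _ = _ := by ring

variable {F : Type*} [NormedAddCommGroup F] [InnerProductSpace ℂ F] {ι κ : Type*}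
  {E : HermitianBundle (2 * m) M F ι} {L : HermitianBundle (2 * m) M ℂ κ}

/-- Uniform bounds, on a set `U` of a chart, for the fixed geometric data: the metric, its
Levi-Civita connection, and the connections and curvatures of the two bundles. -/
structure GeometryBounds (DE : HermitianConnection E) (DL : HermitianConnection L) (c : M) (i : ι)
    (a : κ) (B : ℝ) (U : Set (EuclideanSpace ℝ (Fin (2 * m)))) : Prop where
  subset_dom : U ⊆ dom c
  mem_baseSet : ∀ y ∈ U, param c y ∈ E.baseSet i ∩ L.baseSet a
  metric_le : ∀ y ∈ U, ∀ v, √(K.g (param c y) (dparam c y v) (dparam c y v)) ≤ B * ‖v‖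
  le_metric : ∀ y ∈ U, ∀ v, ‖v‖ ≤ B * √(K.g (param c y) (dparam c y v) (dparam c y v))
  christoffel_le : ∀ y ∈ U, ∀ v w, ‖K.christoffel c y v w‖ ≤ B * ‖v‖ * ‖w‖
  form_le : ∀ y ∈ U, ∀ v z, ‖(DE.form i).inChart c y v z‖ ≤ B * ‖v‖ * ‖z‖
  lipschitz_form : ∀ y ∈ U, ∀ y' ∈ U, ∀ v,
    ‖(DL.form a).inChart c y v 1 - (DL.form a).inChart c y' v 1‖ ≤ B * ‖y - y'‖ * ‖v‖
  curvature_le : ∀ y ∈ U, ∀ v w,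
    ‖DE.curvature i (param c y) ![dparam c y v, dparam c y w]‖ ≤ B * ‖v‖ * ‖w‖
  Ω_le : ∀ y ∈ U, ∀ v w, |K.Ω (param c y) ![dparam c y v, dparam c y w]| ≤ B * ‖v‖ * ‖w‖

/-- The geometric data are smooth, hence bounded near each point. The radius is written as `4 R` to
fit `exists_lintegral_inv_norm_pow_le`. -/
theorem exists_geometryBounds (DE : HermitianConnection E) (DL : HermitianConnection L)
    (hy : y₀ ∈ dom c) {i : ι} {a : κ} (hi : param c y₀ ∈ E.baseSet i)
    (ha : param c y₀ ∈ L.baseSet a) :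
    ∃ B R : ℝ, 1 ≤ B ∧ 0 < R ∧ GeometryBounds K DE DL c i a B (Metric.ball y₀ (4 * R)) := by
  have hO := (E.isOpen_baseSet i).inter (L.isOpen_baseSet a)
  obtain ⟨B₁, h₁⟩ := K.exists_metric_comparison hy
  obtain ⟨B₂, h₂⟩ := K.exists_christoffel_bound hy
  have hA := (DE.smooth_form i).contDiffAt (E.isOpen_baseSet i) hy hi
  have hα := (DL.smooth_form a).contDiffAt (L.isOpen_baseSet a) hy ha
  obtain ⟨B₃, h₃⟩ := eventually_norm_le_of_continuousAt hA.continuousAt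
  obtain ⟨B₄, h₄⟩ := eventually_norm_le_of_continuousAt
    (hA.fderiv_right (m := 1) (by simpa [one_add_one_eq_two] using two_le_infty)).continuousAt
  obtain ⟨B₅, t, ht, h₅⟩ := (hα.of_le (m := 1) (by simp)).exists_lipschitzOnWith
  obtain ⟨B₆, h₆⟩ := eventually_norm_le_of_continuousAt (K.contDiffAt_Ω hy).continuousAt
  set B : ℝ := 1 + |B₁| + |B₂| + |B₃| + (2 * |B₄| + 2 * |B₃| ^ 2) + B₅ + |B₆| with hB
  have hB₅ : (0 : ℝ) ≤ B₅ := B₅.2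
  have p₁ := abs_nonneg B₁
  have p₂ := abs_nonneg B₂
  have p₃ := abs_nonneg B₃
  have p₄ := abs_nonneg B₄
  have p₆ := abs_nonneg B₆
  have p₇ := sq_nonneg |B₃|
  have e₀ : 1 ≤ B := by linarith
  have e₁ : B₁ ≤ B := (le_abs_self B₁).trans (by linarith)
  have e₂ : B₂ ≤ B := (le_abs_self B₂).trans (by linarith)
  have e₃ : B₃ ≤ B := (le_abs_self B₃).trans (by linarith)
  have e₄ : 2 * |B₄| + 2 * |B₃| ^ 2 ≤ B := by linarith
  have e₅ : B₅ ≤ B := by linarith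
  have e₆ : B₆ ≤ B := (le_abs_self B₆).trans (by linarith)
  have h₀ : ∀ᶠ y in 𝓝 y₀, y ∈ dom c ∩ param c ⁻¹' (E.baseSet i ∩ L.baseSet a) :=
    (isOpen_dom_inter c hO).mem_nhds ⟨hy, hi, ha⟩
  have ht' : ∀ᶠ y in 𝓝 y₀, y ∈ t := ht
  have hev := (((((h₀.and h₁).and h₂).and h₃).and h₄).and ht').and h₆
  obtain ⟨ε, hε, hball⟩ := Metric.eventually_nhds_iff_ball.1 hev
  -- the curvature `dA + A ∧ A` is bounded by `2 |B₄| + 2 |B₃|²`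
  refine ⟨B, ε / 4, e₀, by positivity, ?_⟩
  rw [show 4 * (ε / 4) = ε by ring]
  refine ⟨fun y hy => ?_, fun y hy => ?_, fun y hy v => ?_, fun y hy v => ?_, fun y hy v w => ?_,
    fun y hy v z => ?_, fun y hy y' hy' v => ?_, fun y hy v w => ?_, fun y hy v w => ?_⟩
  all_goals obtain ⟨⟨⟨⟨⟨⟨⟨g0, g0'⟩, g1⟩, g2⟩, g3⟩, g4⟩, g5⟩, g6⟩ := hball y hy
  · exact g0
  · exact g0'
  · exact (g1 v).1.trans (by gcongr)
  · exact (g1 v).2.trans (by gcongr)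
  · exact (g2 v w).trans (by gcongr)
  · calc _ ≤ ‖(DE.form i).inChart c y‖ * ‖v‖ * ‖z‖ :=
          (ContinuousLinearMap.le_opNorm _ _).trans
            (by gcongr; exact ContinuousLinearMap.le_opNorm _ _)
      _ ≤ _ := by gcongr; exact g3.trans e₃
  · have h7 := h₅.dist_le_mul y g5 y' (hball y' hy').1.2
    rw [dist_eq_norm, dist_eq_norm] at h7
    have h8 := (((DL.form a).inChart c y - (DL.form a).inChart c y') v).le_opNorm 1
    rw [norm_one, mul_one] at h8
    calc _ ≤ ‖((DL.form a).inChart c y - (DL.form a).inChart c y') v‖ := h8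
      _ ≤ ‖(DL.form a).inChart c y - (DL.form a).inChart c y'‖ * ‖v‖ :=
        ContinuousLinearMap.le_opNorm _ _
      _ ≤ _ := by gcongr; exact h7.trans (by gcongr)
  · rw [DE.curvature_apply g0 g0'.1]
    set A := (DE.form i).inChart c
    have k1 : ∀ v w, ‖fderiv ℝ A y v w‖ ≤ |B₄| * (‖v‖ * ‖w‖) := fun v w => by
      calc _ ≤ ‖fderiv ℝ A y‖ * ‖v‖ * ‖w‖ := ContinuousLinearMap.le_opNorm₂ _ _ _
        _ ≤ |B₄| * ‖v‖ * ‖w‖ := by gcongr; exact g4.trans (le_abs_self _)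
        _ = _ := by ring
    have k2 : ∀ v, ‖A y v‖ ≤ |B₃| * ‖v‖ := fun v =>
      (ContinuousLinearMap.le_opNorm _ _).trans (by gcongr; exact g3.trans (le_abs_self _))
    have k3 : ∀ v w, ‖A y v * A y w‖ ≤ |B₃| ^ 2 * (‖v‖ * ‖w‖) := fun v w => by
      calc _ ≤ (|B₃| * ‖v‖) * (|B₃| * ‖w‖) :=
            (norm_mul_le _ _).trans (mul_le_mul (k2 v) (k2 w) (norm_nonneg _) (by positivity))
        _ = _ := by ring
    calc _ ≤ (|B₄| * (‖v‖ * ‖w‖) + |B₄| * (‖w‖ * ‖v‖)) +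
          (|B₃| ^ 2 * (‖v‖ * ‖w‖) + |B₃| ^ 2 * (‖w‖ * ‖v‖)) :=
          (norm_add_le _ _).trans (add_le_add
            ((norm_sub_le _ _).trans (add_le_add (k1 _ _) (k1 _ _)))
            ((norm_sub_le _ _).trans (add_le_add (k3 _ _) (k3 _ _))))
      _ = (2 * |B₄| + 2 * |B₃| ^ 2) * ‖v‖ * ‖w‖ := by ring
      _ ≤ _ := by gcongr
  · exact (K.abs_Ω_le c y v w).trans (by gcongr; exact g6.trans e₆)

end LocalGeometry

/-! ### Local bounds for the sections -/

section LocalSections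

variable {m : ℕ} {M : Type*} [TopologicalSpace M]
  [ChartedSpace (EuclideanSpace ℝ (Fin (2 * m))) M] {K : AlmostKahler m M}

theorem AlmostKahler.len_eq (K : AlmostKahler m M) (k : ℕ) (x : M)
    (v : TangentSpace (𝓡 (2 * m)) x) : K.len k x v = √(k : ℝ) * √(K.g x v v) :=
  Real.sqrt_mul (Nat.cast_nonneg k) _

variable {F : Type*} [NormedAddCommGroup F] [InnerProductSpace ℂ F] {ι κ : Type*}
  {E : HermitianBundle (2 * m) M F ι} {L : HermitianBundle (2 * m) M ℂ κ}
  {DE : HermitianConnection E} {DL : HermitianConnection L}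
  {c : M} {i : ι} {a : κ} {B C η : ℝ} {U : Set (EuclideanSpace ℝ (Fin (2 * m)))}

/-- The connection form of a Hermitian line bundle is purely imaginary. -/
theorem HermitianConnection.form_line_eq (DL : HermitianConnection L) {x : M}
    (hx : x ∈ L.baseSet a) (v : TangentSpace (𝓡 (2 * m)) x) :
    DL.form a x v 1 = Complex.I * ((DL.form a x v 1).im : ℂ) := by
  have h := DL.skew a x hx v 1 1
  simp only [RCLike.inner_apply, map_one, mul_one, one_mul] at h
  have hre : (DL.form a x v 1).re = 0 := by
    have := congrArg Complex.re h
    simp at this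
    linarith
  apply Complex.ext <;> simp [hre]

theorem GeometryBounds.len_dparam_le (hG : GeometryBounds K DE DL c i a B U) (k : ℕ)
    {y : EuclideanSpace ℝ (Fin (2 * m))} (hy : y ∈ U) (v : EuclideanSpace ℝ (Fin (2 * m))) :
    K.len k (param c y) (dparam c y v) ≤ √(k : ℝ) * (B * ‖v‖) := by
  rw [K.len_eq]
  gcongr
  exact hG.metric_le y hy v

variable (K DE DL) in
/-- The part of the asymptotic bounds that concerns one section of `E ⊗ L^k` and the frame of index
`(i, a)`: bounds for the section and its first two covariant derivatives, and transversality. -/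
structure SectionBounds {k : ℕ} (s : SmoothSection (E.tensorPow L k)) (i : ι) (a : κ)
    (C η : ℝ) : Prop where
  norm_le : ∀ x ∈ (E.tensorPow L k).baseSet (i, a), ‖s.coord (i, a) x‖ ≤ C
  covDeriv_le : ∀ x ∈ (E.tensorPow L k).baseSet (i, a), ∀ v,
    ‖(DE.tensorPow DL k).covDeriv s (i, a) x v‖ ≤ C * K.len k x v
  covDerivOneForm_le : ∀ c : M, ∀ y ∈ dom c, param c y ∈ (E.tensorPow L k).baseSet (i, a) → ∀ v w,
    ‖(DE.tensorPow DL k).covDerivOneForm K ((DE.tensorPow DL k).covDeriv s (i, a)) (i, a) c y v w‖ ≤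
      C * K.len k (param c y) (dparam c y v) * K.len k (param c y) (dparam c y w)
  transverse : ∀ x ∈ (E.tensorPow L k).baseSet (i, a), ‖s.coord (i, a) x‖ ≤ η →
    ∃ R : F →ₗ[ℝ] TangentSpace (𝓡 (2 * m)) x, ∀ u : F,
      (DE.tensorPow DL k).covDeriv s (i, a) x (R u) = u ∧ K.len k x (R u) ≤ η⁻¹ * ‖u‖

theorem SmoothSection.mdifferentiableAt {E : HermitianBundle (2 * m) M F ι} (s : SmoothSection E)
    {x : M} (hx : x ∈ E.baseSet i) : MDifferentiableAt (𝓡 (2 * m)) 𝓘(ℝ, F) (s.coord i) x :=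
  ((s.smooth_coord i).contMDiffAt ((E.isOpen_baseSet i).mem_nhds hx)).mdifferentiableAt (by simp)

variable [IsManifold (𝓡 (2 * m)) ∞ M]

theorem HermitianConnection.covDeriv_inChart {E : HermitianBundle (2 * m) M F ι}
    (D : HermitianConnection E) (s : SmoothSection E) {y : EuclideanSpace ℝ (Fin (2 * m))}
    (hy : y ∈ dom c) (hi : param c y ∈ E.baseSet i) :
    (D.covDeriv s i).inChart c y = fderiv ℝ (fun y => s.coord i (param c y)) y +
      (ContinuousLinearMap.apply ℂ F (s.coord i (param c y))).restrictScalars ℝ ∘L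
        (D.form i).inChart c y := by
  ext v
  rw [add_apply, fderiv_comp_param hy (s.mdifferentiableAt hi)]
  rfl

theorem SmoothSection.contDiffAt_coord {E : HermitianBundle (2 * m) M F ι} (s : SmoothSection E)
    {y : EuclideanSpace ℝ (Fin (2 * m))} (hy : y ∈ dom c) (hi : param c y ∈ E.baseSet i) :
    ContDiffAt ℝ ∞ (fun y => s.coord i (param c y)) y :=
  (contDiffOn_comp_param (E.isOpen_baseSet i) (s.smooth_coord i) c).contDiffAt
    ((isOpen_dom_inter c (E.isOpen_baseSet i)).mem_nhds ⟨hy, hi⟩)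

/-- The covariant derivative of a smooth section is differentiable; class `C^1` is all that is used.
-/
theorem HermitianConnection.contDiffAt_covDeriv {E : HermitianBundle (2 * m) M F ι}
    (D : HermitianConnection E) (s : SmoothSection E) {y : EuclideanSpace ℝ (Fin (2 * m))}
    (hy : y ∈ dom c) (hi : param c y ∈ E.baseSet i) :
    ContDiffAt ℝ 1 ((D.covDeriv s i).inChart c) y := by
  have hu := s.contDiffAt_coord hy hi
  have hA := (D.smooth_form i).contDiffAt (E.isOpen_baseSet i) hy hi
  have h1 : ContDiffAt ℝ 1 (fderiv ℝ (fun y => s.coord i (param c y))) y :=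
    hu.fderiv_right (m := 1) (by simpa [one_add_one_eq_two] using two_le_infty)
  have h2 : ContDiffAt ℝ 1 (fun y => (ContinuousLinearMap.apply ℂ F
      (s.coord i (param c y))).restrictScalars ℝ ∘L (D.form i).inChart c y) y := by
    have h3 : ContDiffAt ℝ 1 (fun y => ((ContinuousLinearMap.restrictScalarsL ℂ (F →L[ℂ] F) F ℝ ℝ)
        ∘L ((ContinuousLinearMap.apply ℂ F).restrictScalars ℝ)) (s.coord i (param c y))) y :=
      (ContinuousLinearMap.contDiff _).contDiffAt.comp y (hu.of_le (by simp))
    exact h3.clm_comp (hA.of_le (by simp))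
  refine (h1.add h2).congr_of_eventuallyEq ?_
  filter_upwards [(isOpen_dom_inter c (E.isOpen_baseSet i)).mem_nhds ⟨hy, hi⟩] with z hz
  exact D.covDeriv_inChart s hz.1 hz.2

/-- In a chart, the bounds for the metric `g_k = k g` turn into Euclidean bounds at scale `τ = √k`.
The connection form of `L^k` is `k α`, up to the factor `i`, where `α` does not depend on `k`. -/
theorem SectionBounds.transverseBounds {k : ℕ} (hk : 1 ≤ k)
    {s : SmoothSection (E.tensorPow L k)} (hs : SectionBounds K DE DL s i a C η) (hC : 0 ≤ C)
    (hη : 0 < η) (hB : 1 ≤ B) (hG : GeometryBounds K DE DL c i a B U) :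
    TransverseBounds (B ^ 2 * (1 + C) + B * η⁻¹) η √(k : ℝ) U (fun y => s.coord (i, a) (param c y))
      (((DE.tensorPow DL k).covDeriv s (i, a)).inChart c)
      (fun y => ContinuousLinearMap.restrictScalarsL ℂ F F ℝ ℝ ∘L (DE.form i).inChart c y)
      (fun y => (Complex.imCLM ∘L (ContinuousLinearMap.apply ℂ ℂ (1 : ℂ)).restrictScalars ℝ) ∘L
        (DL.form a).inChart c y)
      (K.christoffel c) := by
  have hk0 : (0 : ℝ) < k := by exact_mod_cast hk
  have hsq : √(k : ℝ) ^ 2 = k := Real.sq_sqrt hk0.le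
  have hτ : 0 < √(k : ℝ) := Real.sqrt_pos.2 hk0
  have hη' : 0 < η⁻¹ := inv_pos.2 hη
  have b1 : C ≤ B ^ 2 * (1 + C) + B * η⁻¹ := by
    have : 1 * (1 + C) ≤ B ^ 2 * (1 + C) := by gcongr; exact one_le_pow₀ hB
    have : 0 ≤ B * η⁻¹ := by positivity
    linarith
  have b2 : C * B ^ 2 ≤ B ^ 2 * (1 + C) + B * η⁻¹ := by
    have : 0 ≤ B * η⁻¹ := by positivity
    nlinarith [sq_nonneg B]
  have b3 : B ≤ B ^ 2 * (1 + C) + B * η⁻¹ := by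
    have : 0 ≤ B * η⁻¹ := by positivity
    have : B ≤ B ^ 2 := by nlinarith
    nlinarith [mul_nonneg (sq_nonneg B) hC]
  have b4 : B * η⁻¹ ≤ B ^ 2 * (1 + C) + B * η⁻¹ := le_add_of_nonneg_left (by positivity)
  have b5 : C * B ≤ B ^ 2 * (1 + C) + B * η⁻¹ := by
    refine le_trans ?_ b2
    have : B ≤ B ^ 2 := by nlinarith
    gcongr
  -- the connection form of `E ⊗ L^k` acts as `A + i k α`
  have hform : ∀ y ∈ U, ∀ v z, ((DE.tensorPow DL k).form (i, a)).inChart c y v z =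
      (DE.form i).inChart c y v z +
        (Complex.I * ((√(k : ℝ) ^ 2 * ((DL.form a).inChart c y v 1).im : ℝ) : ℂ)) • z := by
    intro y hy v z
    rw [HermitianConnection.tensorPow_form_inChart, add_apply,
      smul_apply, one_apply_eq_self, hsq]
    congr 2
    have := DL.form_line_eq (hG.mem_baseSet y hy).2 (dparam c y v)
    change (k : ℂ) * DL.form a (param c y) (dparam c y v) 1 = _
    rw [this]
    push_cast
    exact mul_left_comm _ _ _
  refine ⟨fun y hy => ?_, fun y hy => ?_, fun y hy v => ?_, fun y hy v z => ?_,
    fun y hy y' hy' v => ?_, fun y hy v w => ?_, fun y hy => ?_, fun y hy hu => ?_⟩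
  · have hd := hG.subset_dom hy
    have hb := hG.mem_baseSet y hy
    refine ⟨_, ((s.contDiffAt_coord (i := (i, a)) hd hb).differentiableAt
      (by simp)).hasFDerivAt, fun v => ?_⟩
    rw [HermitianConnection.covDeriv_inChart (i := (i, a)) _ s hd hb, add_assoc]
    exact congrArg _ (hform y hy v _)
  · exact (hs.norm_le _ (hG.mem_baseSet y hy)).trans b1
  · calc _ ≤ C * K.len k (param c y) (dparam c y v) :=
          hs.covDeriv_le _ (hG.mem_baseSet y hy) (dparam c y v)
      _ ≤ C * (√(k : ℝ) * (B * ‖v‖)) := by gcongr; exact hG.len_dparam_le k hy v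
      _ = (C * B) * √(k : ℝ) * ‖v‖ := by ring
      _ ≤ _ := by gcongr
  · exact (hG.form_le y hy v z).trans (by gcongr)
  · have h1 : ∀ y, ((Complex.imCLM ∘L (ContinuousLinearMap.apply ℂ ℂ (1 : ℂ)).restrictScalars ℝ) ∘L
        (DL.form a).inChart c y) v = ((DL.form a).inChart c y v 1).im := fun _ => rfl
    rw [h1, h1, ← Complex.sub_im]
    exact (Complex.abs_im_le_norm _).trans ((hG.lipschitz_form y hy y' hy' v).trans (by gcongr))
  · exact (hG.christoffel_le y hy v w).trans (by gcongr)
  · have hd := hG.subset_dom hy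
    have hb := hG.mem_baseSet y hy
    refine ⟨_, (((DE.tensorPow DL k).contDiffAt_covDeriv s (i := (i, a)) hd hb).differentiableAt
      (by simp)).hasFDerivAt, fun v w => ?_⟩
    have h1 := hs.covDerivOneForm_le c y hd hb v w
    rw [HermitianConnection.covDerivOneForm, hform y hy, ← add_assoc] at h1
    calc _ ≤ _ := h1
      _ ≤ C * (√(k : ℝ) * (B * ‖v‖)) * (√(k : ℝ) * (B * ‖w‖)) := by
        have h2 := hG.len_dparam_le k hy v
        have h3 := hG.len_dparam_le k hy w
        have h4 : 0 ≤ K.len k (param c y) (dparam c y w) := Real.sqrt_nonneg _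
        gcongr
      _ = (C * B ^ 2) * √(k : ℝ) ^ 2 * ‖v‖ * ‖w‖ := by ring
      _ ≤ _ := by gcongr
  · have hd := hG.subset_dom hy
    obtain ⟨R, hR⟩ := hs.transverse _ (hG.mem_baseSet y hy) hu
    refine ⟨(mvfderiv (𝓡 (2 * m)) (extChartAt (𝓡 (2 * m)) c) (param c y)).toLinearMap ∘ₗ R,
      fun z => ?_⟩
    set w : EuclideanSpace ℝ (Fin (2 * m)) :=
      mvfderiv (𝓡 (2 * m)) (extChartAt (𝓡 (2 * m)) c) (param c y) (R z) with hw
    have h1 : dparam c y w = R z := dparam_mvfderiv_extChartAt hd _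
    constructor
    · change (DE.tensorPow DL k).covDeriv s (i, a) (param c y) (dparam c y w) = z
      rw [h1]
      exact (hR z).1
    · change ‖w‖ ≤ _
      have h2 := (hR z).2
      rw [K.len_eq, ← h1] at h2
      have h3 : √(K.g (param c y) (dparam c y w) (dparam c y w)) ≤
          (√(k : ℝ))⁻¹ * (η⁻¹ * ‖z‖) := by
        rw [le_inv_mul_iff₀ hτ]
        exact h2
      calc ‖w‖ ≤ B * ((√(k : ℝ))⁻¹ * (η⁻¹ * ‖z‖)) :=
            (hG.le_metric y hy w).trans (by gcongr)
        _ = (B * η⁻¹) * (√(k : ℝ))⁻¹ * ‖z‖ := by ring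
        _ ≤ _ := by gcongr

end LocalSections

/-! ### The local estimate of the potential -/

section PotentialEstimate

variable {m : ℕ} {M : Type*} [TopologicalSpace M]
  [ChartedSpace (EuclideanSpace ℝ (Fin (2 * m))) M] [IsManifold (𝓡 (2 * m)) ∞ M]
  {K : AlmostKahler m M}

/-- The covariant derivative of a section transforms like the section. -/
theorem HermitianConnection.covDeriv_gauge {F : Type*} [NormedAddCommGroup F]
    [InnerProductSpace ℂ F] {ι : Type*} {E : HermitianBundle (2 * m) M F ι}
    (D : HermitianConnection E) (s : SmoothSection E) {i j : ι} {x : M}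
    (hx : x ∈ E.baseSet i ∩ E.baseSet j) (v : TangentSpace (𝓡 (2 * m)) x) :
    D.covDeriv s j x v = E.coordChange i j x (D.covDeriv s i x v) := by
  obtain ⟨c, y, hy, rfl⟩ := exists_param (d := 2 * m) x
  obtain ⟨v, rfl⟩ := dparam_surjective hy v
  have hO := (E.isOpen_baseSet i).inter (E.isOpen_baseSet j)
  have e1 : ∀ l, D.covDeriv s l (param c y) (dparam c y v) =
      (D.covDeriv s l).inChart c y v := fun _ => rfl
  rw [e1, e1, D.covDeriv_inChart s hy hx.1, D.covDeriv_inChart s hy hx.2]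
  set h : EuclideanSpace ℝ (Fin (2 * m)) → F →L[ℂ] F := fun y => E.coordChange i j (param c y)
    with hh
  set u : EuclideanSpace ℝ (Fin (2 * m)) → F := fun y => s.coord i (param c y) with hu
  have hhd : DifferentiableAt ℝ h y :=
    ((contDiffOn_comp_param hO (E.smooth_coordChange i j) c).contDiffAt
      ((isOpen_dom_inter c hO).mem_nhds ⟨hy, hx⟩)).differentiableAt (by simp)
  have hud : DifferentiableAt ℝ u y := (s.contDiffAt_coord hy hx.1).differentiableAt (by simp)
  have h1 : (fun y : EuclideanSpace ℝ (Fin (2 * m)) => s.coord j (param c y)) =ᶠ[𝓝 y] fun y =>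
      (ContinuousLinearMap.restrictScalarsL ℂ F F ℝ ℝ) (h y) (u y) := by
    filter_upwards [(isOpen_dom_inter c hO).mem_nhds ⟨hy, hx⟩] with z hz
    exact (s.coord_change i j _ hz.2).symm
  have h2 : HasFDerivAt (fun y => (ContinuousLinearMap.restrictScalarsL ℂ F F ℝ ℝ) (h y)) _ y :=
    (ContinuousLinearMap.restrictScalarsL ℂ F F ℝ ℝ).hasFDerivAt.comp y hhd.hasFDerivAt
  have h3 := (h2.clm_apply hud.hasFDerivAt).fderiv
  have h4 := congrArg (fun T => T (u y)) (D.form_inChart_gauge hy hx v)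
  have h5 : (D.form j).inChart c y v (h y (u y)) =
      h y ((D.form i).inChart c y v (u y)) - fderiv ℝ h y v (u y) := h4
  have h6 : fderiv ℝ (fun y => s.coord j (param c y)) y v =
      h y (fderiv ℝ u y v) + fderiv ℝ h y v (u y) := by
    rw [h1.fderiv_eq, h3]
    rfl
  have h7 : s.coord j (param c y) = h y (u y) := (s.coord_change i j _ hx).symm
  change fderiv ℝ (fun y => s.coord j (param c y)) y v +
      (D.form j).inChart c y v (s.coord j (param c y)) =
    h y (fderiv ℝ u y v + (D.form i).inChart c y v (u y))
  rw [h6, h7, h5, map_add]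
  abel

variable {r : ℕ} {ι κ : Type*}

/-- The potential may be computed in any frame. -/
theorem potential_eq {E : HermitianBundle (2 * m) M (EuclideanSpace ℂ (Fin (r + 1))) ι}
    (D : HermitianConnection E) (s : SmoothSection E) {i : ι} {x : M} (hx : x ∈ E.baseSet i) :
    potential D s x = potentialForm (s.coord i x) (D.covDeriv s i x).toLinearMap
      (D.curvature i x) := by
  have hx' : x ∈ E.baseSet i ∩ E.baseSet (E.indexAt x) := ⟨hx, E.mem_baseSet_at x⟩
  rw [potential, ← s.coord_change i _ x hx']
  refine potentialForm_change_of_frame _ (E.norm_coordChange _ _ x hx') _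
    (fun v => D.covDeriv_gauge s hx' v) fun v => ?_
  have hv : v = ![v 0, v 1] := by
    ext j : 1
    fin_cases j <;> rfl
  rw [hv]
  exact D.curvature_gauge hx' _ _

theorem aemeasurable_potential {E : HermitianBundle (2 * m) M (EuclideanSpace ℂ (Fin (r + 1))) ι}
    (D : HermitianConnection E) (s : SmoothSection E) {i : ι} {c : M}
    {U : Set (EuclideanSpace ℝ (Fin (2 * m)))} (hU : IsOpen U) (hd : U ⊆ dom c)
    (hb : ∀ y ∈ U, param c y ∈ E.baseSet i) (I : Fin (2 * r + 1) → Fin (2 * m)) :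
    AEMeasurable (fun y => potential D s (param c y) fun j =>
      dparam c y (EuclideanSpace.single (I j) 1)) (volume.restrict U) := by
  have hcoord : ContinuousOn (fun y => s.coord i (param c y)) U := fun y hy =>
    (s.contDiffAt_coord (hd hy) (hb y hy)).continuousAt.continuousWithinAt
  have hD : ContinuousOn ((D.covDeriv s i).inChart c) U := fun y hy =>
    (D.contDiffAt_covDeriv s (hd hy) (hb y hy)).continuousAt.continuousWithinAt
  have hA : ∀ y ∈ U, ContDiffAt ℝ ∞ ((D.form i).inChart c) y := fun y hy =>
    (D.smooth_form i).contDiffAt (E.isOpen_baseSet i) (hd hy) (hb y hy)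
  have hA0 : ContinuousOn ((D.form i).inChart c) U := fun y hy =>
    (hA y hy).continuousAt.continuousWithinAt
  have hA1 : ContinuousOn (fderiv ℝ ((D.form i).inChart c)) U := fun y hy =>
    ((hA y hy).fderiv_right (m := 1)
      (by simpa [one_add_one_eq_two] using two_le_infty)).continuousAt.continuousWithinAt
  have hΘ : ∀ v w : EuclideanSpace ℝ (Fin (2 * m)), ContinuousOn (fun y =>
      fderiv ℝ ((D.form i).inChart c) y v w - fderiv ℝ ((D.form i).inChart c) y w v +
        ((D.form i).inChart c y v * (D.form i).inChart c y w -
          (D.form i).inChart c y w * (D.form i).inChart c y v)) U := by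
    intro v w
    have e : ∀ v w, ContinuousOn (fun y => fderiv ℝ ((D.form i).inChart c) y v w) U :=
      fun v w => (hA1.clm_apply continuousOn_const).clm_apply continuousOn_const
    have e' : ∀ v, ContinuousOn (fun y => (D.form i).inChart c y v) U :=
      fun v => hA0.clm_apply continuousOn_const
    exact ((e v w).sub (e w v)).add (((e' v).mul (e' w)).sub ((e' w).mul (e' v)))
  have hproj : ∀ (f : EuclideanSpace ℝ (Fin (2 * m)) → EuclideanSpace ℂ (Fin (r + 1))) (j),
      ContinuousOn f U → AEMeasurable (fun y => f y j) (volume.restrict U) := fun f j hf =>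
    ((EuclideanSpace.proj j : EuclideanSpace ℂ (Fin (r + 1)) →L[ℂ] ℂ).continuous.comp_continuousOn
      hf).aemeasurable hU.measurableSet
  refine (aemeasurable_potentialForm (T := fun y => TangentSpace (𝓡 (2 * m)) (param c y))
    (e := fun y j => dparam c y (EuclideanSpace.single j 1))
    (u := fun y => s.coord i (param c y)) (Du := fun y => (D.covDeriv s i (param c y)).toLinearMap)
    (Θ := fun y => D.curvature i (param c y)) (fun j => hproj _ j hcoord)
    (hcoord.norm.aemeasurable hU.measurableSet)
    (fun a j => hproj _ j (hD.clm_apply continuousOn_const)) (fun J j l => ?_) I).congr ?_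
  · refine (hproj _ l ((hΘ (EuclideanSpace.single (J 0) 1)
      (EuclideanSpace.single (J 1) 1)).clm_apply
        (continuousOn_const (c := EuclideanSpace.single j (1 : ℂ))))).congr ?_
    filter_upwards [ae_restrict_mem hU.measurableSet] with y hy
    rw [← D.curvature_apply (hd hy) (hb y hy)]
    have hv : (fun l => dparam c y (EuclideanSpace.single (J l) 1)) =
        ![dparam c y (EuclideanSpace.single (J 0) 1),
          dparam c y (EuclideanSpace.single (J 1) 1)] := by
      ext l : 1
      fin_cases l <;> rfl
    rw [hv]
  · filter_upwards [ae_restrict_mem hU.measurableSet] with y hy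
    rw [potential_eq D s (hb y hy)]

variable {E : HermitianBundle (2 * m) M (EuclideanSpace ℂ (Fin (r + 1))) ι}
  {L : HermitianBundle (2 * m) M ℂ κ} {DE : HermitianConnection E} {DL : HermitianConnection L}

/-- The curvature `Θ_k = Θ_E - i k Ω` grows like `k`. -/
theorem norm_curvature_tensorPow_le (hL : HasCurvature K DL) {c : M} {i : ι} {a : κ} {B : ℝ}
    {U : Set (EuclideanSpace ℝ (Fin (2 * m)))} (hB : 1 ≤ B)
    (hG : GeometryBounds K DE DL c i a B U) {k : ℕ} (hk : 1 ≤ k)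
    {y : EuclideanSpace ℝ (Fin (2 * m))} (hy : y ∈ U)
    (v : Fin 2 → TangentSpace (𝓡 (2 * m)) (param c y)) :
    ‖(DE.tensorPow DL k).curvature (i, a) (param c y) v‖ ≤
      (2 * B ^ 3) * √(k : ℝ) ^ 2 * ∏ j, √(K.g (param c y) (v j) (v j)) := by
  have hk1 : (1 : ℝ) ≤ k := by exact_mod_cast hk
  have hb := hG.mem_baseSet y hy
  have hd := hG.subset_dom hy
  have hv : v = ![v 0, v 1] := by
    ext j : 1
    fin_cases j <;> rfl
  obtain ⟨w₀, h₀⟩ := dparam_surjective hd (v 0)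
  obtain ⟨w₁, h₁⟩ := dparam_surjective hd (v 1)
  rw [Fin.prod_univ_two, hv, ← h₀, ← h₁, Real.sq_sqrt (by positivity),
    HermitianConnection.curvature_tensorPow (i := (i, a)) _ _ k hb, hL a _ hb.2]
  change _ ≤ 2 * B ^ 3 * (k : ℝ) * (√(K.g (param c y) (dparam c y w₀) (dparam c y w₀)) *
    √(K.g (param c y) (dparam c y w₁) (dparam c y w₁)))
  have h1 := hG.curvature_le y hy w₀ w₁
  have h2 := hG.Ω_le y hy w₀ w₁
  have h3 := hG.le_metric y hy w₀
  have h4 := hG.le_metric y hy w₁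
  set g₀ := √(K.g (param c y) (dparam c y w₀) (dparam c y w₀))
  set g₁ := √(K.g (param c y) (dparam c y w₁) (dparam c y w₁))
  have h5 : ‖((k : ℂ) * (-Complex.I * (K.Ω (param c y) ![dparam c y w₀, dparam c y w₁] : ℂ) * 1)) •
      (1 : EuclideanSpace ℂ (Fin (r + 1)) →L[ℂ] EuclideanSpace ℂ (Fin (r + 1)))‖ ≤
      k * (B * ‖w₀‖ * ‖w₁‖) := by
    rw [norm_smul]
    simp only [norm_mul, norm_neg, Complex.norm_I, one_mul, mul_one, norm_one, Complex.norm_real,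
      Complex.norm_natCast, Real.norm_eq_abs]
    gcongr
  have hB0 : 0 ≤ B := by linarith
  calc _ ≤ B * ‖w₀‖ * ‖w₁‖ + k * (B * ‖w₀‖ * ‖w₁‖) := (norm_add_le _ _).trans (add_le_add h1 h5)
    _ ≤ k * (B * ‖w₀‖ * ‖w₁‖) + k * (B * ‖w₀‖ * ‖w₁‖) := by
      have := le_mul_of_one_le_left (a := (k : ℝ)) (b := B * ‖w₀‖ * ‖w₁‖) (by positivity) hk1
      linarith
    _ = 2 * B * k * (‖w₀‖ * ‖w₁‖) := by ring
    _ ≤ 2 * B * k * ((B * g₀) * (B * g₁)) := by gcongr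
    _ = _ := by ring

/-- At `z = 0` the left side vanishes and the right side is infinite. -/
theorem ofReal_inv_pow_le {G : Type*} [SeminormedAddCommGroup G] (z : G) (n : ℕ) :
    ENNReal.ofReal ((‖z‖ ^ n)⁻¹) ≤ (‖z‖ₑ ^ n)⁻¹ := by
  rcases (pow_nonneg (norm_nonneg z) n).eq_or_lt with h | h
  · simp [← h]
  · rw [ENNReal.ofReal_inv_of_pos h, ENNReal.ofReal_pow (norm_nonneg z), ofReal_norm]

variable (K DE DL) in
/-- The uniform local estimate of the potential: near every point of a chart, `σ_k` is bounded by
`k^{n - 1/2}` times a function whose integral is bounded independently of `k`. -/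
theorem exists_potential_bound (hL : HasCurvature K DL) {c : M}
    {y₀ : EuclideanSpace ℝ (Fin (2 * m))} (hy₀ : y₀ ∈ dom c) {C η : ℝ} (hC : 0 ≤ C) (hη : 0 < η) :
    ∃ R B : ℝ, 0 < R ∧ 0 ≤ B ∧ Metric.ball y₀ R ⊆ dom c ∧
      (∀ y ∈ Metric.ball y₀ R, ∀ v,
        √(K.g (param c y) (dparam c y v) (dparam c y v)) ≤ B * ‖v‖) ∧
      ∀ k : ℕ, 1 ≤ k → ∀ s : SmoothSection (E.tensorPow L k),
        (∀ i a, SectionBounds K DE DL s i a C η) →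
        (∀ I : Fin (2 * r + 1) → Fin (2 * m),
          AEMeasurable (fun y => potential (DE.tensorPow DL k) s (param c y) fun j =>
          dparam c y (EuclideanSpace.single (I j) 1)) (volume.restrict (Metric.ball y₀ R))) ∧
        ∃ f : EuclideanSpace ℝ (Fin (2 * m)) → ℝ, (∀ y, 0 ≤ f y) ∧
          (∀ y ∈ Metric.ball y₀ R, ∀ v, ‖potential (DE.tensorPow DL k) s (param c y) v‖ ≤
            (√(k : ℝ) ^ (2 * r + 1) * f y) * ∏ j, √(K.g (param c y) (v j) (v j))) ∧
          ∫⁻ y in Metric.ball y₀ R, ENNReal.ofReal (f y) ≤ ENNReal.ofReal B := by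
  obtain ⟨B, R, hB, hR, hG⟩ := exists_geometryBounds K DE DL hy₀
    (E.mem_baseSet_at (param c y₀)) (L.mem_baseSet_at (param c y₀))
  set i := E.indexAt (param c y₀)
  set a := L.indexAt (param c y₀)
  have hB' : 1 ≤ B ^ 2 * (1 + C) + B * η⁻¹ := by
    have : 1 * (1 + C) ≤ B ^ 2 * (1 + C) := by gcongr; exact one_le_pow₀ hB
    have : 0 ≤ B * η⁻¹ := by positivity
    linarith
  obtain ⟨C₁, hC₁, h₁⟩ := exists_lintegral_inv_norm_pow_le
    (F := EuclideanSpace ℂ (Fin (r + 1))) (volume : Measure (EuclideanSpace ℝ (Fin (2 * m))))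
    hB' hη hR y₀
  obtain ⟨C₂, hC₂, h₂⟩ := exists_norm_potentialForm_apply_le r (B := C + 2 * B ^ 3) (by positivity)
  have hsub : Metric.ball y₀ R ⊆ Metric.ball y₀ (4 * R) := Metric.ball_subset_ball (by linarith)
  have hfin : Module.finrank ℝ (EuclideanSpace ℂ (Fin (r + 1))) - 1 = 2 * r + 1 := by
    rw [finrank_real_of_complex, finrank_euclideanSpace_fin]
    omega
  rw [hfin] at h₁
  refine ⟨R, B + C₂ * C₁.toReal, hR, by positivity, hsub.trans hG.subset_dom, fun y hy v => ?_,
    fun k hk s hs => ⟨fun I => ?_, fun y => C₂ * (‖s.coord (i, a) (param c y)‖ ^ (2 * r + 1))⁻¹,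
      fun y => by positivity, fun y hy v => ?_, ?_⟩⟩
  · refine (hG.metric_le y (hsub hy) v).trans ?_
    gcongr
    exact le_add_of_nonneg_right (by positivity)
  · exact aemeasurable_potential (DE.tensorPow DL k) s (i := (i, a)) Metric.isOpen_ball
      (hsub.trans hG.subset_dom) (fun y hy => hG.mem_baseSet y (hsub hy)) I
  · have hb := hG.mem_baseSet y (hsub hy)
    rw [potential_eq (i := (i, a)) (DE.tensorPow DL k) s hb]
    have hB0 : 0 ≤ 2 * B ^ 3 := by positivity
    refine (h₂ (TangentSpace (𝓡 (2 * m)) (param c y))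
      (fun v => √(K.g (param c y) v v)) √(k : ℝ) _ _ _
      (Real.sqrt_nonneg _) (fun _ => Real.sqrt_nonneg _)
      (((hs i a).norm_le _ hb).trans (by linarith)) (fun v => ?_) (fun v => ?_)
        v).trans_eq (by ring)
    · refine ((hs i a).covDeriv_le _ hb v).trans ?_
      rw [K.len_eq, ← mul_assoc]
      gcongr
      linarith
    · refine (norm_curvature_tensorPow_le hL hB hG hk (hsub hy) v).trans ?_
      gcongr
      linarith
  · have h3 := h₁ √(k : ℝ) _ _ _ _ _ (Real.one_le_sqrt.2 (by exact_mod_cast hk))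
      ((hs i a).transverseBounds hk hC hη hB hG)
    calc _ ≤ ∫⁻ y in Metric.ball y₀ R, ENNReal.ofReal C₂ *
          (‖s.coord (i, a) (param c y)‖ₑ ^ (2 * r + 1))⁻¹ := by
          refine lintegral_mono fun y => ?_
          rw [ENNReal.ofReal_mul hC₂]
          gcongr
          exact ofReal_inv_pow_le _ _
      _ = ENNReal.ofReal C₂ * ∫⁻ y in Metric.ball y₀ R,
          (‖s.coord (i, a) (param c y)‖ₑ ^ (2 * r + 1))⁻¹ :=
          lintegral_const_mul' _ _ ENNReal.ofReal_ne_top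
      _ ≤ ENNReal.ofReal C₂ * C₁ := by gcongr
      _ = ENNReal.ofReal (C₂ * C₁.toReal) := by
          rw [ENNReal.ofReal_mul hC₂, ENNReal.ofReal_toReal hC₁]
      _ ≤ _ := ENNReal.ofReal_le_ofReal (by linarith)

end PotentialEstimate

/-! ### The currents -/

section Currents

variable {m : ℕ} {M : Type*} [TopologicalSpace M]
  [ChartedSpace (EuclideanSpace ℝ (Fin (2 * m))) M] (K : AlmostKahler m M)

/-- The infimum defining the sup norm is attained, as soon as the form is bounded. -/
theorem AlmostKahler.norm_apply_le_supNorm {p : ℕ} {ψ : DForm (2 * m) M p ℂ}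
    (hψ : ∃ B : ℝ, 0 ≤ B ∧ ∀ x v, ‖ψ x v‖ ≤ B * ∏ i, √(K.g x (v i) (v i))) (x : M)
    (v : Fin p → TangentSpace (𝓡 (2 * m)) x) :
    ‖ψ x v‖ ≤ K.supNorm ψ * ∏ i, √(K.g x (v i) (v i)) := by
  have hP : 0 ≤ ∏ i, √(K.g x (v i) (v i)) := Finset.prod_nonneg fun _ _ => Real.sqrt_nonneg _
  rcases hP.eq_or_lt with h | h
  · obtain ⟨B, -, hB⟩ := hψ
    have := hB x v
    rwa [← h, mul_zero] at this ⊢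
  · rw [← div_le_iff₀ h]
    exact le_csInf hψ fun B hB => (div_le_iff₀ h).2 (hB.2 x v)

theorem AlmostKahler.supNorm_nonneg {p : ℕ} (ψ : DForm (2 * m) M p ℂ) : 0 ≤ K.supNorm ψ :=
  Real.sInf_nonneg fun _ h => h.1

variable [IsManifold (𝓡 (2 * m)) ∞ M]

/-- The exterior derivative of a smooth form on a compact manifold is bounded, so that its sup norm
is an infimum over a nonempty set. -/
theorem AlmostKahler.exists_forall_norm_extD_le [CompactSpace M] {p : ℕ}
    {φ : DForm (2 * m) M p ℂ} (hφ : φ.SmoothOn univ) :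
    ∃ B : ℝ, 0 ≤ B ∧ ∀ x v, ‖φ.extD x v‖ ≤ B * ∏ i, √(K.g x (v i) (v i)) := by
  have hP : ∀ (x : M) (v : Fin (p + 1) → TangentSpace (𝓡 (2 * m)) x),
      0 ≤ ∏ i, √(K.g x (v i) (v i)) := fun x v => Finset.prod_nonneg fun _ _ => Real.sqrt_nonneg _
  suffices h : ∃ B : ℝ, 0 ≤ B ∧ ∀ x ∈ (univ : Set M), ∀ v,
      ‖φ.extD x v‖ ≤ B * ∏ i, √(K.g x (v i) (v i)) by simpa using h
  refine isCompact_univ.induction_on (p := fun s => ∃ B : ℝ, 0 ≤ B ∧ ∀ x ∈ s, ∀ v,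
    ‖φ.extD x v‖ ≤ B * ∏ i, √(K.g x (v i) (v i))) ?_ ?_ ?_ ?_
  · exact ⟨0, le_rfl, fun x hx => hx.elim⟩
  · rintro s t hst ⟨B, hB, h⟩
    exact ⟨B, hB, fun x hx => h x (hst hx)⟩
  · rintro s t ⟨B, hB, h⟩ ⟨B', hB', h'⟩
    refine ⟨B + B', by positivity, fun x hx v => ?_⟩
    have := hP x v
    rcases hx with hx | hx
    · exact (h x hx v).trans (by gcongr; linarith)
    · exact (h' x hx v).trans (by gcongr; linarith)
  · intro x _
    rw [nhdsWithin_univ]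
    have hxs := mem_extChartAt_source (I := 𝓡 (2 * m)) x
    have hy₀ : extChartAt (𝓡 (2 * m)) x x ∈ dom x := extChartAt_mem_dom hxs
    have hcont : ContinuousAt (φ.extD.inChart x) (extChartAt (𝓡 (2 * m)) x x) := by
      have h1 : ContinuousAt (fderiv ℝ (φ.inChart x)) (extChartAt (𝓡 (2 * m)) x x) :=
        ((hφ.contDiffAt isOpen_univ hy₀ (mem_univ _)).fderiv_right (m := 1)
          (by simpa [one_add_one_eq_two] using two_le_infty)).continuousAt
      have h2 : ContinuousAt (extDeriv (φ.inChart x)) (extChartAt (𝓡 (2 * m)) x x) :=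
        (ContinuousAlternatingMap.alternatizeUncurryFinCLM ℝ (EuclideanSpace ℝ (Fin (2 * m)))
          ℂ).continuous.continuousAt.comp h1
      refine h2.congr ?_
      filter_upwards [(isOpen_dom x).mem_nhds hy₀] with y hy
      exact (hφ.extD_inChart isOpen_univ hy (mem_univ _)).symm
    obtain ⟨B, hB⟩ := eventually_norm_le_of_continuousAt hcont
    obtain ⟨B', hB'⟩ := K.exists_metric_comparison hy₀
    have hev := (continuousAt_extChartAt x).eventually (hB.and hB')
    refine ⟨_, (hev.and (extChartAt_source_mem_nhds (I := 𝓡 (2 * m)) x)), |B| * |B'| ^ (p + 1),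
      by positivity, ?_⟩
    rintro x' ⟨⟨h1, h2⟩, hx'⟩ v
    set y := extChartAt (𝓡 (2 * m)) x x' with hy
    have hyd : y ∈ dom x := extChartAt_mem_dom hx'
    have hyx : param x y = x' := param_extChartAt hx'
    clear_value y
    subst hyx
    choose w hw using fun i => dparam_surjective hyd (v i)
    obtain rfl : (fun i => dparam x y (w i)) = v := funext hw
    calc _ ≤ ‖φ.extD.inChart x y‖ * ∏ i, ‖w i‖ := (φ.extD.inChart x y).le_opNorm w
      _ ≤ |B| * ∏ i, (|B'| * √(K.g (param x y) (dparam x y (w i)) (dparam x y (w i)))) := by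
        gcongr with i
        · exact h1.trans (le_abs_self B)
        · refine (h2 (w i)).2.trans ?_
          gcongr
          exact le_abs_self B'
      _ = _ := by
        rw [Finset.prod_mul_distrib, Finset.prod_const, Finset.card_univ, Fintype.card_fin]
        ring

theorem lintegral_enorm_le_of_norm_le {Y G : Type*} [MeasurableSpace Y] {μ : Measure Y}
    [SeminormedAddCommGroup G] {h : Y → G} {f : Y → ℝ} {t B : ℝ} {S : Set Y} (hS : MeasurableSet S)
    (ht : 0 ≤ t) (hh : ∀ y ∈ S, ‖h y‖ ≤ t * f y)
    (hf : ∫⁻ y in S, ENNReal.ofReal (f y) ∂μ ≤ ENNReal.ofReal B) :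
    ∫⁻ y in S, ‖h y‖ₑ ∂μ ≤ ENNReal.ofReal (t * B) := by
  calc _ ≤ ∫⁻ y in S, ENNReal.ofReal t * ENNReal.ofReal (f y) ∂μ := by
        refine setLIntegral_mono' hS fun y hy => ?_
        rw [← ENNReal.ofReal_mul ht, ← ofReal_norm]
        exact ENNReal.ofReal_le_ofReal (hh y hy)
    _ = ENNReal.ofReal t * ∫⁻ y in S, ENNReal.ofReal (f y) ∂μ :=
        lintegral_const_mul' _ _ ENNReal.ofReal_ne_top
    _ ≤ ENNReal.ofReal t * ENNReal.ofReal B := by gcongr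
    _ = _ := (ENNReal.ofReal_mul ht).symm

variable {r : ℕ} {ι κ : Type*}
  {E : HermitianBundle (2 * m) M (EuclideanSpace ℂ (Fin (r + 1))) ι}
  {L : HermitianBundle (2 * m) M ℂ κ} (DE : HermitianConnection E) (DL : HermitianConnection L)
  {C η : ℝ}

variable {K DE DL} in
/-- The coefficients of the potential are measurable, and dominated by an integrable function near
each point. -/
theorem isLocallyIntegrable_potential (hL : HasCurvature K DL) (hC : 0 ≤ C) (hη : 0 < η) {k : ℕ}
    (hk : 1 ≤ k) {s : SmoothSection (E.tensorPow L k)}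
    (hs : ∀ i a, SectionBounds K DE DL s i a C η) :
    IsLocallyIntegrable (potential (DE.tensorPow DL k) s) := by
  intro c I y₀ hy₀
  obtain ⟨R, B, hR, hB, hd, hg, h⟩ := exists_potential_bound K DE DL hL hy₀ hC hη
  obtain ⟨hmeas, f, hf, hσ, hint⟩ := h k hk s hs
  refine ⟨Metric.ball y₀ R, mem_nhdsWithin_of_mem_nhds (Metric.ball_mem_nhds y₀ hR),
    (hmeas I).aestronglyMeasurable, ?_⟩
  refine (lintegral_enorm_le_of_norm_le (t := √(k : ℝ) ^ (2 * r + 1) * B ^ (2 * r + 1)) (f := f)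
    measurableSet_ball (by positivity) (fun y hy => ?_) hint).trans_lt ENNReal.ofReal_lt_top
  refine (hσ y hy _).trans ?_
  have h1 : ∏ j, √(K.g (param c y) (dparam c y (EuclideanSpace.single (I j) 1))
      (dparam c y (EuclideanSpace.single (I j) 1))) ≤ B ^ (2 * r + 1) := by
    refine (Finset.prod_le_prod (fun _ _ => Real.sqrt_nonneg _) fun j _ =>
      hg y hy (EuclideanSpace.single (I j) 1)).trans_eq ?_
    simp
  have := hf y
  calc _ ≤ (√(k : ℝ) ^ (2 * r + 1) * f y) * B ^ (2 * r + 1) := by gcongr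
    _ = _ := by ring

/-- The local estimates add up over the finitely many balls that cover a compact set of a chart. -/
theorem exists_lintegral_wedge_potential_le (hL : HasCurvature K DL) (hC : 0 ≤ C) (hη : 0 < η)
    {q : ℕ} (h : 2 * r + 1 + q = 2 * m) (c : M) {S : Set (EuclideanSpace ℝ (Fin (2 * m)))}
    (hS : IsCompact S) (hSd : S ⊆ dom c) :
    ∃ A : ℝ, 0 ≤ A ∧ ∀ k : ℕ, 1 ≤ k → ∀ s : SmoothSection (E.tensorPow L k),
      (∀ i a, SectionBounds K DE DL s i a C η) → ∀ (ψ : DForm (2 * m) M q ℂ) (b : ℝ), 0 ≤ b →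
      (∀ x v, ‖ψ x v‖ ≤ b * ∏ i, √(K.g x (v i) (v i))) →
      ∫⁻ y in S, ‖(wedge (potential (DE.tensorPow DL k) s (param c y))
        (ψ (param c y)).toAlternatingMap).domDomCongr (finCongr h)
          fun j => dparam c y (EuclideanSpace.single j 1)‖ₑ ≤
        ENNReal.ofReal (A * (√(k : ℝ) ^ (2 * r + 1) * b)) := by
  refine hS.induction_on (p := fun S => ∃ A : ℝ, 0 ≤ A ∧ ∀ k : ℕ, 1 ≤ k →
    ∀ s : SmoothSection (E.tensorPow L k),
      (∀ i a, SectionBounds K DE DL s i a C η) → ∀ (ψ : DForm (2 * m) M q ℂ) (b : ℝ), 0 ≤ b →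
      (∀ x v, ‖ψ x v‖ ≤ b * ∏ i, √(K.g x (v i) (v i))) →
      ∫⁻ y in S, ‖(wedge (potential (DE.tensorPow DL k) s (param c y))
        (ψ (param c y)).toAlternatingMap).domDomCongr (finCongr h)
          fun j => dparam c y (EuclideanSpace.single j 1)‖ₑ ≤
        ENNReal.ofReal (A * (√(k : ℝ) ^ (2 * r + 1) * b))) ?_ ?_ ?_ ?_
  · exact ⟨0, le_rfl, fun k _ s _ ψ b _ _ => by simp⟩
  · rintro S T hST ⟨A, hA, hT⟩
    exact ⟨A, hA, fun k hk s hs ψ b hb hψ =>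
      (lintegral_mono_set hST).trans (hT k hk s hs ψ b hb hψ)⟩
  · rintro S T ⟨A, hA, hS⟩ ⟨A', hA', hT⟩
    refine ⟨A + A', by positivity, fun k hk s hs ψ b hb hψ => ?_⟩
    refine (lintegral_union_le _ _ _).trans ?_
    rw [add_mul, ENNReal.ofReal_add (by positivity) (by positivity)]
    exact add_le_add (hS k hk s hs ψ b hb hψ) (hT k hk s hs ψ b hb hψ)
  · intro y₀ hy₀
    obtain ⟨R, B, hR, hB, hd, hg, hp⟩ := exists_potential_bound K DE DL hL (hSd hy₀) hC hη
    refine ⟨Metric.ball y₀ R, mem_nhdsWithin_of_mem_nhds (Metric.ball_mem_nhds y₀ hR),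
      (2 * r + 1 + q).factorial * B ^ (2 * r + 1 + q) * B, by positivity,
      fun k hk s hs ψ b hb hψ => ?_⟩
    obtain ⟨-, f, hf, hσ, hint⟩ := hp k hk s hs
    refine (lintegral_enorm_le_of_norm_le (f := f) (t := (2 * r + 1 + q).factorial *
      B ^ (2 * r + 1 + q) * (√(k : ℝ) ^ (2 * r + 1) * b)) measurableSet_ball (by positivity)
      (fun y hy => ?_) hint).trans_eq (by congr 1; ring)
    have := hf y
    have h1 := norm_wedge_apply_le (N := fun v => √(K.g (param c y) v v)) (by positivity)
      (fun _ => Real.sqrt_nonneg _) (hσ y hy) (β := (ψ (param c y)).toAlternatingMap)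
      (hψ (param c y)) fun j => dparam c y (EuclideanSpace.single (finCongr h j) 1)
    refine h1.trans ?_
    have h2 : ∏ j, √(K.g (param c y) (dparam c y (EuclideanSpace.single (finCongr h j) 1))
        (dparam c y (EuclideanSpace.single (finCongr h j) 1))) ≤ B ^ (2 * r + 1 + q) := by
      refine (Finset.prod_le_prod (fun _ _ => Real.sqrt_nonneg _) fun j _ =>
        hg y hy (EuclideanSpace.single (finCongr h j) 1)).trans_eq ?_
      simp
    calc _ ≤ ((2 * r + 1 + q).factorial : ℝ) * (√(k : ℝ) ^ (2 * r + 1) * f y * b) *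
          B ^ (2 * r + 1 + q) := by gcongr
      _ = _ := by ring

variable [CompactSpace M] [T2Space M]

theorem partition_isSubordinate (m : ℕ) (M : Type*) [TopologicalSpace M]
    [ChartedSpace (EuclideanSpace ℝ (Fin (2 * m))) M] [IsManifold (𝓡 (2 * m)) ∞ M]
    [CompactSpace M] [T2Space M] (c : M) :
    tsupport (AlmostKahler.partition m M c) ⊆ (extChartAt (𝓡 (2 * m)) c).source := by
  rw [extChartAt_source]
  exact (SmoothPartitionOfUnity.exists_isSubordinate_chartAt_source (𝓡 (2 * m)) M).choose_spec c

/-- The uniform bound of the currents defined by the potentials, as functionals on bounded forms. -/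
theorem exists_norm_current_le (hL : HasCurvature K DL) (hC : 0 ≤ C) (hη : 0 < η)
    {q : ℕ} (h : 2 * r + 1 + q = 2 * m) :
    ∃ A : ℝ, 0 ≤ A ∧ ∀ k : ℕ, 1 ≤ k → ∀ s : SmoothSection (E.tensorPow L k),
      (∀ i a, SectionBounds K DE DL s i a C η) → ∀ (ψ : DForm (2 * m) M q ℂ) (b : ℝ), 0 ≤ b →
      (∀ x v, ‖ψ x v‖ ≤ b * ∏ i, √(K.g x (v i) (v i))) →
      ‖K.current h (potential (DE.tensorPow DL k) s) ψ‖ ≤ A * (√(k : ℝ) ^ (2 * r + 1) * b) := by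
  set ρ := AlmostKahler.partition m M with hρ
  have hcpt : ∀ c, IsCompact (extChartAt (𝓡 (2 * m)) c '' tsupport (ρ c)) := fun c =>
    (isClosed_tsupport _).isCompact.image_of_continuousOn
      ((continuousOn_extChartAt c).mono (partition_isSubordinate m M c))
  have hsub : ∀ c, extChartAt (𝓡 (2 * m)) c '' tsupport (ρ c) ⊆ dom c := by
    rintro c _ ⟨x, hx, rfl⟩
    exact extChartAt_mem_dom (partition_isSubordinate m M c hx)
  choose A hA hA' using fun c =>
    exists_lintegral_wedge_potential_le K DE DL hL hC hη h c (hcpt c) (hsub c)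
  -- only finitely many functions of the partition are nonzero
  have hfin : {c : M | (Function.support (ρ c)).Nonempty}.Finite :=
    ρ.locallyFinite.finite_nonempty_of_compact
  refine ⟨∑ c ∈ hfin.toFinset, A c, Finset.sum_nonneg fun c _ => hA c,
    fun k hk s hs ψ b hb hψ => ?_⟩
  rw [AlmostKahler.current, AlmostKahler.integral, ← hρ,
    finsum_eq_sum_of_support_subset (s := hfin.toFinset), Finset.sum_mul]
  · refine norm_sum_le_of_le _ fun c _ => ?_
    have h0 : 0 ≤ A c * (√(k : ℝ) ^ (2 * r + 1) * b) := mul_nonneg (hA c) (by positivity)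
    rw [← ENNReal.ofReal_le_ofReal_iff h0, ofReal_norm]
    refine (enorm_integral_le_lintegral_enorm _).trans (le_trans ?_ (hA' c k hk s hs ψ b hb hψ))
    rw [← lintegral_indicator (isOpen_dom c).measurableSet,
      ← lintegral_indicator (hcpt c).isClosed.measurableSet]
    refine lintegral_mono fun y => ?_
    by_cases hyd : y ∈ dom c
    · rw [indicator_of_mem hyd]
      by_cases hy : y ∈ extChartAt (𝓡 (2 * m)) c '' tsupport (ρ c)
      · rw [indicator_of_mem hy, enorm_mul]
        -- the partition of unity and the orientation sign are bounded by `1`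
        refine mul_le_of_le_one_left zero_le ?_
        rw [← ofReal_norm, ENNReal.ofReal_le_one, Complex.norm_real, norm_mul]
        have h1 : ‖ρ c (param c y)‖ ≤ 1 := by
          rw [Real.norm_of_nonneg (ρ.nonneg _ _)]
          exact ρ.le_one _ _
        have h2 : ‖K.orient c y‖ ≤ 1 := by
          rw [AlmostKahler.orient]
          rcases SignType.trichotomy (SignType.sign (twoFormPow
            (K.Ω (param c y)).toAlternatingMap m
              fun j => dparam c y (EuclideanSpace.single j 1))) with h | h | h <;> simp [h]
        exact mul_le_one₀ h1 (norm_nonneg _) h2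
      · have h1 : ρ c (param c y) = 0 := by
          by_contra h2
          exact hy ⟨param c y, subset_tsupport _ h2, extChartAt_param hyd⟩
        simp [h1]
    · rw [indicator_of_notMem hyd]
      exact zero_le
  · intro c hc
    rw [Set.Finite.coe_toFinset]
    by_contra h1
    refine hc ?_
    have h2 : ∀ x, ρ c x = 0 := fun x => by
      by_contra h3
      exact h1 ⟨x, h3⟩
    simp [h2]

end Currents

end HL

theorem mainTheorem4
    {m r p : ℕ} (hp : 2 * (r + 1) + p = 2 * m)
    {M : Type*} [TopologicalSpace M] [T2Space M] [CompactSpace M]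
    [ChartedSpace (EuclideanSpace ℝ (Fin (2 * m))) M] [IsManifold (𝓡 (2 * m)) ∞ M]
    (K : HL.AlmostKahler m M) {ι κ : Type*}
    (E : HL.HermitianBundle (2 * m) M (EuclideanSpace ℂ (Fin (r + 1))) ι)
    (DE : HL.HermitianConnection E)
    (L : HL.HermitianBundle (2 * m) M ℂ κ) (DL : HL.HermitianConnection L) (hL : HL.HasCurvature K DL)
    (s : ∀ k : ℕ, HL.SmoothSection (E.tensorPow L k)) (k₀ : ℕ)
    (hs : HL.AsymptoticBounds K DE DL s) (hη : HL.UniformlyTransverse K DE DL k₀ s) :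
    ∃ C : ℝ, 0 < C ∧ ∀ k : ℕ, 1 ≤ k → k₀ ≤ k →
      HL.IsLocallyIntegrable (HL.potential (DE.tensorPow DL k) (s k)) ∧
      ∀ φ : HL.DForm (2 * m) M p ℂ, φ.SmoothOn univ →
        1 / (k : ℝ) ^ (r + 1) *
            ‖K.dCurrent (HL.degree_eq hp) (HL.potential (DE.tensorPow DL k) (s k)) φ‖ ≤
          C * (k : ℝ) ^ (-(1 / 2) : ℝ) * K.supNorm φ.extD := by
  obtain ⟨C, hC⟩ := hs
  obtain ⟨η, hη0, hη⟩ := hη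
  have hlen : ∀ (k : ℕ) (x : M) v, 0 ≤ K.len k x v := fun _ _ _ => Real.sqrt_nonneg _
  -- the constant `C` of the asymptotic bounds is replaced by `|C|`, as its sign is not known
  have hsec : ∀ k, 1 ≤ k → k₀ ≤ k → ∀ i a, HL.SectionBounds K DE DL (s k) i a |C| η := by
    intro k hk hk₀ i a
    obtain ⟨h1, h2⟩ := hC k hk (i, a)
    refine ⟨fun x hx => (h1 x hx).1.trans (le_abs_self C), fun x hx v => ?_,
      fun c y hy hb v w => ?_, fun x hx => hη k hk hk₀ (i, a) x hx⟩
    · refine ((h1 x hx).2.1 v).trans ?_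
      have := hlen k x v
      gcongr
      exact le_abs_self C
    · refine (h2 c y hy hb v w).1.trans ?_
      have := hlen k (HL.param c y) (HL.dparam c y v)
      have := hlen k (HL.param c y) (HL.dparam c y w)
      gcongr
      exact le_abs_self C
  obtain ⟨A, hA, hcur⟩ := HL.exists_norm_current_le K DE DL hL (abs_nonneg C) hη0 (HL.degree_eq hp)
  -- `A` may vanish
  refine ⟨A + 1, by positivity, fun k hk hk₀ => ⟨HL.isLocallyIntegrable_potential hL (abs_nonneg C)
    hη0 hk (hsec k hk hk₀), fun φ hφ => ?_⟩⟩
  have hk0 : (0 : ℝ) < k := by exact_mod_cast hk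
  have hτ : 0 < √(k : ℝ) := Real.sqrt_pos.2 hk0
  have hS := K.supNorm_nonneg φ.extD
  have h1 := hcur k hk (s k) (hsec k hk hk₀) φ.extD _ hS
    (K.norm_apply_le_supNorm (K.exists_forall_norm_extD_le hφ))
  have h2 : (k : ℝ) ^ (-(1 / 2) : ℝ) = (√(k : ℝ))⁻¹ := by
    rw [Real.rpow_neg hk0.le, Real.sqrt_eq_rpow]
  -- dividing by `k ^ n` leaves one factor `√k` in the denominator
  have h3 : (k : ℝ) ^ (r + 1) = √(k : ℝ) ^ (2 * r + 1) * √(k : ℝ) := by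
    rw [← pow_succ, show 2 * r + 1 + 1 = 2 * (r + 1) by ring, pow_mul, Real.sq_sqrt hk0.le]
  rw [HL.AlmostKahler.dCurrent, norm_mul, norm_pow, norm_neg, norm_one, one_pow, one_mul, h2, h3]
  calc _ ≤ 1 / (√(k : ℝ) ^ (2 * r + 1) * √(k : ℝ)) *
        (A * (√(k : ℝ) ^ (2 * r + 1) * K.supNorm φ.extD)) := by gcongr
    _ = A * (√(k : ℝ))⁻¹ * K.supNorm φ.extD := by field_simp
    _ ≤ _ := by gcongr; linarith
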